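/- Let $c>0$ and let $f,g\colon[0,1]\to[0,\infty)$ be smooth, with $g>0$ on $[0,1]$. For $n,k\in\mathbb N$ put $x_i=f(i/n)$ $(1\le i\le n)$ and $y_j=g(j/k)$ $(1\le j\le k)$, and let $\lambda=(\lambda_1\ge\dots\ge\lambda_n\ge 0)$ be a random partition with $\lambda_1\le k$, distributed according to the dual Schur measure $$\mu_{n,k}(\lambda)=\prod_{i=1}^n\prod_{j=1}^k(1+x_iy_j)^{-1}\; s_\lambda(x_1,\dots,x_n)\,s_{\lambda'}(y_1,\dots,y_k),$$ where $s_\lambda$ is the Schur polynomial and $\lambda'$ the conjugate partition. Let $$\Phi(z)=\int_0^1\frac{f(s)z}{1-f(s)z}\,ds+c\int_0^1\frac{g(s)}{z+g(s)}\,ds ,$$ and let $x_+$ be the largest of the values $\Phi(z)$ over those real $z$ (with $1-f(s)z\ne0\ne z+g(s)$ for all $s\in[0,1]$) at which $\Phi'(z)=\int_0^1\frac{f(s)}{(1-f(s)z)^2}ds-c\int_0^1\frac{g(s)}{(z+g(s))^2}ds=0$; this is the right end of the support of the limit shape of $\lambda$. Then $x_+=c$ (the critical full-support case) if and only if $\int_0^1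 f(s)\,ds=c\int_0^1\frac{ds}{g(s)}$. Suppose this holds, and let $k=k(n)$ satisfy $k(n)-nc=o(\sqrt n)$ as $n\to\infty$. Then for every $\Delta\in\mathbb N$ $$\lim_{n\to\infty}\mathbb P(\lambda_1-k(n)\le-\Delta)=\det_{0\le i,j\le\Delta-1}\bigl(\delta_{i,j}-K_{\rm crit}(i,j)\bigr),$$ and, if moreover $k(n)=\lfloor nc\rfloor$ for all large $n$ (for instance $k(n)=nc$ when $c$ is an integer), $$\lim_{n\to\infty}\mathbb P(\lambda_1-nc\le-\Delta)=\det_{0\le i,j\le\Delta-1}\bigl(\delta_{i,j}-K_{\rm crit}(i,j)\bigr).$$ Here $$K_{\rm crit}(i,j)=\sum_{\ell=0}^{\lfloor(\Delta-j-1)/2\rfloor}\begin{cases}\dfrac1{2\pi}\,\dfrac1{\ell!}\,\sin\!\Bigl(\dfrac{\pi(j-i)}2\Bigr)\,\Gamma\!\Bigl(\ell+\dfrac{j-i}2\Bigr), & \text{if } \ell+\frac{j-i}2\notin\mathbb Z_{\le0},\\[2mm] \dfrac12\,\dfrac{(-1)^\ell}{\ell!\,\bigl(\frac{i-j}2-\ell\bigr)!},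 & \text{if } \ell+\frac{j-i}2\in\mathbb Z_{\le0}.\end{cases}$$ -/

import Mathlib

open Filter Topology
open scoped ContDiff

noncomputable section

/-- The complete homogeneous symmetric polynomial `h_r` evaluated at `x = (x_1, …, x_n)`. -/
def completeHomog {n : ℕ} (x : Fin n → ℝ) (r : ℕ) : ℝ :=
  MvPolynomial.eval x (MvPolynomial.hsymm (Fin n) ℝ r)

/-- The Schur polynomial `s_lam(x_1, …, x_n)` of a partition `lam = (lam_1 ≥ … ≥ lam_n ≥ 0)` with
at most `n` parts, as the Jacobi–Trudi determinant `det (h_{lam_i - i + j}(x))`, where `h_r = 0`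
for `r < 0`. -/
def schurPoly {n : ℕ} (x : Fin n → ℝ) (lam : Fin n → ℕ) : ℝ :=
  Matrix.det (Matrix.of fun i j : Fin n =>
    if (i : ℕ) ≤ lam i + j then completeHomog x (lam i + j - i) else 0)

/-- The conjugate partition `lam'` of a partition `lam` contained in the `n × k` rectangle:
`lam'_j` is the number of rows `i` with `lam_i ≥ j` (here `j` is counted from `0`). -/
def conjPartition {n k : ℕ} (lam : Fin n → Fin (k + 1)) : Fin k → ℕ := fun j =>
  (Finset.univ.filter fun i : Fin n => (j : ℕ) < (lam i : ℕ)).card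

/-- The dual Schur measure of a single partition `lam` contained in the `n × k` rectangle:
`∏_{i,j} (1 + x_i y_j)⁻¹ * s_lam(x) * s_{lam'}(y)`. -/
def dualSchurWeight {n k : ℕ} (x : Fin n → ℝ) (y : Fin k → ℝ) (lam : Fin n → Fin (k + 1)) : ℝ :=
  (∏ i, ∏ j, (1 + x i * y j)⁻¹) * schurPoly x (fun i => (lam i : ℕ)) *
    schurPoly y (conjPartition lam)

open Classical in
/-- The probability, under the dual Schur measure, of an event `E`. Partitions contained in the
`n × k` rectangle are the weakly decreasing `lam : Fin n → {0, …, k}`. -/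
def dualSchurProb {n k : ℕ} (x : Fin n → ℝ) (y : Fin k → ℝ)
    (E : (Fin n → Fin (k + 1)) → Prop) : ℝ :=
  ∑ lam : Fin n → Fin (k + 1), if Antitone lam ∧ E lam then dualSchurWeight x y lam else 0

/-- The first (largest) part `lam_1`; it is `0` if there are no rows. -/
def firstPart {n k : ℕ} (lam : Fin n → Fin (k + 1)) : ℕ :=
  if h : 0 < n then (lam ⟨0, h⟩ : ℕ) else 0

/-- The parameters `φ(1/n), φ(2/n), …, φ(n/n)`. -/
def sampled (φ : ℝ → ℝ) (n : ℕ) : Fin n → ℝ := fun i => φ (((i : ℕ) + 1 : ℝ) / n)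

/-- `z ∂_z S(z) + t`, where `S` is the limiting action at level `t`:
`∫ f z / (1 - f z) + c ∫ g / (z + g)`. -/
def edgeFunction (f g : ℝ → ℝ) (c z : ℝ) : ℝ :=
  (∫ s in (0 : ℝ)..1, f s * z / (1 - f s * z)) + c * ∫ s in (0 : ℝ)..1, g s / (z + g s)

/-- `z` is a real double critical point of the action (at the level `t = edgeFunction f g c z`):
it is not a pole, and the derivative of `edgeFunction f g c` at `z`, that is
`∫ f / (1 - f z)^2 - c ∫ g / (z + g)^2`, is zero. -/
def IsDoubleCritical (f g : ℝ → ℝ) (c z : ℝ) : Prop :=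
  (∀ s ∈ Set.Icc (0 : ℝ) 1, 1 - f s * z ≠ 0 ∧ z + g s ≠ 0) ∧
  (∫ s in (0 : ℝ)..1, f s / (1 - f s * z) ^ 2) - c * (∫ s in (0 : ℝ)..1, g s / (z + g s) ^ 2) = 0

/-- `x` is the right end `x_+` of the support `[x_-, x_+]` of the limit shape: the largest level
at which the action has a real double critical point. -/
def IsRightEdge (f g : ℝ → ℝ) (c x : ℝ) : Prop :=
  IsGreatest {t : ℝ | ∃ z : ℝ, IsDoubleCritical f g c z ∧ t = edgeFunction f g c z} x

open scoped Nat in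
/-- The entry `K_crit(i, j)` of the critical kernel of size `Δ`, `0 ≤ i, j ≤ Δ - 1`. The condition
says that `ℓ + (j - i) / 2` is an integer `≤ 0`; then the integer divisions are exact, and the
argument of the factorial is `(i - j) / 2 - ℓ ≥ 0`. -/
def criticalKernel (Δ i j : ℕ) : ℝ :=
  ∑ l ∈ Finset.range ((Δ - j - 1) / 2 + 1),
    if Even ((j : ℤ) - i) ∧ (l : ℤ) + ((j : ℤ) - i) / 2 ≤ 0 then
      1 / 2 * ((-1) ^ l / ((l ! : ℝ) * ((((i : ℤ) - j) / 2 - l).toNat ! : ℝ)))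
    else
      1 / (2 * Real.pi) * (1 / (l ! : ℝ)) * Real.sin (Real.pi * ((j : ℝ) - i) / 2) *
        Real.Gamma (l + ((j : ℝ) - i) / 2)

/-- `det_{0 ≤ i, j ≤ Δ - 1} (δ_{ij} - K_crit(i, j))`. -/
def criticalDet (Δ : ℕ) : ℝ :=
  Matrix.det (Matrix.of fun i j : Fin Δ =>
    (if i = j then (1 : ℝ) else 0) - criticalKernel Δ i j)

end

noncomputable section

/-! ### Generating function of the complete homogeneous symmetric polynomials -/

theorem completeHomog_eq_sum {n : ℕ} (x : Fin n → ℝ) (r : ℕ) :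
    completeHomog x r =
      ∑ P ∈ Finset.univ.finsuppAntidiag r, ∏ i, x i ^ (P i : ℕ) := by
  unfold completeHomog MvPolynomial.hsymm
  rw [map_sum]
  refine Finset.sum_bij' (fun s _ => Multiset.toFinsupp (s : Multiset (Fin n)))
    (fun P hP => ⟨Finsupp.toMultiset P, ?_⟩) ?_ ?_ ?_ ?_ ?_
  · rw [Finset.mem_finsuppAntidiag] at hP
    rw [Finsupp.card_toMultiset, Finsupp.sum_fintype _ _ (by simp)]
    exact hP.1
  · intro s _
    rw [Finset.mem_finsuppAntidiag]
    refine ⟨?_, Finset.subset_univ _⟩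
    have := Multiset.toFinset_sum_count_eq (s : Multiset (Fin n))
    refine Eq.trans ?_ (this.trans s.2)
    symm
    refine Finset.sum_subset (Finset.subset_univ _) fun i _ hi => ?_
    rwa [Multiset.mem_toFinset, ← Multiset.count_eq_zero] at hi
  · intro P _
    exact Finset.mem_univ _
  · intro s _
    exact Subtype.ext (Multiset.toFinsupp_toMultiset _)
  · intro P _
    exact Finsupp.toMultiset_toFinsupp _
  · intro s _
    rw [map_multiset_prod, Multiset.map_map]
    simp only [Function.comp_def, MvPolynomial.eval_X]
    rw [Finset.prod_multiset_map_count]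
    simp only [Multiset.toFinsupp_apply]
    exact Finset.prod_subset (Finset.subset_univ _) (by
      intro i _ hi
      rw [Multiset.mem_toFinset, ← Multiset.count_eq_zero] at hi
      exact (congrArg (x i ^ ·) hi).trans (pow_zero _))

theorem completeHomog_neg {n : ℕ} (x : Fin n → ℝ) (r : ℕ) :
    completeHomog (-x) r = (-1) ^ r * completeHomog x r := by
  simp only [completeHomog_eq_sum, Finset.mul_sum, Pi.neg_apply]
  refine Finset.sum_congr rfl fun P hP => ?_
  rw [Finset.mem_finsuppAntidiag] at hP
  rw [← hP.1, ← Finset.prod_pow_eq_pow_sum, ← Finset.prod_mul_distrib]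
  refine Finset.prod_congr rfl fun i _ => ?_
  rw [← mul_pow, neg_one_mul]

theorem completeHomog_zero {n : ℕ} (x : Fin n → ℝ) : completeHomog x 0 = 1 := by
  simp [completeHomog]

theorem continuous_completeHomog {n : ℕ} (r : ℕ) :
    Continuous fun x : Fin n → ℝ => completeHomog x r :=
  MvPolynomial.continuous_eval _

/-- `∑ h_r(x) z^r`. -/
def homogSeries {n : ℕ} (x : Fin n → ℝ) : PowerSeries ℝ := PowerSeries.mk (completeHomog x)

theorem coeff_homogSeries {n : ℕ} (x : Fin n → ℝ) (r : ℕ) :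
    PowerSeries.coeff r (homogSeries x) = completeHomog x r := PowerSeries.coeff_mk _ _

theorem homogSeries_eq_prod {n : ℕ} (x : Fin n → ℝ) :
    homogSeries x = ∏ i, PowerSeries.mk fun m => x i ^ m := by
  ext r
  rw [coeff_homogSeries, completeHomog_eq_sum, PowerSeries.coeff_prod]
  simp

theorem geomSeries_mul (a : ℝ) :
    (PowerSeries.mk fun m => a ^ m) * (1 - PowerSeries.C a * PowerSeries.X) = 1 := by
  ext r
  rw [mul_sub, mul_one, mul_comm (PowerSeries.C a), ← mul_assoc]
  cases r with
  | zero => simp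
  | succ r =>
    rw [map_sub, PowerSeries.coeff_mul_C, PowerSeries.coeff_succ_mul_X]
    simp [PowerSeries.coeff_one, pow_succ]

/-- `∏ (1 + x_i z)`. -/
def elemPoly {n : ℕ} (x : Fin n → ℝ) : Polynomial ℝ :=
  ∏ i, (1 + Polynomial.C (x i) * Polynomial.X)

/-- `∏ (z - y_j)`. -/
def rootPoly {k : ℕ} (y : Fin k → ℝ) : Polynomial ℝ :=
  ∏ j, (Polynomial.X - Polynomial.C (y j))

theorem homogSeries_neg_mul_elemPoly {n : ℕ} (x : Fin n → ℝ) :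
    homogSeries (-x) * (elemPoly x : PowerSeries ℝ) = 1 := by
  have h : (elemPoly x : PowerSeries ℝ) =
      ∏ i, (1 - PowerSeries.C ((-x) i) * PowerSeries.X) := by
    rw [elemPoly, ← Polynomial.coeToPowerSeries.ringHom_apply, map_prod]
    refine Finset.prod_congr rfl fun i _ => ?_
    simp
  rw [h, homogSeries_eq_prod, ← Finset.prod_mul_distrib]
  exact Finset.prod_eq_one fun i _ => geomSeries_mul _

theorem natDegree_rootPoly {k : ℕ} (y : Fin k → ℝ) : (rootPoly y).natDegree = k := by
  simp [rootPoly]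

theorem monic_rootPoly {k : ℕ} (y : Fin k → ℝ) : (rootPoly y).Monic :=
  Polynomial.monic_prod_of_monic _ _ fun _ _ => Polynomial.monic_X_sub_C _

theorem reflect_rootPoly {k : ℕ} (y : Fin k → ℝ) :
    Polynomial.reflect k (rootPoly y) = elemPoly (-y) := by
  unfold rootPoly elemPoly
  induction k with
  | zero => simp
  | succ k ih =>
    rw [Fin.prod_univ_castSucc, Fin.prod_univ_castSucc, Polynomial.reflect_mul, ih]
    · congr 1
      rw [Polynomial.reflect_sub, Polynomial.reflect_C]
      simp [sub_eq_add_neg]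
    · exact (natDegree_rootPoly fun j : Fin k => y j.castSucc).le
    · simp

/-- `h_{p - r}(y)`, which is `0` for `p < r`. -/
def homogEntry {k : ℕ} (y : Fin k → ℝ) (p r : ℕ) : ℝ :=
  if r ≤ p then completeHomog y (p - r) else 0

theorem homogEntry_of_lt {k : ℕ} (y : Fin k → ℝ) {p r : ℕ} (h : p < r) :
    homogEntry y p r = 0 := by
  simp [homogEntry, h]

theorem continuous_homogEntry {k : ℕ} (p r : ℕ) :
    Continuous fun y : Fin k → ℝ => homogEntry y p r := by
  unfold homogEntry
  split_ifs
  · exact continuous_completeHomog _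
  · exact continuous_const

theorem sum_homogEntry_mul_rootPoly_X_pow {k : ℕ} (y : Fin k → ℝ) (M r i : ℕ) (hr : r < k)
    (hM : k + i < M) :
    ∑ s ∈ Finset.range M,
      homogEntry y s r * (rootPoly y * Polynomial.X ^ i).coeff s = 0 := by
  have h0 : ∑ a ∈ Finset.range (k + i + 1),
      (elemPoly (-y)).coeff a * homogEntry y (k + i - a) r = 0 := by
    have h1 := congrArg (PowerSeries.coeff (k + i - r)) (homogSeries_neg_mul_elemPoly (-y))
    rw [neg_neg, mul_comm, PowerSeries.coeff_mul,
      Finset.Nat.sum_antidiagonal_eq_sum_range_succ_mk] at h1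
    rw [PowerSeries.coeff_one, if_neg (by omega)] at h1
    rw [← h1]
    symm
    refine Finset.sum_subset_zero_on_sdiff (by intro a; simp; omega) ?_ ?_
    · intro a ha
      rw [homogEntry_of_lt, mul_zero]
      simp at ha
      omega
    · intro a ha
      simp at ha
      rw [homogEntry, if_pos (by omega), coeff_homogSeries, Polynomial.coeff_coe]
      congr 2
      omega
  rw [← h0, ← Finset.sum_range_reflect _ (k + i + 1)]
  symm
  refine Finset.sum_subset_zero_on_sdiff (by intro a; simp; omega) ?_ ?_
  · intro s hs
    simp at hs
    rw [Polynomial.coeff_eq_zero_of_natDegree_lt, mul_zero]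
    refine lt_of_le_of_lt Polynomial.natDegree_mul_le ?_
    rw [natDegree_rootPoly, Polynomial.natDegree_X_pow]
    omega
  · intro s hs
    simp at hs
    have e1 : k + i - (k + i + 1 - 1 - s) = s := by omega
    rw [← reflect_rootPoly, Polynomial.coeff_reflect, Polynomial.coeff_mul_X_pow', mul_comm, e1]
    congr 1
    split_ifs with h
    · rw [Polynomial.revAt_le (by omega)]
      congr 1
      omega
    · rw [Polynomial.revAt_eq_self_of_lt (by omega)]
      rw [Polynomial.coeff_eq_zero_of_natDegree_lt]
      rw [natDegree_rootPoly]
      omega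

theorem sum_homogEntry_mul_rootPoly_mul {k : ℕ} (y : Fin k → ℝ) (n r : ℕ) (hr : r < k)
    (R : Polynomial ℝ) (hR : R.degree < n) :
    ∑ s ∈ Finset.range (k + n), homogEntry y s r * (rootPoly y * R).coeff s = 0 := by
  have h : rootPoly y * R = ∑ i ∈ Finset.range n,
      Polynomial.C (R.coeff i) * (rootPoly y * Polynomial.X ^ i) := by
    by_cases h0 : R = 0
    · simp [h0]
    conv_lhs => rw [R.as_sum_range' n ((Polynomial.natDegree_lt_iff_degree_lt h0).2 hR),
      Finset.mul_sum]
    refine Finset.sum_congr rfl fun i _ => ?_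
    rw [← Polynomial.C_mul_X_pow_eq_monomial]
    ring
  simp_rw [h, Polynomial.finsetSum_coeff, Polynomial.coeff_C_mul, Finset.mul_sum]
  rw [Finset.sum_comm]
  refine Finset.sum_eq_zero fun i hi => ?_
  have := sum_homogEntry_mul_rootPoly_X_pow y (k + n) r i hr
    (by have := Finset.mem_range.1 hi; omega)
  rw [← mul_zero (R.coeff i), ← this, Finset.mul_sum]
  exact Finset.sum_congr rfl fun s _ => by ring

/-! ### Partitions in a rectangle as shuffles -/

theorem lt_conjPartition_iff {n k : ℕ} {lam : Fin n → Fin (k + 1)} (h : Antitone lam)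
    (i : Fin n) (j : Fin k) : (i : ℕ) < conjPartition lam j ↔ (j : ℕ) < lam i := by
  unfold conjPartition
  constructor
  · intro hi
    by_contra hc
    have hsub : (Finset.univ.filter fun i' : Fin n => (j : ℕ) < (lam i' : ℕ)) ⊆ Finset.Iio i := by
      intro a ha
      rw [Finset.mem_filter] at ha
      rw [Finset.mem_Iio]
      by_contra hai
      have := h (not_lt.1 hai)
      rw [Fin.le_def] at this
      omega
    have := Finset.card_le_card hsub
    rw [Fin.card_Iio] at this
    omega
  · intro hj
    have hsub : Finset.Iic i ⊆ (Finset.univ.filter fun i' : Fin n => (j : ℕ) < (lam i' : ℕ)) := by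
      intro a ha
      rw [Finset.mem_Iic] at ha
      have := h ha
      rw [Fin.le_def] at this
      simp only [Finset.mem_filter, Finset.mem_univ, true_and]
      omega
    have := Finset.card_le_card hsub
    rw [Fin.card_Iic] at this
    omega

theorem conjPartition_le {n k : ℕ} (lam : Fin n → Fin (k + 1)) (j : Fin k) :
    conjPartition lam j ≤ n :=
  (Finset.card_filter_le _ _).trans (by simp)

theorem antitone_conjPartition {n k : ℕ} (lam : Fin n → Fin (k + 1)) :
    Antitone (conjPartition lam) := by
  intro j j' hj
  refine Finset.card_le_card fun i => ?_
  simp only [Finset.mem_filter, Finset.mem_univ, true_and]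
  rw [Fin.le_def] at hj
  omega

/-- The positions of the vertical and horizontal steps of the boundary of a partition. -/
def boundaryShuffle {n k : ℕ} (lam : Fin n → Fin (k + 1)) : Fin k ⊕ Fin n → Fin (k + n)
  | .inl j => ⟨conjPartition lam j + (k - 1 - j), by
      have := conjPartition_le lam j
      omega⟩
  | .inr i => ⟨k + i - lam i, by omega⟩

theorem boundaryShuffle_inr_strictMono {n k : ℕ} {lam : Fin n → Fin (k + 1)} (h : Antitone lam) :
    StrictMono fun i => boundaryShuffle lam (.inr i) := by
  intro i i' hi
  have := h hi.le
  rw [Fin.le_def] at this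
  rw [Fin.lt_def] at hi ⊢
  simp only [boundaryShuffle]
  omega

theorem boundaryShuffle_inl_strictAnti {n k : ℕ} (lam : Fin n → Fin (k + 1)) :
    StrictAnti fun j => boundaryShuffle lam (.inl j) := by
  intro i i' hi
  have := antitone_conjPartition lam hi.le
  rw [Fin.lt_def] at hi ⊢
  simp only [boundaryShuffle]
  omega

theorem boundaryShuffle_inr_lt_inl_iff {n k : ℕ} {lam : Fin n → Fin (k + 1)} (h : Antitone lam)
    (i : Fin n) (j : Fin k) :
    boundaryShuffle lam (.inr i) < boundaryShuffle lam (.inl j) ↔ (j : ℕ) < lam i := by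
  have := lt_conjPartition_iff h i j
  rw [Fin.lt_def]
  simp only [boundaryShuffle]
  omega

theorem boundaryShuffle_inl_lt_inr_iff {n k : ℕ} {lam : Fin n → Fin (k + 1)} (h : Antitone lam)
    (i : Fin n) (j : Fin k) :
    boundaryShuffle lam (.inl j) < boundaryShuffle lam (.inr i) ↔ ¬ (j : ℕ) < lam i := by
  have := lt_conjPartition_iff h i j
  rw [Fin.lt_def]
  simp only [boundaryShuffle]
  omega

theorem boundaryShuffle_bijective {n k : ℕ} {lam : Fin n → Fin (k + 1)} (h : Antitone lam) :
    Function.Bijective (boundaryShuffle lam) := by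
  rw [Fintype.bijective_iff_injective_and_card]
  refine ⟨?_, by simp⟩
  have key : ∀ i j, boundaryShuffle lam (.inr i) ≠ boundaryShuffle lam (.inl j) := by
    intro i j he
    have h1 := boundaryShuffle_inr_lt_inl_iff h i j
    have h2 := boundaryShuffle_inl_lt_inr_iff h i j
    rw [he] at h1 h2
    simp only [lt_self_iff_false, false_iff, not_not] at h1 h2
    exact h1 h2
  rintro (a | a) (b | b) hab
  · exact congrArg _ ((boundaryShuffle_inl_strictAnti lam).injective hab)
  · exact absurd hab.symm (key _ _)
  · exact absurd hab (key _ _)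
  · exact congrArg _ ((boundaryShuffle_inr_strictMono h).injective hab)

/-- The boundary of a partition in a rectangle, as a bijection. -/
def boundaryEquiv {n k : ℕ} {lam : Fin n → Fin (k + 1)} (h : Antitone lam) :
    Fin k ⊕ Fin n ≃ Fin (k + n) :=
  Equiv.ofBijective _ (boundaryShuffle_bijective h)

@[simp] theorem boundaryEquiv_apply {n k : ℕ} {lam : Fin n → Fin (k + 1)} (h : Antitone lam)
    (s : Fin k ⊕ Fin n) : boundaryEquiv h s = boundaryShuffle lam s := rfl

/-- The boundary of the empty partition. -/
def emptyBoundary (n k : ℕ) : Fin k ⊕ Fin n ≃ Fin (k + n) :=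
  boundaryEquiv (lam := fun _ : Fin n => (0 : Fin (k + 1))) antitone_const

theorem emptyBoundary_inl {n k : ℕ} (j : Fin k) :
    (emptyBoundary n k (.inl j) : ℕ) = k - 1 - j := by
  simp [emptyBoundary, boundaryShuffle, conjPartition]

theorem emptyBoundary_inr {n k : ℕ} (i : Fin n) :
    (emptyBoundary n k (.inr i) : ℕ) = k + i := by
  simp [emptyBoundary, boundaryShuffle]

theorem emptyBoundary_symm_castAdd {n k : ℕ} (j : Fin k) :
    (emptyBoundary n k).symm (Fin.castAdd n j) = .inl j.rev := by
  rw [Equiv.symm_apply_eq, Fin.ext_iff, emptyBoundary_inl]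
  simp [Fin.val_rev]
  omega

theorem emptyBoundary_symm_natAdd {n k : ℕ} (i : Fin n) :
    (emptyBoundary n k).symm (Fin.natAdd k i) = .inr i := by
  rw [Equiv.symm_apply_eq, Fin.ext_iff, emptyBoundary_inr]
  simp

/-- The permutation of the steps that turns the boundary of the empty partition into that of
`lam`. -/
def boundaryPerm {n k : ℕ} {lam : Fin n → Fin (k + 1)} (h : Antitone lam) :
    Equiv.Perm (Fin k ⊕ Fin n) :=
  (boundaryEquiv h).trans (emptyBoundary n k).symm

theorem sign_boundaryPerm {n k : ℕ} {lam : Fin n → Fin (k + 1)} (h : Antitone lam) :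
    Equiv.Perm.sign (boundaryPerm h) = ∏ i, (-1 : ℤˣ) ^ (lam i : ℕ) := by
  rw [← Equiv.Perm.sign_symm_trans_trans (boundaryPerm h) (emptyBoundary n k)]
  set p : Equiv.Perm (Fin (k + n)) :=
    ((emptyBoundary n k).symm.trans (boundaryPerm h)).trans (emptyBoundary n k) with hp
  have hl : ∀ j : Fin k, p (Fin.castAdd n j) = boundaryShuffle lam (.inl j.rev) := by
    intro j
    simp [hp, boundaryPerm, emptyBoundary_symm_castAdd]
  have hr : ∀ i : Fin n, p (Fin.natAdd k i) = boundaryShuffle lam (.inr i) := by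
    intro j
    simp [hp, boundaryPerm, emptyBoundary_symm_natAdd]
  have h1 : Equiv.Perm.sign p = ∏ i, ∏ j, if i < j ∧ ¬ p i < p j then (-1 : ℤˣ) else 1 := by
    rw [Equiv.Perm.sign_eq_prod_prod_Ioi]
    refine Finset.prod_congr rfl fun i _ => ?_
    rw [← Finset.prod_subset (Finset.subset_univ (Finset.Ioi i))]
    · refine Finset.prod_congr rfl fun j hj => ?_
      rw [Finset.mem_Ioi] at hj
      by_cases hh : p i < p j <;> simp [hj, hh]
    · intro j _ hj
      rw [Finset.mem_Ioi] at hj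
      simp [hj]
  rw [h1, Fin.prod_univ_add]
  have h2 : ∀ i : Fin n, (∏ j, if Fin.natAdd k i < j ∧ ¬ p (Fin.natAdd k i) < p j
      then (-1 : ℤˣ) else 1) = 1 := by
    intro i
    refine Finset.prod_eq_one fun j _ => if_neg ?_
    rintro ⟨hij, hpij⟩
    refine hpij ?_
    induction j using Fin.addCases with
    | left j =>
      rw [Fin.lt_def] at hij
      simp at hij
      omega
    | right j =>
      rw [hr, hr]
      refine boundaryShuffle_inr_strictMono h ?_
      simpa using hij
  rw [Finset.prod_congr rfl fun i _ => h2 i, Finset.prod_const_one, mul_one]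
  have h3 : ∀ j : Fin k, (∏ i, if Fin.castAdd n j < i ∧ ¬ p (Fin.castAdd n j) < p i
      then (-1 : ℤˣ) else 1) = ∏ i : Fin n, if ((j.rev : Fin k) : ℕ) < lam i then -1 else 1 := by
    intro j
    rw [Fin.prod_univ_add]
    have h4 : (∏ i : Fin k, if Fin.castAdd n j < Fin.castAdd n i ∧
        ¬ p (Fin.castAdd n j) < p (Fin.castAdd n i) then (-1 : ℤˣ) else 1) = 1 := by
      refine Finset.prod_eq_one fun i _ => if_neg ?_
      rintro ⟨hij, hpij⟩
      refine hpij ?_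
      rw [hl, hl]
      refine boundaryShuffle_inl_strictAnti lam ?_
      rw [Fin.rev_lt_rev]
      exact hij
    rw [h4, one_mul]
    refine Finset.prod_congr rfl fun i _ => ?_
    simp only [hl, hr, boundaryShuffle_inl_lt_inr_iff h, not_not]
    have : Fin.castAdd n j < Fin.natAdd k i := by
      rw [Fin.lt_def]
      simp
      omega
    simp [this]
  rw [Finset.prod_congr rfl fun i _ => h3 i, Finset.prod_comm]
  refine Finset.prod_congr rfl fun i _ => ?_
  rw [show (∏ j : Fin k, if ((j.rev : Fin k) : ℕ) < lam i then (-1 : ℤˣ) else 1) = _ from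
    Equiv.prod_comp Fin.revPerm (fun j : Fin k => if (j : ℕ) < lam i then (-1 : ℤˣ) else 1),
    Finset.prod_ite, Finset.prod_const, Finset.prod_const_one, mul_one]
  congr 1
  rw [Fin.card_filter_val_lt]
  omega

/-- The function that assembles a permutation from a partition and two permutations. -/
def assemblePerm {n k : ℕ}
    (t : {lam : Fin n → Fin (k + 1) // Antitone lam} × Equiv.Perm (Fin k) × Equiv.Perm (Fin n)) :
    Equiv.Perm (Fin k ⊕ Fin n) :=
  boundaryPerm t.1.2 * Equiv.Perm.sumCongr t.2.1 t.2.2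

theorem emptyBoundary_assemblePerm_inl {n k : ℕ}
    (t : {lam : Fin n → Fin (k + 1) // Antitone lam} × Equiv.Perm (Fin k) × Equiv.Perm (Fin n))
    (j : Fin k) :
    emptyBoundary n k (assemblePerm t (.inl j)) = boundaryShuffle t.1.1 (.inl (t.2.1 j)) := by
  simp [assemblePerm, boundaryPerm]

theorem emptyBoundary_assemblePerm_inr {n k : ℕ}
    (t : {lam : Fin n → Fin (k + 1) // Antitone lam} × Equiv.Perm (Fin k) × Equiv.Perm (Fin n))
    (i : Fin n) :
    emptyBoundary n k (assemblePerm t (.inr i)) = boundaryShuffle t.1.1 (.inr (t.2.2 i)) := by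
  simp [assemblePerm, boundaryPerm]

theorem assemblePerm_injective {n k : ℕ} :
    Function.Injective (assemblePerm (n := n) (k := k)) := by
  rintro ⟨⟨lam, h⟩, α, β⟩ ⟨⟨lam', h'⟩, α', β'⟩ he
  have hlam : lam = lam' := by
    have hs : (fun i => boundaryShuffle lam (.inr i)) = fun i => boundaryShuffle lam' (.inr i) := by
      refine (StrictMono.range_inj (boundaryShuffle_inr_strictMono h)
        (boundaryShuffle_inr_strictMono h')).1 ?_
      have e1 : ∀ i, boundaryShuffle lam (.inr (β i)) = boundaryShuffle lam' (.inr (β' i)) := by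
        intro i
        have a1 := emptyBoundary_assemblePerm_inr ⟨⟨lam, h⟩, α, β⟩ i
        have a2 := emptyBoundary_assemblePerm_inr ⟨⟨lam', h'⟩, α', β'⟩ i
        rw [he] at a1
        exact a1.symm.trans a2
      rw [← β.surjective.range_comp (fun i => boundaryShuffle lam (.inr i)),
        ← β'.surjective.range_comp (fun i => boundaryShuffle lam' (.inr i))]
      congr 1
      exact funext e1
    funext i
    have := congrArg Fin.val (congrFun hs i)
    simp only [boundaryShuffle] at this
    omega
  subst hlam
  have h2 : Equiv.Perm.sumCongr α β = Equiv.Perm.sumCongr α' β' := mul_left_cancel he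
  have h3 := Equiv.Perm.sumCongrHom_injective (a₁ := (α, β)) (a₂ := (α', β')) h2
  rw [h3]

theorem assemblePerm_surjective {n k : ℕ} :
    Function.Surjective (assemblePerm (n := n) (k := k)) := by
  intro s
  let S : Finset (Fin (k + n)) := Finset.univ.image fun i : Fin n => emptyBoundary n k (s (.inr i))
  have hS : S.card = n := by
    rw [Finset.card_image_of_injective, Finset.card_univ, Fintype.card_fin]
    intro a b hab
    simpa using hab
  let e := S.orderEmbOfFin hS
  have hlow : ∀ i : Fin n, (i : ℕ) ≤ e i := by
    rintro ⟨i, hi⟩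
    induction i with
    | zero => simp
    | succ i ih =>
      have h1 := ih (by omega)
      have h2 : e ⟨i, by omega⟩ < e ⟨i + 1, hi⟩ := e.strictMono (by simp [Fin.lt_def])
      rw [Fin.lt_def] at h2
      simp only at h1 ⊢
      omega
  have hup : ∀ d : ℕ, ∀ i : Fin n, (i : ℕ) + d + 1 = n → (e i : ℕ) ≤ k + i := by
    intro d
    induction d with
    | zero =>
      intro i hi
      have := (e i).2
      omega
    | succ d ih =>
      rintro ⟨i, hi⟩ hid
      simp only at hid
      have h1 := ih ⟨i + 1, by omega⟩ (by simp only; omega)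
      have h2 : e ⟨i, by omega⟩ < e ⟨i + 1, by omega⟩ := e.strictMono (by simp [Fin.lt_def])
      rw [Fin.lt_def] at h2
      simp only at h1 ⊢
      omega
  have hup' : ∀ i : Fin n, (e i : ℕ) ≤ k + i := fun i => hup (n - 1 - i) i (by omega)
  let lam : Fin n → Fin (k + 1) := fun i => ⟨k + i - e i, by have := hlow i; omega⟩
  have hlam : Antitone lam := by
    refine antitone_iff_forall_lt.2 fun a b hab => ?_
    have key : ∀ d : ℕ, ∀ a b : Fin n, (b : ℕ) = a + d → (e a : ℕ) + d ≤ e b := by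
      intro d
      induction d with
      | zero =>
        intro a b hab
        have : a = b := Fin.ext (by omega)
        rw [this]; rfl
      | succ d ih =>
        intro a b hab
        have h1 := ih a ⟨a + d, by omega⟩ rfl
        have h2 : e ⟨a + d, by omega⟩ < e b := e.strictMono (by simp [Fin.lt_def]; omega)
        rw [Fin.lt_def] at h2
        omega
    have := key (b - a) a b (by have := Fin.lt_def.1 hab; omega)
    rw [Fin.le_def]
    have := Fin.lt_def.1 hab
    simp only [lam]
    omega
  have hshuf : ∀ i, boundaryShuffle lam (.inr i) = e i := by
    intro i
    have := hup' i
    ext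
    simp only [boundaryShuffle, lam]
    omega
  have hmem : (boundaryPerm hlam)⁻¹ * s ∈ (Equiv.Perm.sumCongrHom (Fin k) (Fin n)).range := by
    apply Equiv.Perm.mem_sumCongrHom_range_of_perm_mapsTo_inl
    rw [Equiv.Perm.perm_mapsTo_inl_iff_mapsTo_inr]
    rintro _ ⟨i, rfl⟩
    have h1 : emptyBoundary n k (s (.inr i)) ∈ S :=
      Finset.mem_image_of_mem _ (Finset.mem_univ _)
    have h2 : emptyBoundary n k (s (.inr i)) ∈ Set.range e := by
      rw [Finset.range_orderEmbOfFin]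
      exact h1
    obtain ⟨i', hi'⟩ := h2
    refine ⟨i', ?_⟩
    rw [Equiv.Perm.mul_apply, Equiv.Perm.eq_inv_iff_eq, ← (emptyBoundary n k).injective.eq_iff,
      ← hi', ← hshuf]
    simp [boundaryPerm]
  obtain ⟨⟨α, β⟩, hαβ⟩ := hmem
  refine ⟨⟨⟨lam, hlam⟩, α, β⟩, ?_⟩
  change boundaryPerm hlam * Equiv.Perm.sumCongrHom _ _ (α, β) = s
  rw [hαβ, mul_inv_cancel_left]

/-- Laplace expansion of a determinant along two complementary groups of rows. -/
theorem det_eq_sum_antitone {n k : ℕ} (N : Matrix (Fin k ⊕ Fin n) (Fin (k + n)) ℝ) :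
    (N.submatrix id (emptyBoundary n k)).det =
      ∑ lam : {lam : Fin n → Fin (k + 1) // Antitone lam},
        (∏ i, (-1 : ℝ) ^ (lam.1 i : ℕ)) *
        (Matrix.of fun l j : Fin k => N (.inl l) (boundaryShuffle lam.1 (.inl j))).det *
        (Matrix.of fun l i : Fin n => N (.inr l) (boundaryShuffle lam.1 (.inr i))).det := by
  rw [← Matrix.det_transpose, Matrix.det_apply,
    ← (Function.Bijective.sum_comp ⟨assemblePerm_injective, assemblePerm_surjective⟩),
    Fintype.sum_prod_type]
  refine Finset.sum_congr rfl fun lam _ => ?_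
  rw [Fintype.sum_prod_type, ← Matrix.det_transpose, ← Matrix.det_transpose (Matrix.of fun l i : Fin n => _),
    Matrix.det_apply, Matrix.det_apply, mul_assoc, Finset.sum_mul_sum, Finset.mul_sum]
  refine Finset.sum_congr rfl fun α _ => ?_
  rw [Finset.mul_sum]
  refine Finset.sum_congr rfl fun β _ => ?_
  rw [Fintype.prod_sum_type]
  simp only [Matrix.transpose_apply, Matrix.submatrix_apply, id, emptyBoundary_assemblePerm_inl,
    emptyBoundary_assemblePerm_inr, Matrix.of_apply]
  have hs : Equiv.Perm.sign (assemblePerm (lam, α, β)) =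
      (∏ i, (-1 : ℤˣ) ^ (lam.1 i : ℕ)) * (Equiv.Perm.sign α * Equiv.Perm.sign β) := by
    rw [assemblePerm, Equiv.Perm.sign_mul, sign_boundaryPerm, Equiv.Perm.sign_sumCongr]
  rw [hs]
  simp only [Units.smul_def, zsmul_eq_mul, Units.val_mul, Int.cast_mul, Units.coe_prod,
    Int.cast_prod, Units.val_pow_eq_pow_val, Int.cast_pow, Units.val_neg, Units.val_one,
    Int.cast_neg, Int.cast_one]
  ring

/-! ### The distribution of the first part as a determinant -/

/-- The matrix whose expansion along two groups of rows generates the dual Schur measure on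
partitions with first part at most `k - Δ`. -/
def stepMatrix {n k : ℕ} (x : Fin n → ℝ) (y : Fin k → ℝ) (Δ : ℕ) :
    Matrix (Fin k ⊕ Fin n) (Fin (k + n)) ℝ
  | .inl l, p => homogEntry y p (k - 1 - l)
  | .inr l, p => if Δ ≤ (p : ℕ) then homogEntry (-x) (k + l) p else 0

theorem homogEntry_eq {k : ℕ} (y : Fin k → ℝ) {p r d : ℕ} (h : p = r + d) :
    homogEntry y p r = completeHomog y d := by
  subst h
  simp [homogEntry]

theorem boundaryShuffle_inl_val {n k : ℕ} (lam : Fin n → Fin (k + 1)) (j : Fin k) :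
    (boundaryShuffle lam (.inl j) : ℕ) = conjPartition lam j + (k - 1 - j) := rfl

theorem boundaryShuffle_inr_val {n k : ℕ} (lam : Fin n → Fin (k + 1)) (i : Fin n) :
    (boundaryShuffle lam (.inr i) : ℕ) = k + i - lam i := rfl

theorem det_stepMatrix_inl {n k : ℕ} (x : Fin n → ℝ) (y : Fin k → ℝ) (Δ : ℕ)
    (lam : Fin n → Fin (k + 1)) :
    (Matrix.of fun l j : Fin k =>
      stepMatrix x y Δ (.inl l) (boundaryShuffle lam (.inl j))).det =
      schurPoly y (conjPartition lam) := by
  rw [← Matrix.det_transpose]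
  unfold schurPoly
  congr 1
  ext j l
  have := j.2
  have := l.2
  simp only [Matrix.transpose_apply, Matrix.of_apply, stepMatrix]
  by_cases h : (j : ℕ) ≤ conjPartition lam j + l
  · rw [if_pos h]
    exact homogEntry_eq y (by rw [boundaryShuffle_inl_val]; omega)
  · rw [if_neg h]
    exact homogEntry_of_lt y (by rw [boundaryShuffle_inl_val]; omega)

theorem det_homogEntry_neg {n k : ℕ} (x : Fin n → ℝ) (lam : Fin n → Fin (k + 1)) :
    (∏ i, (-1 : ℝ) ^ (lam i : ℕ)) * (Matrix.of fun l i : Fin n =>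
      homogEntry (-x) (k + l) (boundaryShuffle lam (.inr i))).det =
      schurPoly x (fun i => (lam i : ℕ)) := by
  have h1 : (Matrix.of fun l i : Fin n =>
      homogEntry (-x) (k + l) (boundaryShuffle lam (.inr i))) =
      Matrix.of fun l i : Fin n => (-1 : ℝ) ^ (l : ℕ) *
        (Matrix.of fun l i : Fin n => ((-1 : ℝ) ^ (i : ℕ) * (-1) ^ (lam i : ℕ)) *
        (Matrix.of fun l i : Fin n => if (i : ℕ) ≤ lam i + l then
          completeHomog x (lam i + l - i) else 0) l i) l i := by
    ext l i
    have := (lam i).2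
    simp only [Matrix.of_apply]
    by_cases h : (i : ℕ) ≤ lam i + l
    · rw [if_pos h, homogEntry_eq (-x) (d := lam i + l - i)
        (by rw [boundaryShuffle_inr_val]; omega), completeHomog_neg, ← mul_assoc]
      congr 1
      rw [← mul_assoc, ← pow_add, ← pow_add]
      have e2 : (l : ℕ) + i + lam i = (lam i + l - i) + 2 * i := by omega
      rw [e2, pow_add _ _ (2 * (i : ℕ)), pow_mul]
      simp
    · rw [if_neg h, homogEntry_of_lt _ (by rw [boundaryShuffle_inr_val]; omega)]
      simp
  rw [h1, Matrix.det_mul_column, Matrix.det_mul_row, Finset.prod_mul_distrib,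
    ← Matrix.det_transpose]
  have h2 : ∀ a b c : ℝ, a * a = 1 → b * b = 1 → a * (b * (b * a * c)) = c := by
    intro a b c ha hb
    calc a * (b * (b * a * c)) = (a * a) * (b * b) * c := by ring
      _ = c := by rw [ha, hb]; ring
  rw [h2]
  · rfl
  · rw [← Finset.prod_mul_distrib]
    refine Finset.prod_eq_one fun i _ => ?_
    rw [← mul_pow]; simp
  · rw [← Finset.prod_mul_distrib]
    refine Finset.prod_eq_one fun i _ => ?_
    rw [← mul_pow]; simp

open Classical in
theorem det_stepMatrix_eq_sum {n k : ℕ} (x : Fin n → ℝ) (y : Fin k → ℝ) (Δ : ℕ) (hΔ : Δ ≤ k) :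
    ((stepMatrix x y Δ).submatrix id (emptyBoundary n k)).det =
      ∑ lam : Fin n → Fin (k + 1), if Antitone lam ∧ firstPart lam + Δ ≤ k then
        schurPoly x (fun i => (lam i : ℕ)) * schurPoly y (conjPartition lam) else 0 := by
  have h0 : ∀ lam : {lam : Fin n → Fin (k + 1) // Antitone lam},
      (∏ i, (-1 : ℝ) ^ (lam.1 i : ℕ)) *
        (Matrix.of fun l j : Fin k =>
          stepMatrix x y Δ (.inl l) (boundaryShuffle lam.1 (.inl j))).det *
        (Matrix.of fun l i : Fin n =>
          stepMatrix x y Δ (.inr l) (boundaryShuffle lam.1 (.inr i))).det =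
      if firstPart lam.1 + Δ ≤ k then
        schurPoly x (fun i => (lam.1 i : ℕ)) * schurPoly y (conjPartition lam.1) else 0 := by
    rintro ⟨lam, h⟩
    rw [det_stepMatrix_inl]
    split_ifs with hf
    · rw [← det_homogEntry_neg, mul_right_comm]
      congr 3
      ext l i
      simp only [Matrix.of_apply, stepMatrix]
      rw [if_pos]
      have hn : 0 < n := i.pos
      have h1 : lam i ≤ lam ⟨0, hn⟩ := h (Fin.le_def.2 (Nat.zero_le _))
      rw [Fin.le_def] at h1
      simp only [firstPart, dif_pos hn] at hf
      rw [boundaryShuffle_inr_val]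
      omega
    · have hn : 0 < n := by
        by_contra hn
        simp only [firstPart, dif_neg hn] at hf
        omega
      rw [Matrix.det_eq_zero_of_column_eq_zero ⟨0, hn⟩, mul_zero]
      intro l
      simp only [Matrix.of_apply, stepMatrix]
      rw [if_neg]
      simp only [firstPart, dif_pos hn] at hf
      rw [boundaryShuffle_inr_val]
      simp only
      omega
  rw [det_eq_sum_antitone, Finset.sum_congr rfl fun lam _ => h0 lam]
  simp only [ite_and]
  rw [← Finset.sum_filter (p := fun lam : Fin n → Fin (k + 1) => Antitone lam)]
  exact (Finset.sum_subtype _ (fun _ => Finset.mem_filter_univ _) (fun lam =>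
    if firstPart lam + Δ ≤ k then
      schurPoly x (fun i => (lam i : ℕ)) * schurPoly y (conjPartition lam) else 0)).symm

/-- Multiplication by a power series with constant coefficient `1` does not change the
determinant of the matrix of the leading coefficients. -/
theorem det_coeff_mul {A : Type*} [CommRing A] {Δ : ℕ} (G : PowerSeries A)
    (hG : PowerSeries.coeff 0 G = 1) (F : Fin Δ → PowerSeries A) :
    (Matrix.of fun p b : Fin Δ => PowerSeries.coeff p (G * F b)).det =
      (Matrix.of fun p b : Fin Δ => PowerSeries.coeff p (F b)).det := by
  have h : (Matrix.of fun p b : Fin Δ => PowerSeries.coeff p (G * F b)) =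
      (Matrix.of fun p a : Fin Δ => if a ≤ p then PowerSeries.coeff (p - a : ℕ) G else 0) *
      (Matrix.of fun p b : Fin Δ => PowerSeries.coeff p (F b)) := by
    ext p b
    rw [Matrix.mul_apply]
    simp only [Matrix.of_apply]
    rw [mul_comm G, PowerSeries.coeff_mul, Finset.Nat.sum_antidiagonal_eq_sum_range_succ_mk]
    simp only [Fin.le_def]
    rw [Fin.sum_univ_eq_sum_range (fun a => (if a ≤ (p : ℕ) then
      PowerSeries.coeff (p - a : ℕ) G else 0) * PowerSeries.coeff a (F b))]
    refine Finset.sum_subset_zero_on_sdiff ?_ ?_ ?_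
    · intro a
      simp
      omega
    · intro a ha
      simp at ha
      rw [if_neg (by omega), zero_mul]
    · intro a ha
      simp at ha
      rw [if_pos (by omega), mul_comm]
  rw [h, Matrix.det_mul, Matrix.det_of_isLowerTriangular]
  · simp [hG]
  · intro i j hij
    have : ¬ j ≤ i := by simpa using hij
    simp [this]

theorem elemPoly_coeff_zero {n : ℕ} (x : Fin n → ℝ) : (elemPoly x).coeff 0 = 1 := by
  rw [Polynomial.coeff_zero_eq_eval_zero, elemPoly, Polynomial.eval_prod]
  simp

/-- `Q` represents `z^b / E` modulo `Y`, where `E = ∏ (1 + x_i z)` and `Y = ∏ (z - y_j)`. -/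
structure IsQuotient {n k : ℕ} (x : Fin n → ℝ) (y : Fin k → ℝ) (b : ℕ)
    (Q R : Polynomial ℝ) : Prop where
  degree_lt : Q.degree < k
  degree_rem_lt : R.degree < (elemPoly x).natDegree
  mul_eq : elemPoly x * Q = Polynomial.X ^ b + rootPoly y * R

theorem natDegree_elemPoly_le {n : ℕ} (x : Fin n → ℝ) : (elemPoly x).natDegree ≤ n := by
  refine (Polynomial.natDegree_prod_le _ _).trans ?_
  refine (Finset.sum_le_card_nsmul _ _ 1 fun i _ => ?_).trans (by simp)
  compute_degree

theorem elemPoly_ne_zero {n : ℕ} (x : Fin n → ℝ) : elemPoly x ≠ 0 := by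
  intro h
  have := elemPoly_coeff_zero x
  simp [h] at this

theorem eval_elemPoly_pos {n : ℕ} {x : Fin n → ℝ} (hx : ∀ i, 0 ≤ x i) {w : ℝ} (hw : 0 ≤ w) :
    0 < (elemPoly x).eval w := by
  rw [elemPoly, Polynomial.eval_prod]
  refine Finset.prod_pos fun i _ => ?_
  have := mul_nonneg (hx i) hw
  simp
  linarith

theorem exists_isQuotient {n k : ℕ} {x : Fin n → ℝ} {y : Fin k → ℝ} (hx : ∀ i, 0 ≤ x i)
    (hy : ∀ j, 0 < y j) {b : ℕ} (hb : b < k) : ∃ Q R, IsQuotient x y b Q R := by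
  have hcop : IsCoprime (elemPoly x) (rootPoly y) := by
    refine IsCoprime.prod_right fun j _ => IsCoprime.symm ?_
    rw [(Polynomial.irreducible_X_sub_C (y j)).coprime_iff_not_dvd, Polynomial.dvd_iff_isRoot]
    exact (eval_elemPoly_pos hx (hy j).le).ne'
  obtain ⟨u, v, huv⟩ := hcop
  set Q := (Polynomial.X ^ b * u) %ₘ rootPoly y with hQ
  have hdiv := Polynomial.modByMonic_add_div (Polynomial.X ^ b * u) (rootPoly y)
  set D := (Polynomial.X ^ b * u) /ₘ rootPoly y
  set R := -(Polynomial.X ^ b * v + elemPoly x * D) with hR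
  have hmul : elemPoly x * Q = Polynomial.X ^ b + rootPoly y * R := by
    have h1 : Q = Polynomial.X ^ b * u - rootPoly y * D := by rw [← hdiv]; ring
    rw [h1, hR]
    linear_combination (Polynomial.X ^ b) * huv
  have hQd : Q.degree < k := by
    have := Polynomial.degree_modByMonic_lt (Polynomial.X ^ b * u) (monic_rootPoly y)
    rwa [Polynomial.degree_eq_natDegree (monic_rootPoly y).ne_zero, natDegree_rootPoly] at this
  refine ⟨Q, R, hQd, ?_, hmul⟩
  by_contra hcon
  rw [not_lt] at hcon
  have hR0 : R ≠ 0 := by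
    rintro h0
    simp [h0] at hcon
  have hnd : (elemPoly x).natDegree ≤ R.natDegree := by
    rw [Polynomial.degree_eq_natDegree hR0] at hcon
    exact_mod_cast hcon
  have hYR : rootPoly y * R = elemPoly x * Q - Polynomial.X ^ b := by rw [hmul]; ring
  have h1 := congrArg Polynomial.natDegree hYR
  rw [Polynomial.natDegree_mul (monic_rootPoly y).ne_zero hR0, natDegree_rootPoly] at h1
  have hk : k ≠ 0 := by omega
  have hQn : Q.natDegree < k := by
    by_cases hQ0 : Q = 0
    · rw [hQ0]; simp; omega
    · exact (Polynomial.natDegree_lt_iff_degree_lt hQ0).2 hQd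
  have h2 := Polynomial.natDegree_sub_le (elemPoly x * Q) (Polynomial.X ^ b)
  have h3 := Polynomial.natDegree_mul_le (p := elemPoly x) (q := Q)
  rw [Polynomial.natDegree_X_pow] at h2
  rcases max_cases (elemPoly x * Q).natDegree b with ⟨h, _⟩ | ⟨h, _⟩ <;> omega

theorem sum_homogEntry_neg_mul {n : ℕ} (x : Fin n → ℝ) (Q : Polynomial ℝ) (M r : ℕ)
    (hr : r < M) :
    ∑ p ∈ Finset.range M, homogEntry (-x) r p * (elemPoly x * Q).coeff p = Q.coeff r := by
  have h1 : homogSeries (-x) * ((elemPoly x * Q : Polynomial ℝ) : PowerSeries ℝ) = Q := by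
    rw [Polynomial.coe_mul, ← mul_assoc, homogSeries_neg_mul_elemPoly, one_mul]
  have h2 := congrArg (PowerSeries.coeff r) h1
  rw [mul_comm, PowerSeries.coeff_mul, Finset.Nat.sum_antidiagonal_eq_sum_range_succ_mk,
    Polynomial.coeff_coe] at h2
  rw [← h2]
  symm
  refine Finset.sum_subset_zero_on_sdiff ?_ ?_ ?_
  · intro a
    simp
    omega
  · intro a ha
    simp at ha
    rw [homogEntry_of_lt _ (by omega), zero_mul]
  · intro a ha
    simp at ha
    rw [homogEntry, if_pos (by omega), coeff_homogSeries, mul_comm, Polynomial.coeff_coe]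

/-- The matrix with columns `b < Δ` the coefficients of `E * Q b`, completed by the identity. -/
def columnMatrix {n : ℕ} (x : Fin n → ℝ) (Q : ℕ → Polynomial ℝ) (Δ M : ℕ) :
    Matrix (Fin M) (Fin M) ℝ :=
  Matrix.of fun p b => if (b : ℕ) < Δ then (elemPoly x * Q b).coeff p else if p = b then 1 else 0

theorem det_columnMatrix {n : ℕ} (x : Fin n → ℝ) (Q : ℕ → Polynomial ℝ) {Δ M : ℕ} (h : Δ ≤ M) :
    (columnMatrix x Q Δ M).det = (Matrix.of fun p b : Fin Δ => (Q b).coeff p).det := by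
  have h1 := det_coeff_mul (Δ := Δ) (elemPoly x : PowerSeries ℝ)
    (by rw [Polynomial.coeff_coe, elemPoly_coeff_zero]) (fun b => (Q b : PowerSeries ℝ))
  simp only [← Polynomial.coe_mul, Polynomial.coeff_coe] at h1
  rw [← h1, Matrix.twoBlockTriangular_det' _ (fun b : Fin M => (b : ℕ) < Δ)]
  · have h2 : ((columnMatrix x Q Δ M).toSquareBlockProp fun b : Fin M => ¬ (b : ℕ) < Δ) = 1 := by
      ext ⟨i, hi⟩ ⟨j, hj⟩
      rw [Matrix.toSquareBlockProp_def]
      simp only [columnMatrix, Matrix.of_apply, if_neg hj, Matrix.one_apply, Subtype.mk.injEq]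
    rw [h2, Matrix.det_one, mul_one]
    let e : Fin Δ ≃ {b : Fin M // (b : ℕ) < Δ} :=
      { toFun := fun b => ⟨⟨b, by omega⟩, b.2⟩
        invFun := fun b => ⟨b.1, b.2⟩
        left_inv := fun _ => rfl
        right_inv := fun _ => rfl }
    rw [← Matrix.det_submatrix_equiv_self e]
    congr 1
    ext p b
    simp [columnMatrix, Matrix.toSquareBlockProp_def, e]
  · intro i hi j hj
    simp only [columnMatrix, Matrix.of_apply, if_neg hj]
    rw [if_neg]
    rintro rfl
    exact hj hi

theorem det_stepMatrix_eq_mul {n k : ℕ} {x : Fin n → ℝ} {y : Fin k → ℝ} {Δ : ℕ} (hΔ : Δ ≤ k)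
    {Q R : ℕ → Polynomial ℝ} (hQ : ∀ b < Δ, IsQuotient x y b (Q b) (R b)) :
    ((stepMatrix x y Δ).submatrix id (emptyBoundary n k)).det =
      ((stepMatrix x y 0).submatrix id (emptyBoundary n k)).det *
        (Matrix.of fun p b : Fin Δ => (Q b).coeff p).det := by
  rw [← det_columnMatrix x Q (show Δ ≤ k + n by omega),
    ← Matrix.det_submatrix_equiv_self (emptyBoundary n k) (columnMatrix x Q Δ (k + n)),
    ← Matrix.det_mul, Matrix.submatrix_mul_equiv]
  congr 2
  ext s b
  rw [Matrix.mul_apply]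
  by_cases hb : (b : ℕ) < Δ
  · have hq := hQ b hb
    simp only [columnMatrix, Matrix.of_apply, if_pos hb]
    rcases s with l | l
    · simp only [stepMatrix]
      rw [Fin.sum_univ_eq_sum_range (fun p => homogEntry y p (k - 1 - l) *
        (elemPoly x * Q b).coeff p), hq.mul_eq]
      simp only [Polynomial.coeff_add, mul_add]
      rw [Finset.sum_add_distrib, sum_homogEntry_mul_rootPoly_mul y n _ (by omega) _
        (hq.degree_rem_lt.trans_le (by exact_mod_cast natDegree_elemPoly_le x)), add_zero]
      simp [Polynomial.coeff_X_pow]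
    · simp only [stepMatrix, if_neg (show ¬ Δ ≤ (b : ℕ) by omega), Nat.zero_le, if_true]
      rw [Fin.sum_univ_eq_sum_range (fun p => homogEntry (-x) (k + l) p *
        (elemPoly x * Q b).coeff p), sum_homogEntry_neg_mul _ _ _ _ (by omega),
        Polynomial.coeff_eq_zero_of_degree_lt]
      exact hq.degree_lt.trans_le (by exact_mod_cast Nat.le_add_right _ _)
  · simp only [columnMatrix, Matrix.of_apply, if_neg hb]
    rcases s with l | l <;> simp [stepMatrix, not_lt.1 hb]

theorem schurPoly_zero {n : ℕ} (x : Fin n → ℝ) : schurPoly x (fun _ => 0) = 1 := by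
  unfold schurPoly
  rw [Matrix.det_of_isUpperTriangular]
  · refine Finset.prod_eq_one fun i _ => ?_
    simp [completeHomog_zero]
  · intro i j hij
    have h1 : (j : ℕ) < i := hij
    exact if_neg (by simp only; omega)

theorem det_stepMatrix_self {n k : ℕ} (x : Fin n → ℝ) (y : Fin k → ℝ) :
    ((stepMatrix x y k).submatrix id (emptyBoundary n k)).det = 1 := by
  classical
  rw [det_stepMatrix_eq_sum x y k le_rfl, Finset.sum_eq_single (fun _ => 0)]
  · rw [if_pos]
    · have : conjPartition (fun _ : Fin n => (0 : Fin (k + 1))) = fun _ => 0 := by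
        ext j
        simp [conjPartition]
      rw [this]
      simp only [Fin.val_zero]
      rw [schurPoly_zero, schurPoly_zero, mul_one]
    · refine ⟨antitone_const, ?_⟩
      unfold firstPart
      split_ifs <;> simp
  · rintro lam - hne
    rw [if_neg]
    rintro ⟨h, hf⟩
    apply hne
    ext i
    have hn : 0 < n := i.pos
    have h1 : lam i ≤ lam ⟨0, hn⟩ := h (Fin.le_def.2 (Nat.zero_le _))
    rw [Fin.le_def] at h1
    simp only [firstPart, dif_pos hn] at hf
    simp only [Fin.val_zero]
    omega
  · simp

theorem det_stepMatrix_zero_of_injective {n k : ℕ} {x : Fin n → ℝ} {y : Fin k → ℝ}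
    (hx : ∀ i, 0 ≤ x i) (hy : ∀ j, 0 < y j) (hinj : Function.Injective y) :
    ((stepMatrix x y 0).submatrix id (emptyBoundary n k)).det =
      ∏ j, (elemPoly x).eval (y j) := by
  choose Q R hQR using fun b : Fin k => exists_isQuotient (x := x) (y := y) hx hy b.2
  let Q' : ℕ → Polynomial ℝ := fun b => if h : b < k then Q ⟨b, h⟩ else 0
  let R' : ℕ → Polynomial ℝ := fun b => if h : b < k then R ⟨b, h⟩ else 0
  have hQ' : ∀ b < k, IsQuotient x y b (Q' b) (R' b) := by
    intro b hb
    simp only [Q', R', dif_pos hb]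
    exact hQR ⟨b, hb⟩
  have h1 := det_stepMatrix_eq_mul le_rfl hQ'
  rw [det_stepMatrix_self] at h1
  have h2 : Matrix.diagonal (fun j => (elemPoly x).eval (y j)) * (Matrix.vandermonde y *
      Matrix.of fun p b : Fin k => (Q' b).coeff p) = Matrix.vandermonde y := by
    ext j b
    rw [Matrix.diagonal_mul, Matrix.mul_apply]
    simp only [Matrix.vandermonde_apply, Matrix.of_apply]
    have h3 : ∑ p : Fin k, y j ^ (p : ℕ) * (Q' b).coeff p = (Q' b).eval (y j) := by
      rw [Polynomial.eval_eq_sum_range' (n := k),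
        ← Fin.sum_univ_eq_sum_range (fun p => (Q' b).coeff p * y j ^ p)]
      · exact Finset.sum_congr rfl fun p _ => mul_comm _ _
      · by_cases h0 : Q' b = 0
        · rw [h0]; simpa using j.pos
        · exact (Polynomial.natDegree_lt_iff_degree_lt h0).2 (hQ' b b.2).degree_lt
    rw [h3, ← Polynomial.eval_mul, (hQ' b b.2).mul_eq, Polynomial.eval_add, Polynomial.eval_mul]
    have h4 : (rootPoly y).eval (y j) = 0 := by
      rw [rootPoly, Polynomial.eval_prod]
      exact Finset.prod_eq_zero (Finset.mem_univ j) (by simp)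
    simp [h4]
  have h5 := congrArg Matrix.det h2
  rw [Matrix.det_mul, Matrix.det_mul, Matrix.det_diagonal] at h5
  have hV : (Matrix.vandermonde y).det ≠ 0 := Matrix.det_vandermonde_ne_zero_iff.2 hinj
  set q := (Matrix.of fun p b : Fin k => (Q' b).coeff p).det
  have h6 : (∏ j, (elemPoly x).eval (y j)) * q = 1 :=
    mul_left_cancel₀ hV (by linear_combination h5)
  have hq : q ≠ 0 := right_ne_zero_of_mul_eq_one h6
  exact mul_right_cancel₀ hq (h1.symm.trans h6.symm)

theorem det_stepMatrix_zero {n k : ℕ} {x : Fin n → ℝ} {y : Fin k → ℝ}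
    (hx : ∀ i, 0 ≤ x i) (hy : ∀ j, 0 < y j) :
    ((stepMatrix x y 0).submatrix id (emptyBoundary n k)).det =
      ∏ j, (elemPoly x).eval (y j) := by
  let Y : ℝ → Fin k → ℝ := fun d j => y j + j * d
  have hY : Continuous Y := by fun_prop
  have hY0 : Y 0 = y := by ext; simp [Y]
  have hF : Continuous fun d =>
      ((stepMatrix x (Y d) 0).submatrix id (emptyBoundary n k)).det := by
    refine Continuous.matrix_det ?_
    refine continuous_matrix fun s p => ?_
    rcases s with l | l
    · exact (continuous_homogEntry _ _).comp hY
    · simp only [Matrix.submatrix_apply, id, stepMatrix]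
      exact continuous_const
  have hG : Continuous fun d => ∏ j, (elemPoly x).eval (Y d j) := by
    refine continuous_finsetProd _ fun j _ => (elemPoly x).continuous.comp ?_
    exact (continuous_apply j).comp hY
  have hev : ∀ᶠ d in 𝓝[>] (0 : ℝ), ((stepMatrix x (Y d) 0).submatrix id (emptyBoundary n k)).det =
      ∏ j, (elemPoly x).eval (Y d j) := by
    have h1 : ∀ i j : Fin k, i ≠ j → ∀ᶠ d in 𝓝[>] (0 : ℝ), Y d i ≠ Y d j := by
      intro i j hij
      have hne : ((i : ℕ) : ℝ) - (j : ℕ) ≠ 0 := by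
        rw [sub_ne_zero]
        exact fun h => hij (Fin.ext (by exact_mod_cast h))
      by_cases hyij : y i = y j
      · filter_upwards [self_mem_nhdsWithin] with d hd
        intro h
        have hd' : (0 : ℝ) < d := hd
        have : (((i : ℕ) : ℝ) - (j : ℕ)) * d = 0 := by
          simp only [Y] at h
          linear_combination h - hyij
        exact (mul_ne_zero hne hd'.ne') this
      · have hc : Tendsto (fun d => Y d i - Y d j) (𝓝[>] (0 : ℝ)) (𝓝 (y i - y j)) := by
          have : Continuous fun d => Y d i - Y d j := by fun_prop
          have h2 := this.tendsto 0
          simp only [hY0] at h2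
          exact h2.mono_left nhdsWithin_le_nhds
        filter_upwards [hc.eventually_ne (sub_ne_zero.2 hyij)] with d hd
        exact sub_ne_zero.1 hd
    have h2 : ∀ᶠ d in 𝓝[>] (0 : ℝ), ∀ i j : Fin k, i ≠ j → Y d i ≠ Y d j := by
      simp only [eventually_all]
      exact h1
    filter_upwards [h2, self_mem_nhdsWithin] with d hd hd0
    refine det_stepMatrix_zero_of_injective hx (fun j => ?_) fun i j hij => ?_
    · have hd' : (0 : ℝ) < d := hd0
      have := hy j
      simp only [Y]
      positivity
    · by_contra hne
      exact hd i j hne hij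
  have hl1 := (hF.tendsto 0).mono_left (nhdsWithin_le_nhds (s := Set.Ioi 0))
  have hl2 := (hG.tendsto 0).mono_left (nhdsWithin_le_nhds (s := Set.Ioi 0))
  have := tendsto_nhds_unique (hl1.congr' hev) hl2
  simpa only [hY0] using this

theorem dualSchurProb_eq_det_coeff {n k : ℕ} {x : Fin n → ℝ} {y : Fin k → ℝ}
    (hx : ∀ i, 0 ≤ x i) (hy : ∀ j, 0 < y j) {Δ : ℕ} (hΔ : Δ ≤ k)
    {Q R : ℕ → Polynomial ℝ} (hQ : ∀ b < Δ, IsQuotient x y b (Q b) (R b)) :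
    dualSchurProb x y (fun lam => firstPart lam + Δ ≤ k) =
      (Matrix.of fun p b : Fin Δ => (Q b).coeff p).det := by
  classical
  have h1 := det_stepMatrix_eq_mul hΔ hQ
  rw [det_stepMatrix_eq_sum x y Δ hΔ, det_stepMatrix_zero hx hy] at h1
  have h2 : dualSchurProb x y (fun lam => firstPart lam + Δ ≤ k) =
      (∏ i, ∏ j, (1 + x i * y j)⁻¹) *
      ∑ lam : Fin n → Fin (k + 1), if Antitone lam ∧ firstPart lam + Δ ≤ k then
        schurPoly x (fun i => (lam i : ℕ)) * schurPoly y (conjPartition lam) else 0 := by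
    unfold dualSchurProb
    rw [Finset.mul_sum]
    refine Finset.sum_congr rfl fun lam _ => ?_
    rw [mul_ite, mul_zero, dualSchurWeight, mul_assoc]
    congr
  have h3 : ∏ j, (elemPoly x).eval (y j) = ∏ i, ∏ j, (1 + x i * y j) := by
    rw [Finset.prod_comm]
    refine Finset.prod_congr rfl fun j _ => ?_
    rw [elemPoly, Polynomial.eval_prod]
    simp
  have h4 : ∏ i, ∏ j, (1 + x i * y j) ≠ 0 := by
    refine Finset.prod_ne_zero_iff.2 fun i _ => Finset.prod_ne_zero_iff.2 fun j _ => ?_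
    have := mul_nonneg (hx i) (hy j).le
    positivity
  rw [h2, h1, h3]
  simp only [Finset.prod_inv_distrib]
  rw [inv_mul_cancel_left₀ h4]

/-! ### Integrals of rational functions along vertical lines -/

theorem integrable_of_quadratic_decay {h : ℝ → ℂ} (hc : Continuous h) {C M : ℝ}
    (hb : ∀ t : ℝ, M ≤ |t| → ‖h t‖ ≤ C / t ^ 2) : MeasureTheory.Integrable h := by
  have hO : ∀ l : Filter ℝ, (∀ᶠ t in l, max M 1 ≤ |t|) →
      h =O[l] fun t : ℝ => (1 + t ^ 2)⁻¹ := by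
    intro l hl
    refine Asymptotics.IsBigO.of_bound (2 * |C|) ?_
    filter_upwards [hl] with t ht
    have h1 := hb t ((le_max_left _ _).trans ht)
    have h2 : 1 ≤ |t| := (le_max_right _ _).trans ht
    have h3 : 1 ≤ t ^ 2 := by rw [← sq_abs]; nlinarith
    refine h1.trans ?_
    rw [Real.norm_of_nonneg (by positivity), ← div_eq_mul_inv, div_le_div_iff₀ (by positivity)
      (by positivity)]
    have := le_abs_self C
    nlinarith [abs_nonneg C]
  refine (hc.locallyIntegrable).integrable_of_isBigO_atBot_atTop (hO _ ?_)
    (integrable_inv_one_add_sq.integrableAtFilter _) (hO _ ?_)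
    (integrable_inv_one_add_sq.integrableAtFilter _)
  · exact tendsto_abs_atBot_atTop.eventually_ge_atTop _
  · exact tendsto_abs_atTop_atTop.eventually_ge_atTop _

theorem abs_le_norm_line (σ t : ℝ) : |t| ≤ ‖(σ + t * Complex.I : ℂ)‖ := by
  have := Complex.abs_im_le_norm (σ + t * Complex.I : ℂ)
  simpa using this

theorem abs_le_norm_line' (σ t : ℝ) : |σ| ≤ ‖(σ + t * Complex.I : ℂ)‖ := by
  have := Complex.abs_re_le_norm (σ + t * Complex.I : ℂ)
  simpa using this

theorem integrable_line_of_decay {F : ℂ → ℂ} {ε C M : ℝ}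
    (hc : Continuous fun t : ℝ => F (ε + t * Complex.I)) (hC : 0 ≤ C)
    (hb : ∀ w, M ≤ ‖w‖ → ‖F w‖ ≤ C / ‖w‖ ^ 2) :
    MeasureTheory.Integrable fun t : ℝ => F (ε + t * Complex.I) := by
  refine integrable_of_quadratic_decay hc (C := C) (M := max M 1) fun t ht => ?_
  have h1 := abs_le_norm_line ε t
  refine (hb _ (((le_max_left _ _).trans ht).trans h1)).trans ?_
  have h2 : 1 ≤ |t| := (le_max_right _ _).trans ht
  rw [← sq_abs t]
  gcongr

theorem integral_line_eq_zero_of_decay {F : ℂ → ℂ} {ε C M : ℝ}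
    (hd : DifferentiableOn ℂ F {w | ε ≤ w.re}) (hC : 0 ≤ C)
    (hb : ∀ w, M ≤ ‖w‖ → ‖F w‖ ≤ C / ‖w‖ ^ 2) :
    ∫ t : ℝ, F (ε + t * Complex.I) = 0 := by
  have hc : Continuous fun t : ℝ => F (ε + t * Complex.I) := by
    rw [← continuousOn_univ]
    refine hd.continuousOn.comp (by fun_prop) fun t _ => ?_
    simp
  have hint := integrable_line_of_decay hc hC hb
  have hlim := MeasureTheory.intervalIntegral_tendsto_integral hint
    tendsto_neg_atTop_atBot tendsto_id
  refine tendsto_nhds_unique hlim ?_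
  have hbound : ∀ᶠ R : ℝ in atTop, ‖∫ t in (-R)..id R, F (ε + t * Complex.I)‖ ≤
      4 * C * (R⁻¹ + |ε| * R⁻¹ ^ 2) := by
    filter_upwards [eventually_ge_atTop (max M 1)] with R hR
    have hM : M ≤ R := (le_max_left _ _).trans hR
    have hR1 : 1 ≤ R := (le_max_right _ _).trans hR
    have hR0 : 0 < R := by linarith
    set W := |ε| + R with hW
    have hεW : ε ≤ W := by linarith [le_abs_self ε]
    have hrect := Complex.integral_boundary_rect_eq_zero_of_differentiableOn F
      (ε + (-R : ℝ) * Complex.I) (W + R * Complex.I) (hd.mono (by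
        intro w hw
        rw [Complex.mem_reProdIm] at hw
        simp only [Complex.add_re, Complex.ofReal_re, Complex.mul_re, Complex.I_re, mul_zero,
          Complex.ofReal_im, Complex.I_im, mul_one, sub_self, add_zero] at hw
        rw [Set.uIcc_of_le hεW] at hw
        exact hw.1.1))
    simp only [Complex.add_re, Complex.ofReal_re, Complex.mul_re, Complex.I_re, mul_zero,
          Complex.ofReal_im, Complex.I_im, mul_one, sub_self, add_zero, Complex.add_im,
          Complex.mul_im, zero_add, smul_eq_mul] at hrect
    have hfar : ∀ w : ℂ, R ≤ ‖w‖ → ‖F w‖ ≤ C / R ^ 2 := by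
      intro w hw
      refine (hb w (hM.trans hw)).trans ?_
      gcongr
    have b1 : ‖∫ x : ℝ in ε..W, F (x + (-R : ℝ) * Complex.I)‖ ≤ C / R ^ 2 * |W - ε| := by
      refine intervalIntegral.norm_integral_le_of_norm_le_const fun x _ => hfar _ ?_
      have := abs_le_norm_line x (-R)
      rwa [abs_neg, abs_of_pos hR0] at this
    have b2 : ‖∫ x : ℝ in ε..W, F (x + R * Complex.I)‖ ≤ C / R ^ 2 * |W - ε| := by
      refine intervalIntegral.norm_integral_le_of_norm_le_const fun x _ => hfar _ ?_
      have := abs_le_norm_line x R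
      rwa [abs_of_pos hR0] at this
    have b3 : ‖∫ y : ℝ in (-R)..R, F (W + y * Complex.I)‖ ≤ C / R ^ 2 * |R - -R| := by
      refine intervalIntegral.norm_integral_le_of_norm_le_const fun x _ => hfar _ ?_
      refine le_trans ?_ (abs_le_norm_line' W x)
      rw [hW, abs_of_nonneg (by positivity)]
      linarith [abs_nonneg ε]
    have e : Complex.I * ∫ y : ℝ in (-R)..R, F (ε + y * Complex.I) =
        (∫ x : ℝ in ε..W, F (x + (-R : ℝ) * Complex.I)) -
        (∫ x : ℝ in ε..W, F (x + R * Complex.I)) +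
        Complex.I * ∫ y : ℝ in (-R)..R, F (W + y * Complex.I) := by
      linear_combination -hrect
    have e2 := congrArg norm e
    rw [norm_mul, Complex.norm_I, one_mul] at e2
    simp only [id]
    rw [e2]
    have n1 := norm_add_le ((∫ x : ℝ in ε..W, F (x + (-R : ℝ) * Complex.I)) -
        (∫ x : ℝ in ε..W, F (x + R * Complex.I)))
        (Complex.I * ∫ y : ℝ in (-R)..R, F (W + y * Complex.I))
    have n2 := norm_sub_le (∫ x : ℝ in ε..W, F (x + (-R : ℝ) * Complex.I))
        (∫ x : ℝ in ε..W, F (x + R * Complex.I))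
    rw [norm_mul Complex.I, Complex.norm_I, one_mul] at n1
    have a1 : |W - ε| ≤ 2 * |ε| + R := by
      rw [abs_of_nonneg (by linarith)]
      linarith [neg_abs_le ε]
    have a2 : |R - -R| = 2 * R := by rw [abs_of_pos (by linarith)]; ring
    rw [a2] at b3
    have b4 : C / R ^ 2 * |W - ε| ≤ C / R ^ 2 * (2 * |ε| + R) := by gcongr
    have e3 : 4 * C * (R⁻¹ + |ε| * R⁻¹ ^ 2) =
        C / R ^ 2 * (2 * |ε| + R) * 2 + C / R ^ 2 * (2 * R) := by
      field_simp
      ring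
    rw [e3]
    linarith
  refine squeeze_zero_norm' hbound ?_
  have h1 := tendsto_inv_atTop_zero (𝕜 := ℝ)
  have h2 := ((h1.add ((h1.pow 2).const_mul |ε|)).const_mul (4 * C))
  simpa using h2

theorem tendsto_aeval_div_pow (p : Polynomial ℝ) :
    Tendsto (fun w : ℂ => Polynomial.aeval w p / w ^ p.natDegree) (Bornology.cobounded ℂ)
      (𝓝 (p.leadingCoeff : ℂ)) := by
  have h1 : Tendsto (fun w : ℂ => Polynomial.aeval w⁻¹ p.reverse) (Bornology.cobounded ℂ)
      (𝓝 (p.leadingCoeff : ℂ)) := by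
    have h2 : Continuous fun w : ℂ => Polynomial.aeval w p.reverse := by fun_prop
    have h3 := (h2.tendsto 0).comp (tendsto_inv₀_cobounded (α := ℂ))
    have h4 : Polynomial.aeval (0 : ℂ) p.reverse = (p.leadingCoeff : ℂ) := by
      rw [← Polynomial.coeff_zero_reverse, Polynomial.aeval_def,
        Polynomial.eval₂_at_zero]
      rfl
    rw [h4] at h3
    exact h3
  refine h1.congr' ?_
  have hne : ∀ᶠ w : ℂ in Bornology.cobounded ℂ, w ≠ 0 := by
    exact Bornology.eventually_ne_cobounded 0
  filter_upwards [hne] with w hw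
  let _ := invertibleOfNonzero hw
  have := Polynomial.eval₂_reverse_mul_pow (algebraMap ℝ ℂ) w p
  rw [invOf_eq_inv] at this
  rw [eq_div_iff (pow_ne_zero _ hw)]
  exact this

theorem exists_quadratic_decay {p q : Polynomial ℝ} (h : p.degree + 1 < q.degree) :
    ∃ C M : ℝ, 0 ≤ C ∧ ∀ w : ℂ, M ≤ ‖w‖ →
      ‖Polynomial.aeval w p / Polynomial.aeval w q‖ ≤ C / ‖w‖ ^ 2 := by
  by_cases hp : p = 0
  · exact ⟨0, 0, le_rfl, fun w _ => by simp [hp]⟩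
  have hq : q ≠ 0 := by
    rintro rfl
    simp at h
  have hdeg : p.natDegree + 2 ≤ q.natDegree := by
    rw [Polynomial.degree_eq_natDegree hp, Polynomial.degree_eq_natDegree hq] at h
    have : p.natDegree + 1 < q.natDegree := by exact_mod_cast h
    omega
  have hlim := (tendsto_aeval_div_pow p).div (tendsto_aeval_div_pow q)
    (by simpa using hq)
  have hev : ∀ᶠ w : ℂ in Bornology.cobounded ℂ,
      ‖(fun w : ℂ => Polynomial.aeval w p / w ^ p.natDegree) w /
        (fun w : ℂ => Polynomial.aeval w q / w ^ q.natDegree) w‖ <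
        ‖(p.leadingCoeff : ℂ) / q.leadingCoeff‖ + 1 :=
    hlim.norm.eventually_lt_const (by linarith)
  obtain ⟨M, -, hM⟩ := (hasBasis_cobounded_norm (E := ℂ)).eventually_iff.1 hev
  refine ⟨‖(p.leadingCoeff : ℂ) / q.leadingCoeff‖ + 1, max M 1, by positivity, fun w hw => ?_⟩
  have hw1 : 1 ≤ ‖w‖ := (le_max_right _ _).trans hw
  have hw0 : w ≠ 0 := by
    rintro rfl
    simp at hw1
    linarith
  have h1 := (hM (x := w) ((le_max_left _ _).trans hw)).le
  simp only at h1
  have h2 : Polynomial.aeval w p / Polynomial.aeval w q =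
      (Polynomial.aeval w p / w ^ p.natDegree) / (Polynomial.aeval w q / w ^ q.natDegree) *
        (w ^ p.natDegree / w ^ q.natDegree) := by
    have := pow_ne_zero p.natDegree hw0
    have := pow_ne_zero q.natDegree hw0
    by_cases hqz : Polynomial.aeval w q = 0
    · simp [hqz]
    · field_simp
  have h3 : ‖w ^ p.natDegree / w ^ q.natDegree‖ ≤ 1 / ‖w‖ ^ 2 := by
    rw [norm_div, norm_pow, norm_pow, div_le_div_iff₀ (by positivity) (by positivity), one_mul,
      ← pow_add]
    exact pow_le_pow_right₀ hw1 hdeg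
  rw [h2, norm_mul]
  exact (mul_le_mul h1 h3 (norm_nonneg _) (by positivity)).trans_eq (by ring)

theorem integrable_rational_line {p q : Polynomial ℝ} (h : p.degree + 1 < q.degree) {ε : ℝ}
    (hq : ∀ t : ℝ, Polynomial.aeval (ε + t * Complex.I) q ≠ 0) :
    MeasureTheory.Integrable fun t : ℝ =>
      Polynomial.aeval (ε + t * Complex.I) p / Polynomial.aeval (ε + t * Complex.I) q := by
  obtain ⟨C, M, hC, hb⟩ := exists_quadratic_decay h
  refine integrable_line_of_decay
    (F := fun w => Polynomial.aeval w p / Polynomial.aeval w q) ?_ hC hb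
  refine Continuous.div ?_ ?_ hq <;> fun_prop

theorem integral_rational_line_right {p q : Polynomial ℝ} (h : p.degree + 1 < q.degree) {ε : ℝ}
    (hq : ∀ w : ℂ, ε ≤ w.re → Polynomial.aeval w q ≠ 0) :
    ∫ t : ℝ, Polynomial.aeval (ε + t * Complex.I) p / Polynomial.aeval (ε + t * Complex.I) q =
      0 := by
  obtain ⟨C, M, hC, hb⟩ := exists_quadratic_decay h
  refine integral_line_eq_zero_of_decay
    (F := fun w => Polynomial.aeval w p / Polynomial.aeval w q) ?_ hC hb
  intro w hw
  exact ((Polynomial.differentiable_aeval p w).div (Polynomial.differentiable_aeval q w)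
    (hq w hw)).differentiableWithinAt

theorem integral_rational_line_left {p q : Polynomial ℝ} (h : p.degree + 1 < q.degree) {ε : ℝ}
    (hq : ∀ w : ℂ, w.re ≤ ε → Polynomial.aeval w q ≠ 0) :
    ∫ t : ℝ, Polynomial.aeval (ε + t * Complex.I) p / Polynomial.aeval (ε + t * Complex.I) q =
      0 := by
  obtain ⟨C, M, hC, hb⟩ := exists_quadratic_decay h
  have h1 := integral_line_eq_zero_of_decay (ε := -ε)
    (F := fun w => Polynomial.aeval (-w) p / Polynomial.aeval (-w) q) (C := C) (M := M) ?_ hC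
    (fun w hw => by simpa using hb (-w) (by simpa using hw))
  · rw [← MeasureTheory.integral_neg_eq_self] at h1
    rw [← h1]
    congr 1
    ext t
    have : -(((-ε : ℝ) : ℂ) + ((-t : ℝ) : ℂ) * Complex.I) = ε + t * Complex.I := by
      push_cast
      ring
    rw [this]
  · intro w hw
    have hw' : (-w).re ≤ ε := by
      have : -ε ≤ w.re := hw
      simp
      linarith
    exact (((Polynomial.differentiable_aeval p (-w)).comp w differentiableAt_id.neg).div
      ((Polynomial.differentiable_aeval q (-w)).comp w differentiableAt_id.neg)
      (hq (-w) hw')).differentiableWithinAt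

theorem integral_univ_div_sq_add_sq {d : ℝ} (hd : 0 < d) :
    MeasureTheory.Integrable (fun t : ℝ => d / (d ^ 2 + t ^ 2)) ∧
      ∫ t : ℝ, d / (d ^ 2 + t ^ 2) = Real.pi := by
  have h : (fun t : ℝ => d / (d ^ 2 + t ^ 2)) = fun t => d⁻¹ * (1 + (d⁻¹ * t) ^ 2)⁻¹ := by
    ext t
    have : d ^ 2 + t ^ 2 ≠ 0 := by positivity
    have : 1 + (d⁻¹ * t) ^ 2 ≠ 0 := by positivity
    field_simp
  rw [h]
  constructor
  · exact (integrable_inv_one_add_sq.comp_mul_left' (inv_ne_zero hd.ne')).const_mul _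
  · rw [MeasureTheory.integral_const_mul, MeasureTheory.Measure.integral_comp_mul_left
      (fun t : ℝ => (1 + t ^ 2)⁻¹), integral_univ_inv_one_add_sq, inv_inv, abs_of_pos hd,
      smul_eq_mul, inv_mul_cancel_left₀ hd.ne']

/-- The linear factor `1 - z / y`. -/
def linFactor (y : ℝ) : Polynomial ℝ := 1 + Polynomial.C (-y⁻¹) * Polynomial.X

theorem aeval_linFactor (y : ℝ) (w : ℂ) :
    Polynomial.aeval w (linFactor y) = 1 - w / y := by
  simp [linFactor]
  ring

theorem aeval_linFactor_ne_zero {y : ℝ} (hy : 0 < y) {w : ℂ} (hw : w.re < y) :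
    Polynomial.aeval w (linFactor y) ≠ 0 := by
  rw [aeval_linFactor, sub_ne_zero]
  intro h
  rw [eq_comm, div_eq_one_iff_eq (by exact_mod_cast hy.ne')] at h
  rw [h, Complex.ofReal_re] at hw
  exact lt_irrefl _ hw

theorem degree_linFactor {y : ℝ} (hy : 0 < y) : (linFactor y).degree = 1 := by
  unfold linFactor
  rw [add_comm]
  exact Polynomial.degree_linear (neg_ne_zero.2 (inv_ne_zero hy.ne'))

theorem re_line (ε t : ℝ) : (ε + t * Complex.I : ℂ).re = ε := by simp

theorem line_ne_zero {ε : ℝ} (hε : 0 < ε) (t : ℝ) : (ε + t * Complex.I : ℂ) ≠ 0 := by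
  intro h
  have := congrArg Complex.re h
  rw [re_line] at this
  simp at this
  exact hε.ne' this

theorem integral_simple_pole {ε y : ℝ} (hε : 0 < ε) (hy : ε < y) :
    ∫ t : ℝ, Polynomial.aeval (ε + t * Complex.I) (1 : Polynomial ℝ) /
      Polynomial.aeval (ε + t * Complex.I) (Polynomial.X ^ 1 * linFactor y) = 2 * Real.pi := by
  set F : ℝ → ℂ := fun t => Polynomial.aeval (ε + t * Complex.I) (1 : Polynomial ℝ) /
      Polynomial.aeval (ε + t * Complex.I) (Polynomial.X ^ 1 * linFactor y) with hF
  have hy0 : 0 < y := hε.trans hy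
  have hint : MeasureTheory.Integrable F := by
    refine integrable_rational_line ?_ fun t => ?_
    · rw [Polynomial.degree_mul, degree_linFactor hy0]
      simp
      norm_num
    · rw [map_mul, map_pow, Polynomial.aeval_X]
      refine mul_ne_zero (pow_ne_zero _ (line_ne_zero hε t)) (aeval_linFactor_ne_zero hy0 ?_)
      rwa [re_line]
  have hd : 0 < y - ε := by linarith
  have hsum : ∀ t, F t + F (-t) =
      ((2 * (ε / (ε ^ 2 + t ^ 2) + (y - ε) / ((y - ε) ^ 2 + t ^ 2)) : ℝ) : ℂ) := by
    intro t
    have hval : ∀ t : ℝ, F t = (ε - t * Complex.I) / (ε ^ 2 + t ^ 2) +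
        (y - ε + t * Complex.I) / ((y - ε) ^ 2 + t ^ 2) := by
      intro t
      simp only [hF, map_mul, Polynomial.aeval_X, map_one, aeval_linFactor, pow_one]
      have n1 := line_ne_zero hε t
      have n2 : (ε - t * Complex.I : ℂ) ≠ 0 := by
        have := line_ne_zero hε (-t)
        push_cast at this
        rwa [neg_mul, ← sub_eq_add_neg] at this
      have n3 : (y - ε - t * Complex.I : ℂ) ≠ 0 := by
        have := line_ne_zero hd (-t)
        push_cast at this
        rwa [neg_mul, ← sub_eq_add_neg] at this
      have n4 : (y - ε + t * Complex.I : ℂ) ≠ 0 := by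
        have := line_ne_zero hd t
        push_cast at this
        exact this
      have n5 : (y : ℂ) ≠ 0 := by exact_mod_cast hy0.ne'
      have f1 : (ε ^ 2 + t ^ 2 : ℂ) = (ε + t * Complex.I) * (ε - t * Complex.I) := by
        linear_combination ((t : ℂ) ^ 2) * Complex.I_sq
      have f2 : ((y - ε) ^ 2 + t ^ 2 : ℂ) = (y - ε + t * Complex.I) * (y - ε - t * Complex.I) := by
        linear_combination ((t : ℂ) ^ 2) * Complex.I_sq
      have f3 : (1 - (ε + t * Complex.I) / y : ℂ) = (y - ε - t * Complex.I) / y := by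
        field_simp
        ring
      rw [f1, f2, f3]
      field_simp
      ring
    rw [hval, hval]
    push_cast
    ring
  have h1 : ∫ t, F (-t) = ∫ t, F t := MeasureTheory.integral_neg_eq_self F _
  have h2 : ∫ t, (F t + F (-t)) = 2 * ∫ t, F t := by
    rw [MeasureTheory.integral_add hint hint.comp_neg, h1]
    ring
  simp_rw [hsum] at h2
  rw [integral_complex_ofReal, MeasureTheory.integral_const_mul,
    MeasureTheory.integral_add (integral_univ_div_sq_add_sq hε).1 (integral_univ_div_sq_add_sq hd).1,
    (integral_univ_div_sq_add_sq hε).2, (integral_univ_div_sq_add_sq hd).2] at h2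
  have h3 : (2 : ℂ) ≠ 0 := two_ne_zero
  apply mul_left_cancel₀ h3
  rw [← h2]
  push_cast
  ring

/-- The integral of a rational function along the vertical line through `ε`. -/
def ratIntegral (ε : ℝ) (p q : Polynomial ℝ) : ℂ :=
  ∫ t : ℝ, Polynomial.aeval (ε + t * Complex.I) p / Polynomial.aeval (ε + t * Complex.I) q

theorem aeval_X_pow_mul_ne_zero {ε : ℝ} (hε : 0 < ε) {q : Polynomial ℝ}
    (hq : ∀ t : ℝ, Polynomial.aeval (ε + t * Complex.I : ℂ) q ≠ 0) (a : ℕ) (t : ℝ) :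
    Polynomial.aeval (ε + t * Complex.I : ℂ) (Polynomial.X ^ a * q) ≠ 0 := by
  rw [map_mul, map_pow, Polynomial.aeval_X]
  exact mul_ne_zero (pow_ne_zero _ (line_ne_zero hε t)) (hq t)

theorem ratIntegral_simple_pole {ε y : ℝ} (hε : 0 < ε) (hy : ε < y) (a : ℕ) :
    ratIntegral ε 1 (Polynomial.X ^ (a + 1) * linFactor y) =
      2 * Real.pi * ((y⁻¹ : ℝ) : ℂ) ^ a := by
  have hy0 : 0 < y := hε.trans hy
  have hl : ∀ t : ℝ, Polynomial.aeval (ε + t * Complex.I : ℂ) (linFactor y) ≠ 0 := fun t =>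
    aeval_linFactor_ne_zero hy0 (by rwa [re_line])
  induction a with
  | zero => simpa [ratIntegral] using integral_simple_pole hε hy
  | succ a ih =>
    have hdeg : (1 : Polynomial ℝ).degree + 1 < (Polynomial.X ^ (a + 1) * linFactor y).degree := by
      rw [Polynomial.degree_mul, degree_linFactor hy0, Polynomial.degree_X_pow,
        Polynomial.degree_one]
      exact_mod_cast (by omega : 0 + 1 < a + 1 + 1)
    have hdeg2 : (1 : Polynomial ℝ).degree + 1 < (Polynomial.X ^ (a + 2) : Polynomial ℝ).degree := by
      rw [Polynomial.degree_X_pow, Polynomial.degree_one]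
      exact_mod_cast (by omega : 0 + 1 < a + 2)
    have h0 : ∀ w : ℂ, ε ≤ w.re → Polynomial.aeval w (Polynomial.X ^ (a + 2) : Polynomial ℝ) ≠ 0 := by
      intro w hw
      rw [map_pow, Polynomial.aeval_X]
      refine pow_ne_zero _ ?_
      rintro rfl
      simp at hw
      linarith
    have h1 := integral_rational_line_right hdeg2 h0
    have i1 := integrable_rational_line hdeg (aeval_X_pow_mul_ne_zero hε hl _)
    have i2 := integrable_rational_line hdeg2 (ε := ε) (fun t => h0 _ (by rw [re_line]))
    have hsplit : ratIntegral ε 1 (Polynomial.X ^ (a + 1 + 1) * linFactor y) =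
        ratIntegral ε 1 (Polynomial.X ^ (a + 2)) +
        ((y⁻¹ : ℝ) : ℂ) * ratIntegral ε 1 (Polynomial.X ^ (a + 1) * linFactor y) := by
      unfold ratIntegral
      rw [← MeasureTheory.integral_const_mul, ← MeasureTheory.integral_add i2 (i1.const_mul _)]
      congr 1
      ext t
      have n1 := hl t
      have n2 := line_ne_zero hε t
      have n3 : (y : ℂ) ≠ 0 := by exact_mod_cast hy0.ne'
      simp only [map_mul, map_pow, Polynomial.aeval_X, map_one, Complex.ofReal_inv]
      have e : (y : ℂ) = Polynomial.aeval (ε + t * Complex.I : ℂ) (linFactor y) * y +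
          (ε + t * Complex.I) := by
        rw [aeval_linFactor]
        field_simp
        ring
      generalize Polynomial.aeval (ε + t * Complex.I : ℂ) (linFactor y) = u at *
      generalize (ε + t * Complex.I : ℂ) = w at *
      field_simp
      linear_combination (w ^ (a + 1)) * e
    rw [hsplit, ih]
    unfold ratIntegral
    rw [h1]
    ring

/-- `∏ (1 - z / y_j)`. -/
def invRootPoly {k : ℕ} (y : Fin k → ℝ) : Polynomial ℝ := ∏ j, linFactor (y j)

theorem degree_invRootPoly {k : ℕ} {y : Fin k → ℝ} (hy : ∀ j, 0 < y j) :
    (invRootPoly y).degree = k := by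
  rw [invRootPoly, Polynomial.degree_prod, Finset.sum_congr rfl fun j _ => degree_linFactor (hy j)]
  simp

theorem coeff_invRootPoly_zero {k : ℕ} (y : Fin k → ℝ) : (invRootPoly y).coeff 0 = 1 := by
  rw [Polynomial.coeff_zero_eq_eval_zero, invRootPoly, Polynomial.eval_prod]
  exact Finset.prod_eq_one fun j _ => by simp [linFactor]

theorem aeval_invRootPoly {k : ℕ} (y : Fin k → ℝ) (w : ℂ) :
    Polynomial.aeval w (invRootPoly y) = ∏ j, (1 - w / y j) := by
  rw [invRootPoly, map_prod]
  exact Finset.prod_congr rfl fun j _ => aeval_linFactor _ _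

theorem aeval_invRootPoly_ne_zero {k : ℕ} {y : Fin k → ℝ} {ε : ℝ} (hε : 0 < ε)
    (hy : ∀ j, ε < y j) {w : ℂ} (hw : w.re ≤ ε) : Polynomial.aeval w (invRootPoly y) ≠ 0 := by
  rw [invRootPoly, map_prod]
  exact Finset.prod_ne_zero_iff.2 fun j _ =>
    aeval_linFactor_ne_zero (hε.trans (hy j)) (hw.trans_lt (hy j))

theorem rootPoly_eq {k : ℕ} {y : Fin k → ℝ} (hy : ∀ j, 0 < y j) :
    rootPoly y = Polynomial.C (∏ j, -y j) * invRootPoly y := by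
  rw [rootPoly, invRootPoly, map_prod, ← Finset.prod_mul_distrib]
  refine Finset.prod_congr rfl fun j _ => ?_
  have h : (Polynomial.C (y j) * Polynomial.C ((y j)⁻¹) : Polynomial ℝ) = 1 := by
    rw [← Polynomial.C_mul, mul_inv_cancel₀ (hy j).ne', Polynomial.C_1]
  rw [linFactor, Polynomial.C_neg, Polynomial.C_neg]
  linear_combination (-Polynomial.X) * h

/-- The Taylor coefficients at `0` of `Q / ∏ (1 - z / y_j)`, with `deg Q < k`, are integrals along
a vertical line between `0` and the `y_j`. -/
theorem ratIntegral_div_invRootPoly {k : ℕ} {y : Fin k → ℝ} {ε : ℝ} (hε : 0 < ε)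
    (hy : ∀ j, ε < y j) (a : ℕ) (Q : Polynomial ℝ) (hQ : Q.degree < k) :
    ratIntegral ε Q (Polynomial.X ^ (a + 1) * invRootPoly y) =
      2 * Real.pi * ((PowerSeries.coeff a
        ((invRootPoly y : PowerSeries ℝ)⁻¹ * (Q : PowerSeries ℝ)) : ℝ) : ℂ) := by
  rcases k with _ | k
  · have : Q = 0 := by
      rw [← Polynomial.degree_eq_bot]
      rw [Nat.cast_zero] at hQ
      exact Nat.WithBot.lt_zero_iff.1 hQ
    simp [this, ratIntegral]
  have hy0 : ∀ j, 0 < y j := fun j => hε.trans (hy j)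
  set B := invRootPoly y with hB
  set B0 := invRootPoly (fun j : Fin k => y j.succ) with hB0
  have hBB : B = linFactor (y 0) * B0 := by
    rw [hB, invRootPoly, Fin.prod_univ_succ]
    rfl
  have hBd : B.degree = ((k + 1 : ℕ) : WithBot ℕ) := degree_invRootPoly hy0
  have hB0d : B0.degree = (k : WithBot ℕ) := degree_invRootPoly fun j => hy0 j.succ
  have hBne : ∀ w : ℂ, w.re ≤ ε → Polynomial.aeval w B ≠ 0 := fun w hw =>
    aeval_invRootPoly_ne_zero hε hy hw
  have hl : ∀ t : ℝ, Polynomial.aeval (ε + t * Complex.I : ℂ) (linFactor (y 0)) ≠ 0 := fun t =>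
    aeval_linFactor_ne_zero (hy0 0) (by rw [re_line]; exact hy 0)
  have hBinv : (B : PowerSeries ℝ) * (B : PowerSeries ℝ)⁻¹ = 1 := by
    refine PowerSeries.mul_inv_cancel _ ?_
    rw [← PowerSeries.coeff_zero_eq_constantCoeff_apply, Polynomial.coeff_coe,
      coeff_invRootPoly_zero]
    exact one_ne_zero
  -- The induction step removes the value at `0`.
  have hdec : ∃ Q' : Polynomial ℝ, Q'.degree < k ∧
      Q = Polynomial.C (Q.coeff 0) * B0 + Polynomial.X * Q' := by
    set P := Q - Polynomial.C (Q.coeff 0) * B0 with hP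
    have hP0 : P.coeff 0 = 0 := by
      rw [hP, Polynomial.coeff_sub, Polynomial.coeff_C_mul, coeff_invRootPoly_zero]
      ring
    have hPX : Polynomial.X * P.divX = P := by
      have := Polynomial.X_mul_divX_add P
      rwa [hP0, Polynomial.C_0, add_zero] at this
    refine ⟨P.divX, ?_, by rw [hPX, hP]; ring⟩
    have hPd : P.degree < ((k + 1 : ℕ) : WithBot ℕ) := by
      refine (Polynomial.degree_sub_le _ _).trans_lt (max_lt hQ ?_)
      refine (Polynomial.degree_mul_le _ _).trans_lt ?_
      rw [hB0d]
      refine (add_le_add_left Polynomial.degree_C_le _).trans_lt ?_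
      rw [zero_add]
      exact_mod_cast Nat.lt_succ_self k
    by_cases h0 : P.divX = 0
    · rw [h0, Polynomial.degree_zero]
      exact WithBot.bot_lt_coe _
    · rw [← hPX, Polynomial.degree_mul, Polynomial.degree_X,
        Polynomial.degree_eq_natDegree h0] at hPd
      rw [Polynomial.degree_eq_natDegree h0]
      have : 1 + P.divX.natDegree < k + 1 := by exact_mod_cast hPd
      exact_mod_cast (by omega : P.divX.natDegree < k)
  obtain ⟨Q', hQ'd, hQ'⟩ := hdec
  set q := Q.coeff 0 with hq
  have hsplit : ∀ m : ℕ, ratIntegral ε Q (Polynomial.X ^ (m + 1) * B) =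
      (q : ℂ) * ratIntegral ε 1 (Polynomial.X ^ (m + 1) * linFactor (y 0)) +
      ratIntegral ε Q' (Polynomial.X ^ m * B) := by
    intro m
    have i1 : MeasureTheory.Integrable fun t : ℝ =>
        Polynomial.aeval (ε + t * Complex.I : ℂ) (1 : Polynomial ℝ) /
        Polynomial.aeval (ε + t * Complex.I : ℂ) (Polynomial.X ^ (m + 1) * linFactor (y 0)) := by
      refine integrable_rational_line ?_ (aeval_X_pow_mul_ne_zero hε hl _)
      rw [Polynomial.degree_mul, degree_linFactor (hy0 0), Polynomial.degree_X_pow,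
        Polynomial.degree_one]
      exact_mod_cast (by omega : 0 + 1 < m + 1 + 1)
    have i2 : MeasureTheory.Integrable fun t : ℝ =>
        Polynomial.aeval (ε + t * Complex.I : ℂ) Q' /
        Polynomial.aeval (ε + t * Complex.I : ℂ) (Polynomial.X ^ m * B) := by
      refine integrable_rational_line ?_
        (aeval_X_pow_mul_ne_zero hε (fun t => hBne _ (by rw [re_line])) _)
      rw [Polynomial.degree_mul, hBd, Polynomial.degree_X_pow]
      by_cases h0 : Q' = 0
      · rw [h0, Polynomial.degree_zero, WithBot.bot_add]
        exact_mod_cast WithBot.bot_lt_coe (m + (k + 1))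
      · rw [Polynomial.degree_eq_natDegree h0] at hQ'd ⊢
        have : Q'.natDegree < k := by exact_mod_cast hQ'd
        exact_mod_cast (by omega : Q'.natDegree + 1 < m + (k + 1))
    unfold ratIntegral
    rw [← MeasureTheory.integral_const_mul, ← MeasureTheory.integral_add (i1.const_mul _) i2]
    congr 1
    ext t
    have n1 := line_ne_zero hε t
    have n2 := hBne (ε + t * Complex.I : ℂ) (by rw [re_line])
    rw [hBB, map_mul] at n2
    have n3 := left_ne_zero_of_mul n2
    have n4 := right_ne_zero_of_mul n2
    conv_lhs => rw [hQ']
    rw [hBB]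
    simp only [map_mul, map_pow, map_add, Polynomial.aeval_X, map_one, Polynomial.aeval_C,
      Complex.coe_algebraMap]
    field_simp
    ring
  have hps : (B : PowerSeries ℝ)⁻¹ * (Q : PowerSeries ℝ) =
      PowerSeries.C q * (PowerSeries.mk fun m => (y 0)⁻¹ ^ m) +
      PowerSeries.X * ((B : PowerSeries ℝ)⁻¹ * (Q' : PowerSeries ℝ)) := by
    have hg := geomSeries_mul (y 0)⁻¹
    have hBp : (B : PowerSeries ℝ) =
        (1 - PowerSeries.C (y 0)⁻¹ * PowerSeries.X) * (B0 : PowerSeries ℝ) := by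
      rw [hBB, Polynomial.coe_mul]
      congr 1
      simp [linFactor, sub_eq_add_neg]
    have hQp : (Q : PowerSeries ℝ) = PowerSeries.C q * (B0 : PowerSeries ℝ) +
        PowerSeries.X * (Q' : PowerSeries ℝ) := by
      conv_lhs => rw [hQ']
      simp
    rw [hQp]
    have hkey : (B : PowerSeries ℝ)⁻¹ * (B0 : PowerSeries ℝ) =
        PowerSeries.mk fun m => (y 0)⁻¹ ^ m := by
      calc (B : PowerSeries ℝ)⁻¹ * (B0 : PowerSeries ℝ)
          = (B : PowerSeries ℝ)⁻¹ * (((PowerSeries.mk fun m => (y 0)⁻¹ ^ m) *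
            (1 - PowerSeries.C (y 0)⁻¹ * PowerSeries.X)) * (B0 : PowerSeries ℝ)) := by
              rw [hg, one_mul]
        _ = ((B : PowerSeries ℝ) * (B : PowerSeries ℝ)⁻¹) *
            (PowerSeries.mk fun m => (y 0)⁻¹ ^ m) := by rw [hBp]; ring
        _ = _ := by rw [hBinv, one_mul]
    linear_combination (PowerSeries.C q) * hkey
  rw [hsplit a, hps, map_add, PowerSeries.coeff_C_mul, PowerSeries.coeff_mk,
    ratIntegral_simple_pole hε (hy 0) a]
  cases a with
  | zero =>
    have h0 : ratIntegral ε Q' (Polynomial.X ^ 0 * B) = 0 := by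
      rw [pow_zero, one_mul]
      refine integral_rational_line_left ?_ hBne
      rw [hBd]
      by_cases h0 : Q' = 0
      · rw [h0, Polynomial.degree_zero, WithBot.bot_add]
        exact_mod_cast WithBot.bot_lt_coe (k + 1)
      · rw [Polynomial.degree_eq_natDegree h0] at hQ'd ⊢
        have : Q'.natDegree < k := by exact_mod_cast hQ'd
        exact_mod_cast (by omega : Q'.natDegree + 1 < k + 1)
    rw [h0, PowerSeries.coeff_zero_X_mul]
    push_cast
    ring
  | succ a =>
    rw [PowerSeries.coeff_succ_X_mul, ratIntegral_div_invRootPoly hε hy a Q'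
      (hQ'd.trans (by exact_mod_cast Nat.lt_succ_self k))]
    push_cast
    ring
termination_by a

/-- The entry of the Toeplitz matrix whose determinant gives the distribution of the first part. -/
def lineIntegral {n k : ℕ} (x : Fin n → ℝ) (y : Fin k → ℝ) (ε : ℝ) (r : ℤ) : ℂ :=
  (2 * Real.pi : ℂ)⁻¹ * ∫ t : ℝ, (ε + t * Complex.I : ℂ) ^ (-r - 1) /
    ((∏ i, (1 + x i * (ε + t * Complex.I))) * ∏ j, (1 - (ε + t * Complex.I) / y j))

theorem aeval_elemPoly {n : ℕ} (x : Fin n → ℝ) (w : ℂ) :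
    Polynomial.aeval w (elemPoly x) = ∏ i, (1 + x i * w) := by
  rw [elemPoly, map_prod]
  exact Finset.prod_congr rfl fun i _ => by simp

theorem aeval_elemPoly_ne_zero {n : ℕ} {x : Fin n → ℝ} (hx : ∀ i, 0 ≤ x i) {w : ℂ}
    (hw : 0 ≤ w.re) : Polynomial.aeval w (elemPoly x) ≠ 0 := by
  rw [aeval_elemPoly]
  refine Finset.prod_ne_zero_iff.2 fun i _ h => ?_
  have := congrArg Complex.re h
  simp at this
  have := mul_nonneg (hx i) hw
  linarith

theorem dualSchurProb_eq_det_lineIntegral {n k : ℕ} {x : Fin n → ℝ} {y : Fin k → ℝ}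
    (hx : ∀ i, 0 ≤ x i) {Δ : ℕ} (hΔ : Δ ≤ k) {ε : ℝ} (hε : 0 < ε) (hy : ∀ j, ε < y j) :
    ((dualSchurProb x y (fun lam => firstPart lam + Δ ≤ k) : ℝ) : ℂ) =
      (Matrix.of fun a b : Fin Δ => lineIntegral x y ε ((a : ℤ) - b)).det := by
  have hy0 : ∀ j, 0 < y j := fun j => hε.trans (hy j)
  choose Q R hQR using fun b : Fin k => exists_isQuotient (x := x) (y := y) hx hy0 b.2
  let Q' : ℕ → Polynomial ℝ := fun b => if h : b < k then Q ⟨b, h⟩ else 0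
  let R' : ℕ → Polynomial ℝ := fun b => if h : b < k then R ⟨b, h⟩ else 0
  have hQ' : ∀ b < Δ, IsQuotient x y b (Q' b) (R' b) := by
    intro b hb
    simp only [Q', R', dif_pos (show b < k by omega)]
    exact hQR ⟨b, by omega⟩
  rw [dualSchurProb_eq_det_coeff hx hy0 hΔ hQ']
  set B := invRootPoly y with hB
  have hBinv : (B : PowerSeries ℝ) * (B : PowerSeries ℝ)⁻¹ = 1 := by
    refine PowerSeries.mul_inv_cancel _ ?_
    rw [← PowerSeries.coeff_zero_eq_constantCoeff_apply, Polynomial.coeff_coe,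
      coeff_invRootPoly_zero]
    exact one_ne_zero
  have h1 := det_coeff_mul (Δ := Δ) (B : PowerSeries ℝ)
    (by rw [Polynomial.coeff_coe, coeff_invRootPoly_zero])
    (fun b => (B : PowerSeries ℝ)⁻¹ * (Q' b : PowerSeries ℝ))
  simp only [← mul_assoc, hBinv, one_mul, Polynomial.coeff_coe] at h1
  rw [h1]
  have hmap := RingHom.map_det Complex.ofRealHom (Matrix.of fun p b : Fin Δ =>
    PowerSeries.coeff p ((B : PowerSeries ℝ)⁻¹ * (Q' b : PowerSeries ℝ)))
  rw [Complex.ofRealHom_eq_coe] at hmap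
  rw [hmap]
  congr 1
  ext a b
  have hq := hQ' b b.2
  simp only [RingHom.mapMatrix_apply, Matrix.map_apply, Matrix.of_apply,
    Complex.ofRealHom_eq_coe]
  have hpi : (2 * Real.pi : ℂ) ≠ 0 := by
    exact_mod_cast (by positivity : (2 * Real.pi : ℝ) ≠ 0)
  have h2 := ratIntegral_div_invRootPoly hε hy a (Q' b) hq.degree_lt
  unfold lineIntegral
  rw [eq_inv_mul_iff_mul_eq₀ hpi, ← h2]
  set c : ℝ := ∏ j, -y j with hc
  have hAne : ∀ w : ℂ, ε ≤ w.re →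
      Polynomial.aeval w (Polynomial.X ^ ((a : ℕ) + 1) * elemPoly x) ≠ 0 := by
    intro w hw
    rw [map_mul, map_pow, Polynomial.aeval_X]
    refine mul_ne_zero (pow_ne_zero _ ?_) (aeval_elemPoly_ne_zero hx (hε.le.trans hw))
    rintro rfl
    simp at hw
    linarith
  have hBne : ∀ w : ℂ, w.re ≤ ε → Polynomial.aeval w B ≠ 0 := fun w hw =>
    aeval_invRootPoly_ne_zero hε hy hw
  have hA0 : elemPoly x ≠ 0 := elemPoly_ne_zero x
  have d1 : (R' b).degree + 1 < (Polynomial.X ^ ((a : ℕ) + 1) * elemPoly x).degree := by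
    have hR := hq.degree_rem_lt
    rw [Polynomial.degree_mul, Polynomial.degree_X_pow, Polynomial.degree_eq_natDegree hA0]
    by_cases h0 : R' b = 0
    · rw [h0, Polynomial.degree_zero, WithBot.bot_add]
      exact_mod_cast WithBot.bot_lt_coe (a + 1 + (elemPoly x).natDegree)
    · rw [Polynomial.degree_eq_natDegree h0] at hR ⊢
      have : (R' b).natDegree < (elemPoly x).natDegree := by exact_mod_cast hR
      exact_mod_cast (by omega : (R' b).natDegree + 1 < a + 1 + (elemPoly x).natDegree)
  have d2 : (Q' b).degree + 1 < (Polynomial.X ^ ((a : ℕ) + 1) * B).degree := by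
    have hQ := hq.degree_lt
    rw [Polynomial.degree_mul, Polynomial.degree_X_pow, degree_invRootPoly hy0]
    by_cases h0 : Q' b = 0
    · rw [h0, Polynomial.degree_zero, WithBot.bot_add]
      exact_mod_cast WithBot.bot_lt_coe (a + 1 + k)
    · rw [Polynomial.degree_eq_natDegree h0] at hQ ⊢
      have : (Q' b).natDegree < k := by exact_mod_cast hQ
      exact_mod_cast (by omega : (Q' b).natDegree + 1 < a + 1 + k)
  have i1 := integrable_rational_line d1 (ε := ε) (fun t => hAne _ (by rw [re_line]))
  have i2 := integrable_rational_line d2 (ε := ε)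
    (aeval_X_pow_mul_ne_zero hε (fun t => hBne _ (by rw [re_line])) _)
  have z1 := integral_rational_line_right d1 hAne
  have hsub := MeasureTheory.integral_sub i2 (i1.const_mul (c : ℂ))
  rw [MeasureTheory.integral_const_mul, z1, mul_zero, sub_zero] at hsub
  unfold ratIntegral
  rw [← hsub]
  congr 1
  ext t
  have n1 := line_ne_zero hε t
  have n2 := hBne (ε + t * Complex.I : ℂ) (by rw [re_line])
  have n3 := aeval_elemPoly_ne_zero hx (w := (ε + t * Complex.I : ℂ)) (by rw [re_line]; exact hε.le)
  have hmul := congrArg (Polynomial.aeval (ε + t * Complex.I : ℂ)) hq.mul_eq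
  rw [rootPoly_eq hy0] at hmul
  simp only [map_mul, map_add, map_pow, Polynomial.aeval_X, Polynomial.aeval_C,
    Complex.coe_algebraMap, ← hc, ← hB] at hmul
  rw [← aeval_elemPoly, ← aeval_invRootPoly, ← hB]
  simp only [map_mul, map_pow, Polynomial.aeval_X]
  have e1 : -((a : ℤ) - b) - 1 = (b : ℤ) - ((a : ℕ) + 1 : ℕ) := by push_cast; ring
  rw [e1, zpow_sub₀ n1, zpow_natCast, zpow_natCast]
  have hmul' : (ε + t * Complex.I : ℂ) ^ (b : ℕ) = Polynomial.aeval (ε + t * Complex.I : ℂ)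
      (elemPoly x) * Polynomial.aeval (ε + t * Complex.I : ℂ) (Q' b) -
      c * Polynomial.aeval (ε + t * Complex.I : ℂ) B *
        Polynomial.aeval (ε + t * Complex.I : ℂ) (R' b) := by
    rw [hmul]; ring
  rw [hmul']
  generalize Polynomial.aeval (ε + t * Complex.I : ℂ) B = β at *
  generalize Polynomial.aeval (ε + t * Complex.I : ℂ) (elemPoly x) = α at *
  field_simp

/-! ### The limiting Toeplitz entries -/

/-- `1 / (2 Γ(1 + r / 2))`, read as `0` at the poles. -/
def critEntry (r : ℤ) : ℝ := (2 * Real.Gamma (1 + r / 2))⁻¹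

theorem critEntry_recursion (r : ℤ) : (r : ℝ) * critEntry r = 2 * critEntry (r - 2) := by
  unfold critEntry
  have e : (1 + ((r - 2 : ℤ) : ℝ) / 2) = (r : ℝ) / 2 := by push_cast; ring
  rw [e]
  by_cases hr : (r : ℝ) = 0
  · rw [hr]
    simp
  · rw [add_comm, Real.Gamma_add_one (by positivity)]
    by_cases hG : Real.Gamma ((r : ℝ) / 2) = 0
    · simp [hG]
    · field_simp

/-- The integral of `w^(-r-1) exp(w²)` along the line `Re w = 1`, divided by `2 π i`. -/
def gaussLine (r : ℤ) : ℂ :=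
  (2 * Real.pi : ℂ)⁻¹ * ∫ t : ℝ, (1 + t * Complex.I : ℂ) ^ (-r - 1) *
    Complex.exp ((1 + t * Complex.I) ^ 2)

theorem norm_sq_one_add (t : ℝ) : ‖(1 + t * Complex.I : ℂ)‖ ^ 2 = 1 + t ^ 2 := by
  rw [← Complex.normSq_eq_norm_sq, Complex.normSq_apply]
  simp
  ring

theorem one_le_norm_one_add (t : ℝ) : 1 ≤ ‖(1 + t * Complex.I : ℂ)‖ := by
  have := norm_sq_one_add t
  nlinarith [norm_nonneg (1 + t * Complex.I : ℂ), sq_nonneg t]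

theorem one_add_ne_zero (t : ℝ) : (1 + t * Complex.I : ℂ) ≠ 0 := by
  have := one_le_norm_one_add t
  rw [← norm_pos_iff]
  linarith

theorem norm_zpow_le (t : ℝ) (m : ℤ) :
    ‖(1 + t * Complex.I : ℂ) ^ m‖ ≤ (1 + t ^ 2) ^ m.natAbs := by
  have h1 := one_le_norm_one_add t
  rw [norm_zpow, ← norm_sq_one_add]
  have h2 : m ≤ (m.natAbs : ℤ) := Int.le_natAbs
  refine (zpow_le_zpow_right₀ h1 h2).trans ?_
  rw [zpow_natCast]
  exact pow_le_pow_left₀ (norm_nonneg _) (le_self_pow₀ h1 two_ne_zero) _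

theorem norm_exp_sq (t : ℝ) : ‖Complex.exp ((1 + t * Complex.I) ^ 2)‖ = Real.exp (1 - t ^ 2) := by
  rw [Complex.norm_exp]
  congr 1
  simp [sq]

theorem continuous_zpow_line (m : ℤ) : Continuous fun t : ℝ => (1 + t * Complex.I : ℂ) ^ m :=
  Continuous.zpow₀ (by fun_prop) m fun t => Or.inl (one_add_ne_zero t)

theorem integrable_gaussLine (m : ℤ) : MeasureTheory.Integrable fun t : ℝ =>
    (1 + t * Complex.I : ℂ) ^ m * Complex.exp ((1 + t * Complex.I) ^ 2) := by
  have hc : Continuous fun t : ℝ =>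
      (1 + t * Complex.I : ℂ) ^ m * Complex.exp ((1 + t * Complex.I) ^ 2) :=
    (continuous_zpow_line m).mul (by fun_prop)
  have hg := (integrable_exp_neg_mul_sq (b := 1 / 2) (by norm_num)).const_mul
    (2 ^ m.natAbs * (m.natAbs.factorial : ℝ) * Real.exp (3 / 2))
  refine hg.mono' hc.aestronglyMeasurable (MeasureTheory.ae_of_all _ fun t => ?_)
  rw [norm_mul, norm_exp_sq]
  refine (mul_le_mul_of_nonneg_right (norm_zpow_le t m) (Real.exp_pos _).le).trans ?_
  have h1 := Real.pow_div_factorial_le_exp ((1 + t ^ 2) / 2) (by positivity) m.natAbs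
  rw [div_pow, div_div, div_le_iff₀ (by positivity)] at h1
  refine (mul_le_mul_of_nonneg_right h1 (Real.exp_pos _).le).trans (le_of_eq ?_)
  have e : Real.exp ((1 + t ^ 2) / 2) * Real.exp (1 - t ^ 2) =
      Real.exp (3 / 2) * Real.exp (-(1 / 2) * t ^ 2) := by
    rw [← Real.exp_add, ← Real.exp_add]
    congr 1
    ring
  linear_combination (2 ^ m.natAbs * (m.natAbs.factorial : ℝ)) * e

theorem gaussLine_recursion (r : ℤ) : (r : ℂ) * gaussLine r = 2 * gaussLine (r - 2) := by
  have hderiv : ∀ t : ℝ, HasDerivAt (fun t : ℝ => (1 + t * Complex.I : ℂ) ^ (-r) *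
      Complex.exp ((1 + t * Complex.I) ^ 2))
      (Complex.I * (-r * ((1 + t * Complex.I : ℂ) ^ (-r - 1) *
        Complex.exp ((1 + t * Complex.I) ^ 2)) + 2 * ((1 + t * Complex.I : ℂ) ^ (-(r - 2) - 1) *
        Complex.exp ((1 + t * Complex.I) ^ 2)))) t := by
    intro t
    have h1 : HasDerivAt (fun t : ℝ => (1 + t * Complex.I : ℂ)) Complex.I t := by
      have := ((Complex.ofRealCLM.hasDerivAt (x := t)).mul_const Complex.I).const_add 1
      simpa using this
    have h2 := (hasDerivAt_zpow (-r) (1 + t * Complex.I : ℂ) (Or.inl (one_add_ne_zero t))).comp t h1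
    have h3 := (h1.pow 2).cexp
    refine (h2.mul h3).congr_deriv ?_
    have e : (1 + t * Complex.I : ℂ) ^ (-(r - 2) - 1) =
        (1 + t * Complex.I) ^ (-r) * (1 + t * Complex.I) := by
      rw [← zpow_add_one₀ (one_add_ne_zero t)]
      congr 1
      ring
    rw [e]
    simp only [Function.comp_apply, Pi.pow_apply]
    push_cast
    ring
  have i1 := (integrable_gaussLine (-r - 1)).const_mul (-r : ℂ)
  have i2 := (integrable_gaussLine (-(r - 2) - 1)).const_mul (2 : ℂ)
  have h0 := MeasureTheory.integral_eq_zero_of_hasDerivAt_of_integrable hderiv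
    ((i1.add i2).const_mul Complex.I) (integrable_gaussLine (-r))
  rw [MeasureTheory.integral_const_mul] at h0
  have h0' := (mul_eq_zero.1 h0).resolve_left Complex.I_ne_zero
  rw [MeasureTheory.integral_add i1 i2, MeasureTheory.integral_const_mul,
    MeasureTheory.integral_const_mul] at h0'
  unfold gaussLine
  linear_combination (-(2 * Real.pi : ℂ)⁻¹) * h0'

theorem integral_gauss_shift (u : ℝ) :
    ∫ t : ℝ, Complex.exp ((1 + t * Complex.I) ^ 2 - u * (1 + t * Complex.I)) =
      (Real.sqrt Real.pi : ℂ) * Complex.exp (-(1 / 4 : ℝ) * (u : ℂ) ^ 2) := by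
  have h := integral_cexp_quadratic (b := -1) (by simp) (Complex.I * (2 - u)) (1 - u)
  have e1 : ∀ t : ℝ, ((1 + t * Complex.I) ^ 2 - u * (1 + t * Complex.I) : ℂ) =
      -1 * (t : ℂ) ^ 2 + Complex.I * (2 - u) * t + (1 - u) := by
    intro t
    linear_combination ((t : ℂ) ^ 2) * Complex.I_sq
  simp_rw [e1]
  rw [h]
  congr 1
  · rw [neg_neg, div_one, ← Complex.ofReal_ofNat, ← Complex.ofReal_one, ← Complex.ofReal_div,
      ← Complex.ofReal_cpow Real.pi_pos.le, Real.sqrt_eq_rpow]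
  · congr 1
    push_cast
    linear_combination (1 / 4 * (2 - (u : ℂ)) ^ 2) * Complex.I_sq

theorem gaussLine_neg_one : gaussLine (-1) = (critEntry (-1) : ℂ) := by
  have h := integral_gauss_shift 0
  unfold gaussLine critEntry
  simp only [Complex.ofReal_zero, zero_mul, sub_zero] at h
  simp only [neg_neg, sub_self, zpow_zero, one_mul]
  rw [h]
  have e : (1 + ((-1 : ℤ) : ℝ) / 2) = 1 / 2 := by norm_num
  rw [e, Real.Gamma_one_half_eq]
  have hs : (Real.sqrt Real.pi : ℂ) * Real.sqrt Real.pi = Real.pi := by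
    rw [← Complex.ofReal_mul, Real.mul_self_sqrt Real.pi_pos.le]
  have hs0 : (Real.sqrt Real.pi : ℂ) ≠ 0 := by
    exact_mod_cast (Real.sqrt_pos.2 Real.pi_pos).ne'
  have hp : (Real.pi : ℂ) ≠ 0 := by exact_mod_cast Real.pi_ne_zero
  push_cast
  rw [← hs]
  field_simp
  simp

theorem gaussLine_zero : gaussLine 0 = (critEntry 0 : ℂ) := by
  have hswap := MeasureTheory.integral_integral_swap (μ := (MeasureTheory.volume : MeasureTheory.Measure ℝ))
    (ν := MeasureTheory.volume.restrict (Set.Ioi (0 : ℝ)))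
    (f := fun t u : ℝ => Complex.exp ((1 + t * Complex.I) ^ 2 - u * (1 + t * Complex.I))) ?_
  · have h1 : ∀ t : ℝ, ∫ u : ℝ in Set.Ioi 0,
        Complex.exp ((1 + t * Complex.I) ^ 2 - u * (1 + t * Complex.I)) =
        (1 + t * Complex.I : ℂ) ^ (-(0 : ℤ) - 1) * Complex.exp ((1 + t * Complex.I) ^ 2) := by
      intro t
      have h2 := integral_exp_mul_complex_Ioi (a := -(1 + t * Complex.I : ℂ)) (by simp) 0
      have h3 : ∀ u : ℝ, Complex.exp ((1 + t * Complex.I) ^ 2 - u * (1 + t * Complex.I)) =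
          Complex.exp ((1 + t * Complex.I) ^ 2) * Complex.exp (-(1 + t * Complex.I) * u) := by
        intro u
        rw [← Complex.exp_add]
        congr 1
        ring
      simp_rw [h3]
      rw [MeasureTheory.integral_const_mul, h2]
      rw [Complex.ofReal_zero, mul_zero, Complex.exp_zero, neg_div_neg_eq, neg_zero, zero_sub,
        zpow_neg_one, one_div, mul_comm]
    simp_rw [h1, integral_gauss_shift] at hswap
    unfold gaussLine critEntry
    rw [hswap, MeasureTheory.integral_const_mul]
    have h4 := integral_gaussian_Ioi (1 / 4)
    have h5 : ∫ u : ℝ in Set.Ioi 0, Complex.exp (-(1 / 4 : ℝ) * (u : ℂ) ^ 2) =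
        (Real.sqrt Real.pi : ℂ) := by
      have h6 : Real.sqrt (Real.pi / (1 / 4)) / 2 = Real.sqrt Real.pi := by
        rw [show Real.pi / (1 / 4) = 2 ^ 2 * Real.pi by ring, Real.sqrt_mul (by norm_num),
          Real.sqrt_sq (by norm_num)]
        ring
      rw [← h6, ← h4, ← integral_complex_ofReal]
      congr 1
      ext u
      push_cast
      rfl
    rw [h5]
    have hs : (Real.sqrt Real.pi : ℂ) * Real.sqrt Real.pi = Real.pi := by
      rw [← Complex.ofReal_mul, Real.mul_self_sqrt Real.pi_pos.le]
    have hp : (Real.pi : ℂ) ≠ 0 := by exact_mod_cast Real.pi_ne_zero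
    rw [hs]
    simp
    field_simp
  · have hf : MeasureTheory.Integrable (fun t : ℝ => Real.exp 1 * Real.exp (-1 * t ^ 2)) :=
      (integrable_exp_neg_mul_sq one_pos).const_mul _
    have hg : MeasureTheory.Integrable (fun u : ℝ => Real.exp (-1 * u))
        (MeasureTheory.volume.restrict (Set.Ioi (0 : ℝ))) := by
      have := exp_neg_integrableOn_Ioi 0 one_pos
      exact this
    refine (hf.mul_prod hg).mono' (Continuous.aestronglyMeasurable (by fun_prop))
      (MeasureTheory.ae_of_all _ fun z => le_of_eq ?_)
    rw [Function.uncurry, Complex.norm_exp, ← Real.exp_add, ← Real.exp_add]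
    congr 1
    simp [sq]
    ring

theorem gaussLine_eq (r : ℤ) : gaussLine r = (critEntry r : ℂ) := by
  have hdown : ∀ r : ℤ, gaussLine r = (critEntry r : ℂ) →
      gaussLine (r - 2) = (critEntry (r - 2) : ℂ) := by
    intro r h
    have h1 := gaussLine_recursion r
    have h2 := congrArg (fun s : ℝ => (s : ℂ)) (critEntry_recursion r)
    push_cast at h2
    rw [h, h2] at h1
    exact (mul_left_cancel₀ two_ne_zero h1).symm
  have hup : ∀ r : ℤ, r + 2 ≠ 0 → gaussLine r = (critEntry r : ℂ) →
      gaussLine (r + 2) = (critEntry (r + 2) : ℂ) := by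
    intro r hr h
    have h1 := gaussLine_recursion (r + 2)
    have h2 := congrArg (fun s : ℝ => (s : ℂ)) (critEntry_recursion (r + 2))
    simp only [add_sub_cancel_right] at h1 h2
    rw [h] at h1
    have hr' : (((r + 2 : ℤ)) : ℂ) ≠ 0 := by exact_mod_cast hr
    refine mul_left_cancel₀ hr' (h1.trans ?_)
    have h3 := h2.symm
    push_cast at h3 ⊢
    exact h3
  have hneg : ∀ m : ℕ, ∀ r : ℤ, gaussLine r = (critEntry r : ℂ) →
      gaussLine (r - 2 * m) = (critEntry (r - 2 * m) : ℂ) := by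
    intro m r h
    induction m with
    | zero => simpa using h
    | succ m ih =>
      have := hdown _ ih
      have e : r - 2 * ((m + 1 : ℕ) : ℤ) = r - 2 * m - 2 := by push_cast; ring
      rwa [e]
  have hpos : ∀ m : ℕ, ∀ r : ℤ, -1 ≤ r → gaussLine r = (critEntry r : ℂ) →
      gaussLine (r + 2 * m) = (critEntry (r + 2 * m) : ℂ) := by
    intro m r hr h
    induction m with
    | zero => simpa using h
    | succ m ih =>
      have := hup _ (by omega) ih
      have e : r + 2 * ((m + 1 : ℕ) : ℤ) = r + 2 * m + 2 := by push_cast; ring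
      rwa [e]
  have hcase : (∃ m : ℕ, r = 0 - 2 * m) ∨ (∃ m : ℕ, r = 0 + 2 * m) ∨
      (∃ m : ℕ, r = -1 - 2 * m) ∨ ∃ m : ℕ, r = -1 + 2 * m := by
    rcases Int.even_or_odd' r with ⟨q, hq | hq⟩ <;> rcases le_total 0 q with h | h
    · exact Or.inr (Or.inl ⟨q.toNat, by omega⟩)
    · exact Or.inl ⟨(-q).toNat, by omega⟩
    · exact Or.inr (Or.inr (Or.inr ⟨(q + 1).toNat, by omega⟩))
    · by_cases h0 : q = 0
      · exact Or.inr (Or.inr (Or.inr ⟨1, by omega⟩))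
      · exact Or.inr (Or.inr (Or.inl ⟨(-q - 1).toNat, by omega⟩))
  rcases hcase with ⟨m, rfl⟩ | ⟨m, rfl⟩ | ⟨m, rfl⟩ | ⟨m, rfl⟩
  · exact hneg m 0 gaussLine_zero
  · exact hpos m 0 (by norm_num) gaussLine_zero
  · exact hneg m (-1) gaussLine_neg_one
  · exact hpos m (-1) (by norm_num) gaussLine_neg_one

/-! ### The critical determinant -/

theorem critEntry_two_mul_nat (d : ℕ) : critEntry (2 * d) = 1 / 2 * (1 / (d.factorial : ℝ)) := by
  unfold critEntry
  have e : (1 + ((2 * d : ℤ) : ℝ) / 2) = (d : ℝ) + 1 := by push_cast; ring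
  rw [e, Real.Gamma_nat_eq_factorial]
  field_simp

theorem critEntry_two_mul_neg {m : ℤ} (hm : m < 0) : critEntry (2 * m) = 0 := by
  unfold critEntry
  have e : (1 + ((2 * m : ℤ) : ℝ) / 2) = -(((-m - 1).toNat : ℕ) : ℝ) := by
    have : (((-m - 1).toNat : ℕ) : ℤ) = -m - 1 := Int.toNat_of_nonneg (by omega)
    have h2 : (((-m - 1).toNat : ℕ) : ℝ) = -m - 1 := by exact_mod_cast this
    rw [h2]
    push_cast
    ring
  rw [e, Real.Gamma_neg_nat_eq_zero]
  simp

open scoped Nat in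
theorem criticalKernel_eq (Δ i j : ℕ) : criticalKernel Δ i j =
    ∑ l ∈ Finset.range ((Δ - j - 1) / 2 + 1),
      (-1) ^ l / (l ! : ℝ) * critEntry ((i : ℤ) - j - 2 * l) := by
  unfold criticalKernel
  refine Finset.sum_congr rfl fun l _ => ?_
  split_ifs with h
  · obtain ⟨⟨m, hm⟩, hl⟩ := h
    have e1 : ((j : ℤ) - i) / 2 = m := by omega
    have e2 : ((i : ℤ) - j) / 2 = -m := by omega
    rw [e1] at hl
    rw [e2]
    have e3 : (i : ℤ) - j - 2 * l = 2 * (((-m - l).toNat : ℕ) : ℤ) := by omega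
    rw [e3, critEntry_two_mul_nat]
    field_simp
  · set s : ℝ := l + ((j : ℝ) - i) / 2 with hs
    have e1 : critEntry ((i : ℤ) - j - 2 * l) = (2 * Real.Gamma (1 - s))⁻¹ := by
      unfold critEntry
      congr 3
      rw [hs]
      push_cast
      ring
    have e2 : Real.sin (Real.pi * ((j : ℝ) - i) / 2) = (-1) ^ l * Real.sin (Real.pi * s) := by
      have : Real.pi * ((j : ℝ) - i) / 2 = Real.pi * s - l * Real.pi := by rw [hs]; ring
      rw [this, Real.sin_sub_nat_mul_pi]
    have e3 := Real.Gamma_mul_Gamma_one_sub s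
    rw [e2]
    by_cases hsin : Real.sin (Real.pi * s) = 0
    · rw [hsin]
      obtain ⟨m, hm⟩ := Real.sin_eq_zero_iff.1 hsin
      have hm' : (m : ℝ) = s := by
        rw [mul_comm] at hm
        exact mul_left_cancel₀ Real.pi_ne_zero hm
      rw [hs] at hm'
      have hm2 : 2 * m = 2 * l + ((j : ℤ) - i) := by
        have : (2 * m : ℝ) = 2 * l + ((j : ℝ) - i) := by rw [hm']; ring
        exact_mod_cast this
      have hm3 : 0 < m := by
        by_contra hc
        refine h ⟨⟨m - l, by omega⟩, by omega⟩
      have e4 : (i : ℤ) - j - 2 * l = 2 * (-m) := by omega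
      rw [e4, critEntry_two_mul_neg (by omega)]
      ring
    · rw [e1]
      have hG : Real.Gamma (1 - s) ≠ 0 := by
        intro h0
        rw [h0, mul_zero, eq_comm, div_eq_zero_iff] at e3
        rcases e3 with h1 | h1
        · exact Real.pi_ne_zero h1
        · exact hsin h1
      have hpi := Real.pi_ne_zero
      have hΓ : Real.Gamma s = Real.pi / Real.sin (Real.pi * s) / Real.Gamma (1 - s) := by
        rw [← e3]
        field_simp
      rw [hΓ]
      field_simp

open scoped Nat in
/-- The truncation of the Toeplitz matrix of `exp(-z²)`. -/
def expNegSqMatrix (Δ : ℕ) : Matrix (Fin Δ) (Fin Δ) ℝ :=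
  Matrix.of fun m j => if (j : ℕ) ≤ m ∧ Even ((m : ℕ) - j) then
    (-1) ^ (((m : ℕ) - j) / 2) / ((((m : ℕ) - j) / 2) ! : ℝ) else 0

theorem det_expNegSqMatrix (Δ : ℕ) : (expNegSqMatrix Δ).det = 1 := by
  rw [Matrix.det_of_isLowerTriangular]
  · refine Finset.prod_eq_one fun i _ => ?_
    simp [expNegSqMatrix]
  · intro i j hij
    have h : (i : ℕ) < j := hij
    simp only [expNegSqMatrix, Matrix.of_apply]
    rw [if_neg]
    omega

open scoped Nat in
theorem toeplitz_mul_expNegSqMatrix (Δ : ℕ) (A : ℤ → ℝ) (i j : Fin Δ) :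
    ((Matrix.of fun a b : Fin Δ => A ((a : ℤ) - b)) * expNegSqMatrix Δ) i j =
      ∑ l ∈ Finset.range ((Δ - j - 1) / 2 + 1), (-1) ^ l / (l ! : ℝ) *
        A ((i : ℤ) - j - 2 * l) := by
  rw [Matrix.mul_apply]
  simp only [Matrix.of_apply, expNegSqMatrix]
  rw [Fin.sum_univ_eq_sum_range (fun m => A ((i : ℤ) - m) *
    if (j : ℕ) ≤ m ∧ Even (m - (j : ℕ)) then
    (-1) ^ ((m - (j : ℕ)) / 2) / (((m - (j : ℕ)) / 2) ! : ℝ) else 0)]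
  symm
  have hj := j.2
  refine Finset.sum_of_injOn (fun l => (j : ℕ) + 2 * l) ?_ ?_ ?_ ?_
  · intro a _ b _ hab
    simp only at hab
    omega
  · intro l hl
    simp only [Finset.coe_range, Set.mem_Iio] at hl ⊢
    omega
  · intro m hm hm'
    rw [if_neg, mul_zero]
    rintro ⟨h1, q, hq⟩
    refine hm' ⟨q, ?_, ?_⟩
    · simp only [Finset.coe_range, Set.mem_Iio]
      rw [Finset.mem_range] at hm
      omega
    · simp only
      omega
  · intro l _
    have e1 : (j : ℕ) + 2 * l - j = 2 * l := by omega
    simp only [e1]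
    rw [if_pos ⟨by omega, even_two_mul l⟩, Nat.mul_div_cancel_left l (by norm_num), mul_comm]
    congr 2
    push_cast
    ring

theorem criticalDet_eq (Δ : ℕ) :
    criticalDet Δ = (Matrix.of fun a b : Fin Δ => critEntry ((a : ℤ) - b)).det := by
  set T : Matrix (Fin Δ) (Fin Δ) ℝ := Matrix.of fun a b : Fin Δ => critEntry ((a : ℤ) - b) with hT
  set A : ℤ → ℝ := fun r => critEntry r + (-1) ^ r * critEntry r with hA
  have hAodd : ∀ r : ℤ, ¬ Even r → A r = 0 := by
    intro r hr
    simp only [hA, (Int.not_even_iff_odd.1 hr).neg_one_zpow]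
    ring
  have hAneg : ∀ m : ℤ, m < 0 → A (2 * m) = 0 := by
    intro m hm
    simp only [hA, critEntry_two_mul_neg hm]
    ring
  have hApos : ∀ d : ℕ, A (2 * d) = 1 / (d.factorial : ℝ) := by
    intro d
    simp only [hA, critEntry_two_mul_nat, (even_two_mul (d : ℤ)).neg_one_zpow]
    ring
  have hAU : (Matrix.of fun a b : Fin Δ => A ((a : ℤ) - b)) * expNegSqMatrix Δ = 1 := by
    ext i j
    rw [toeplitz_mul_expNegSqMatrix]
    have hi := i.2
    by_cases hev : Even ((i : ℤ) - j)
    · obtain ⟨q, hq⟩ := hev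
      rcases lt_or_ge q 0 with hneg | hpos
      · rw [Matrix.one_apply_ne (by rintro rfl; omega)]
        refine Finset.sum_eq_zero fun l _ => ?_
        have e : (i : ℤ) - j - 2 * l = 2 * (q - l) := by omega
        rw [e, hAneg _ (by omega), mul_zero]
      · obtain ⟨d, rfl⟩ := Int.eq_ofNat_of_zero_le hpos
        have hs : ∑ l ∈ Finset.range ((Δ - j - 1) / 2 + 1), (-1) ^ l / (l.factorial : ℝ) *
            A ((i : ℤ) - j - 2 * l) = ∑ l ∈ Finset.range (d + 1), (-1) ^ l / (l.factorial : ℝ) *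
            A ((i : ℤ) - j - 2 * l) := by
          symm
          refine Finset.sum_subset ?_ ?_
          · intro l
            simp only [Finset.mem_range]
            omega
          · intro l _ hl
            rw [Finset.mem_range, not_lt] at hl
            have e : (i : ℤ) - j - 2 * l = 2 * (d - l) := by omega
            rw [e, hAneg _ (by omega), mul_zero]
        have hs2 : ∑ l ∈ Finset.range (d + 1), (-1) ^ l / (l.factorial : ℝ) *
            A ((i : ℤ) - j - 2 * l) = (1 / (d.factorial : ℝ)) *
            (((∑ l ∈ Finset.range (d + 1), ((-1) ^ l * (d.choose l : ℤ) : ℤ)) : ℤ) : ℝ) := by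
          rw [Int.cast_sum, Finset.mul_sum]
          refine Finset.sum_congr rfl fun l hl => ?_
          rw [Finset.mem_range] at hl
          have e : (i : ℤ) - j - 2 * l = 2 * ((d - l : ℕ) : ℤ) := by omega
          rw [e, hApos]
          push_cast
          rw [Nat.cast_choose ℝ (by omega : l ≤ d)]
          have h1 : (d.factorial : ℝ) ≠ 0 := by positivity
          field_simp
        rw [hs, hs2, Int.alternating_sum_range_choose]
        by_cases hd : d = 0
        · subst hd
          have : i = j := Fin.ext (by omega)
          subst this
          simp
        · rw [if_neg hd, Matrix.one_apply_ne (by rintro rfl; omega)]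
          simp
    · rw [Matrix.one_apply_ne (by rintro rfl; simp at hev)]
      refine Finset.sum_eq_zero fun l _ => ?_
      rw [hAodd, mul_zero]
      intro h
      apply hev
      have := h.add (even_two_mul (l : ℤ))
      simpa using this
  set D : Matrix (Fin Δ) (Fin Δ) ℝ := Matrix.diagonal fun i => (-1) ^ (i : ℕ) with hD
  have hDTD : D * T * D = (Matrix.of fun a b : Fin Δ => A ((a : ℤ) - b)) - T := by
    ext a b
    rw [hD, Matrix.mul_diagonal, Matrix.diagonal_mul]
    simp only [hT, hA, Matrix.sub_apply, Matrix.of_apply]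
    have h1 : (-1 : ℝ) ^ ((a : ℤ) - b) = (-1) ^ (a : ℕ) * (-1) ^ (b : ℕ) := by
      rw [zpow_sub₀ (by norm_num), zpow_natCast, zpow_natCast, div_eq_iff (by positivity),
        mul_assoc, ← mul_pow]
      simp
    rw [h1]
    ring
  have hK : (Matrix.of fun i j : Fin Δ =>
      (if i = j then (1 : ℝ) else 0) - criticalKernel Δ i j) = D * T * D * expNegSqMatrix Δ := by
    rw [hDTD, Matrix.sub_mul, hAU]
    ext i j
    rw [Matrix.sub_apply, hT, toeplitz_mul_expNegSqMatrix, Matrix.of_apply, criticalKernel_eq,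
      Matrix.one_apply]
  have hDD : D.det * D.det = 1 := by
    rw [hD, Matrix.det_diagonal, ← Finset.prod_mul_distrib]
    refine Finset.prod_eq_one fun i _ => ?_
    rw [← mul_pow]
    simp
  unfold criticalDet
  rw [hK, Matrix.det_mul, Matrix.det_mul, Matrix.det_mul, det_expNegSqMatrix]
  linear_combination T.det * hDD

/-! ### Asymptotics of the Toeplitz entries -/

theorem lineIntegral_scale {n k : ℕ} (x : Fin n → ℝ) (y : Fin k → ℝ) {σ : ℝ} (hσ : 0 < σ)
    (r : ℤ) : lineIntegral x y σ⁻¹ r =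
      (σ : ℂ) ^ r * lineIntegral (fun i => x i / σ) (fun j => σ * y j) 1 r := by
  unfold lineIntegral
  have hσc : (σ : ℂ) ≠ 0 := by exact_mod_cast hσ.ne'
  set F : ℝ → ℂ := fun t => ((σ⁻¹ : ℝ) + t * Complex.I : ℂ) ^ (-r - 1) /
    ((∏ i, (1 + x i * ((σ⁻¹ : ℝ) + t * Complex.I))) *
      ∏ j, (1 - ((σ⁻¹ : ℝ) + t * Complex.I) / y j)) with hF
  have h1 := MeasureTheory.Measure.integral_comp_mul_left F σ⁻¹
  rw [inv_inv, abs_of_pos hσ] at h1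
  have h2 : ∀ s : ℝ, F (σ⁻¹ * s) = (σ : ℂ) ^ (r + 1) * (((1 : ℝ) + s * Complex.I : ℂ) ^ (-r - 1) /
      ((∏ i, (1 + ((x i / σ : ℝ) : ℂ) * ((1 : ℝ) + s * Complex.I))) *
        ∏ j, (1 - ((1 : ℝ) + s * Complex.I) / ((σ * y j : ℝ) : ℂ)))) := by
    intro s
    have e : ((σ⁻¹ : ℝ) + (σ⁻¹ * s : ℝ) * Complex.I : ℂ) =
        (σ : ℂ)⁻¹ * ((1 : ℝ) + s * Complex.I) := by
      push_cast
      ring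
    simp only [hF, e]
    rw [mul_zpow, inv_zpow', mul_div_assoc]
    congr 1
    · congr 1
      ring
    · congr 2
      · refine Finset.prod_congr rfl fun i _ => ?_
        push_cast
        ring
      · refine Finset.prod_congr rfl fun i _ => ?_
        push_cast
        rw [mul_comm (σ : ℂ), ← div_div, div_eq_mul_inv _ (σ : ℂ)]
        ring
  simp_rw [h2] at h1
  rw [MeasureTheory.integral_const_mul, Complex.real_smul, zpow_add_one₀ hσc] at h1
  have h3 := mul_left_cancel₀ hσc ((mul_assoc _ _ _).symm.trans ((congrArg (· * _)
    (mul_comm (σ : ℂ) _)).trans h1))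
  rw [mul_left_comm, ← h3]

theorem det_zpow_mul {Δ : ℕ} {c : ℂ} (hc : c ≠ 0) (M : Matrix (Fin Δ) (Fin Δ) ℂ) :
    (Matrix.of fun a b : Fin Δ => c ^ ((a : ℤ) - b) * M a b).det = M.det := by
  have h : (Matrix.of fun a b : Fin Δ => c ^ ((a : ℤ) - b) * M a b) =
      Matrix.diagonal (fun a : Fin Δ => c ^ (a : ℕ)) * M *
        Matrix.diagonal fun b : Fin Δ => (c ^ (b : ℕ))⁻¹ := by
    ext a b
    rw [Matrix.mul_diagonal, Matrix.diagonal_mul, Matrix.of_apply, zpow_sub₀ hc, zpow_natCast,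
      zpow_natCast]
    ring
  rw [h, Matrix.det_mul, Matrix.det_mul, Matrix.det_diagonal, Matrix.det_diagonal,
    mul_right_comm, ← Finset.prod_mul_distrib, Finset.prod_eq_one, one_mul]
  intro a _
  exact mul_inv_cancel₀ (pow_ne_zero _ hc)

theorem norm_log_sub_le {z : ℂ} (hz : ‖z‖ ≤ 1 / 2) :
    ‖Complex.log (1 + z) - (z - z ^ 2 / 2)‖ ≤ ‖z‖ ^ 3 := by
  have h := Complex.norm_log_sub_logTaylor_le 2 (z := z) (by linarith)
  have e : Complex.logTaylor 3 z = z - z ^ 2 / 2 := by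
    simp [Complex.logTaylor_succ, Complex.logTaylor_zero]
    ring
  rw [e] at h
  refine h.trans ?_
  have h1 : (1 - ‖z‖)⁻¹ ≤ 2 := by
    rw [inv_le_comm₀ (by linarith) (by norm_num)]
    linarith
  have h2 : 0 ≤ ‖z‖ ^ 3 := by positivity
  push_cast
  nlinarith

/-- The product of many factors close to `1` is governed by the first two power sums. -/
theorem tendsto_prod_one_add {ι : ℕ → Type*} [∀ n, Fintype (ι n)] (c : ∀ n, ι n → ℂ)
    (δ : ℕ → ℝ) (hδ : Tendsto δ atTop (𝓝 0)) (hc : ∀ᶠ n in atTop, ∀ i, ‖c n i‖ ≤ δ n)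
    (h1 : Tendsto (fun n => ∑ i, c n i) atTop (𝓝 0)) {L : ℂ}
    (h2 : Tendsto (fun n => ∑ i, c n i ^ 2) atTop (𝓝 L)) {M : ℝ}
    (hM : ∀ᶠ n in atTop, ∑ i, ‖c n i‖ ^ 2 ≤ M) :
    Tendsto (fun n => ∏ i, (1 + c n i)) atTop (𝓝 (Complex.exp (-L / 2))) := by
  have hsmall : ∀ᶠ n in atTop, δ n ≤ 1 / 2 :=
    (hδ.eventually_lt_const (by norm_num : (0 : ℝ) < 1 / 2)).mono fun _ h => h.le
  have herr : Tendsto (fun n => ∑ i, (Complex.log (1 + c n i) - (c n i - c n i ^ 2 / 2))) atTop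
      (𝓝 0) := by
    have hb : Tendsto (fun n => |δ n| * M) atTop (𝓝 0) := by
      simpa using hδ.abs.mul_const M
    refine squeeze_zero_norm' ?_ hb
    filter_upwards [hsmall, hc, hM] with n hn hcn hMn
    calc ‖∑ i, (Complex.log (1 + c n i) - (c n i - c n i ^ 2 / 2))‖
        ≤ ∑ i, ‖Complex.log (1 + c n i) - (c n i - c n i ^ 2 / 2)‖ := norm_sum_le _ _
      _ ≤ ∑ i, |δ n| * ‖c n i‖ ^ 2 := by
          refine Finset.sum_le_sum fun i _ => (norm_log_sub_le ((hcn i).trans hn)).trans ?_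
          rw [pow_succ']
          gcongr
          exact (hcn i).trans (le_abs_self _)
      _ = |δ n| * ∑ i, ‖c n i‖ ^ 2 := by rw [Finset.mul_sum]
      _ ≤ |δ n| * M := by gcongr
  have hlog : Tendsto (fun n => ∑ i, Complex.log (1 + c n i)) atTop (𝓝 (-L / 2)) := by
    have h3 := herr.add (h1.sub (h2.div_const 2))
    have e : (0 : ℂ) + (0 - L / 2) = -L / 2 := by ring
    rw [e] at h3
    refine h3.congr fun n => ?_
    rw [Finset.sum_div, ← Finset.sum_sub_distrib, ← Finset.sum_add_distrib]
    exact Finset.sum_congr rfl fun i _ => by ring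
  refine ((Complex.continuous_exp.tendsto _).comp hlog).congr' ?_
  filter_upwards [hsmall, hc] with n hn hcn
  simp only [Function.comp_apply]
  rw [Complex.exp_sum]
  refine Finset.prod_congr rfl fun i _ => Complex.exp_log fun h0 => ?_
  have h3 : ‖c n i‖ ≤ 1 / 2 := (hcn i).trans hn
  have h4 : c n i = -1 := by linear_combination h0
  rw [h4] at h3
  simp at h3
  norm_num at h3

/-- The parameters, in the scaling in which the action is quadratic in the limit. -/
structure IsGaussianScaling (m : ℕ → ℕ) (u : ∀ n, Fin n → ℝ) (y : ∀ n, Fin (m n) → ℝ) : Prop where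
  nonneg : ∀ n i, 0 ≤ u n i
  pos : ∀ᶠ n in atTop, ∀ j, 0 < y n j
  small : ∃ δ : ℕ → ℝ, Tendsto δ atTop (𝓝 0) ∧
    ∀ᶠ n in atTop, (∀ i, u n i ≤ δ n) ∧ ∀ j, (y n j)⁻¹ ≤ δ n
  sum_sub : Tendsto (fun n => ∑ i, u n i - ∑ j, (y n j)⁻¹) atTop (𝓝 0)
  sum_sq : Tendsto (fun n => ∑ i, u n i ^ 2 + ∑ j, (y n j)⁻¹ ^ 2) atTop (𝓝 2)
  growth : ∀ p : ℕ, ∃ A : ℝ, 0 < A ∧ ∀ᶠ n in atTop, ∀ s : ℝ,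
    (1 + A * s ^ 2) ^ p ≤ ∏ j, (1 + s ^ 2 * (y n j)⁻¹ ^ 2)

namespace IsGaussianScaling

variable {m : ℕ → ℕ} {u : ∀ n, Fin n → ℝ} {y : ∀ n, Fin (m n) → ℝ}

theorem tendsto_prod (h : IsGaussianScaling m u y) (w : ℂ) :
    Tendsto (fun n => (∏ i, (1 + u n i * w)) * ∏ j, (1 - w / y n j)) atTop
      (𝓝 (Complex.exp (-w ^ 2))) := by
  obtain ⟨δ, hδ, hsm⟩ := h.small
  let c : ∀ n, Fin n ⊕ Fin (m n) → ℂ := fun n => Sum.elim (fun i => ((u n i : ℝ) : ℂ) * w)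
    fun j => (((-(y n j)⁻¹ : ℝ)) : ℂ) * w
  have hsum1 : ∀ n, ∑ i, c n i = ((∑ i, u n i - ∑ j, (y n j)⁻¹ : ℝ) : ℂ) * w := by
    intro n
    rw [Fintype.sum_sum_type]
    simp only [c, Sum.elim_inl, Sum.elim_inr]
    rw [← Finset.sum_mul, ← Finset.sum_mul, ← add_mul]
    congr 1
    push_cast
    rw [Finset.sum_neg_distrib]
    ring
  have hsum2 : ∀ n, ∑ i, c n i ^ 2 =
      ((∑ i, u n i ^ 2 + ∑ j, (y n j)⁻¹ ^ 2 : ℝ) : ℂ) * w ^ 2 := by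
    intro n
    rw [Fintype.sum_sum_type]
    simp only [c, Sum.elim_inl, Sum.elim_inr, mul_pow]
    rw [← Finset.sum_mul, ← Finset.sum_mul, ← add_mul]
    congr 1
    push_cast
    congr 1
    exact Finset.sum_congr rfl fun j _ => by ring
  have hsum3 : ∀ n, ∑ i, ‖c n i‖ ^ 2 =
      (∑ i, u n i ^ 2 + ∑ j, (y n j)⁻¹ ^ 2) * ‖w‖ ^ 2 := by
    intro n
    rw [Fintype.sum_sum_type]
    simp only [c, Sum.elim_inl, Sum.elim_inr, norm_mul, mul_pow, Complex.norm_real,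
      Real.norm_eq_abs, sq_abs, neg_sq]
    rw [← Finset.sum_mul, ← Finset.sum_mul, ← add_mul]
  have hlim := tendsto_prod_one_add c (fun n => δ n * ‖w‖) (by simpa using hδ.mul_const ‖w‖)
    (L := 2 * w ^ 2) (M := 3 * ‖w‖ ^ 2) ?_ ?_ ?_ ?_
  · have e : -(2 * w ^ 2) / 2 = -w ^ 2 := by ring
    rw [e] at hlim
    refine hlim.congr fun n => ?_
    rw [Fintype.prod_sum_type]
    congr 1
    refine Finset.prod_congr rfl fun j _ => ?_
    simp only [c, Sum.elim_inr]
    push_cast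
    ring
  · filter_upwards [hsm, h.pos] with n hn hp
    rintro (i | j)
    · simp only [c, Sum.elim_inl, norm_mul, Complex.norm_real, Real.norm_eq_abs]
      rw [abs_of_nonneg (h.nonneg n i)]
      exact mul_le_mul_of_nonneg_right (hn.1 i) (norm_nonneg _)
    · simp only [c, Sum.elim_inr, norm_mul, Complex.norm_real, Real.norm_eq_abs, abs_neg]
      rw [abs_of_pos (inv_pos.2 (hp j))]
      exact mul_le_mul_of_nonneg_right (hn.2 j) (norm_nonneg _)
  · simp_rw [hsum1]
    have := ((Complex.continuous_ofReal.tendsto 0).comp h.sum_sub).mul_const w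
    simpa using this
  · simp_rw [hsum2]
    have := ((Complex.continuous_ofReal.tendsto 2).comp h.sum_sq).mul_const (w ^ 2)
    simpa using this
  · filter_upwards [h.sum_sq.eventually_lt_const (by norm_num : (2 : ℝ) < 3)] with n hn
    rw [hsum3]
    exact mul_le_mul_of_nonneg_right hn.le (by positivity)

theorem norm_one_add_mul_ge (a s : ℝ) :
    1 + a ≤ ‖(1 + a * (1 + s * Complex.I) : ℂ)‖ := by
  have := Complex.abs_re_le_norm (1 + a * (1 + s * Complex.I) : ℂ)
  simp at this
  exact (le_abs_self _).trans this

theorem norm_one_sub_mul_ge {v : ℝ} (hv : 0 ≤ v) (hv1 : v ≤ 1) (s : ℝ) :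
    (1 - v) ^ 2 * (1 + s ^ 2 * v ^ 2) ≤ ‖(1 - (1 + s * Complex.I) * v : ℂ)‖ ^ 2 := by
  rw [← Complex.normSq_eq_norm_sq, Complex.normSq_apply]
  simp
  nlinarith [mul_nonneg (mul_nonneg hv (by linarith : (0 : ℝ) ≤ 2 - v))
    (mul_nonneg (sq_nonneg s) (sq_nonneg v))]

theorem eventually_norm_ge (h : IsGaussianScaling m u y) (q : ℕ) :
    ∃ A : ℝ, 0 < A ∧ ∀ᶠ n in atTop, ∀ s : ℝ,
      Real.exp (-1) / 2 * (1 + A * s ^ 2) ^ q ≤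
        ‖(∏ i, (1 + u n i * (1 + s * Complex.I : ℂ))) * ∏ j, (1 - (1 + s * Complex.I) / y n j)‖ := by
  obtain ⟨A, hA, hgr⟩ := h.growth (2 * q)
  obtain ⟨δ, hδ, hsm⟩ := h.small
  refine ⟨A, hA, ?_⟩
  have h1 := (h.tendsto_prod 1).norm
  have e1 : ‖Complex.exp (-1 ^ 2)‖ = Real.exp (-1) := by
    rw [Complex.norm_exp]
    simp
  rw [e1] at h1
  have hlow := h1.eventually_const_lt (by linarith [Real.exp_pos (-1)] :
    Real.exp (-1) / 2 < Real.exp (-1))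
  filter_upwards [hgr, hsm, hlow, h.pos, hδ.eventually_lt_const (zero_lt_one)] with
    n hg hs hl hp hd s
  have hv0 : ∀ j, 0 ≤ (y n j)⁻¹ := fun j => (inv_pos.2 (hp j)).le
  have hv1 : ∀ j, (y n j)⁻¹ ≤ 1 := fun j => (hs.2 j).trans hd.le
  have e2 : ‖(∏ i, (1 + u n i * (1 : ℂ))) * ∏ j, (1 - (1 : ℂ) / y n j)‖ =
      (∏ i, (1 + u n i)) * ∏ j, (1 - (y n j)⁻¹) := by
    rw [norm_mul, norm_prod, norm_prod]
    congr 1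
    · refine Finset.prod_congr rfl fun i _ => ?_
      rw [mul_one, ← Complex.ofReal_one, ← Complex.ofReal_add, Complex.norm_real,
        Real.norm_of_nonneg]
      linarith [h.nonneg n i]
    · refine Finset.prod_congr rfl fun j _ => ?_
      rw [one_div, ← Complex.ofReal_one, ← Complex.ofReal_inv, ← Complex.ofReal_sub,
        Complex.norm_real, Real.norm_of_nonneg]
      linarith [hv1 j]
  rw [e2] at hl
  have b1 : ∏ i, (1 + u n i) ≤ ∏ i, ‖(1 + u n i * (1 + s * Complex.I) : ℂ)‖ :=
    Finset.prod_le_prod (fun i _ => by linarith [h.nonneg n i])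
      fun i _ => norm_one_add_mul_ge (u n i) s
  have b2 : (∏ j, (1 - (y n j)⁻¹)) * (1 + A * s ^ 2) ^ q ≤
      ∏ j, ‖(1 - (1 + s * Complex.I) / y n j : ℂ)‖ := by
    refine le_of_sq_le_sq ?_ (Finset.prod_nonneg fun j _ => norm_nonneg _)
    rw [mul_pow, ← pow_mul, mul_comm q 2, ← Finset.prod_pow, ← Finset.prod_pow]
    refine (mul_le_mul_of_nonneg_left (hg s) (Finset.prod_nonneg fun j _ => sq_nonneg _)).trans ?_
    rw [← Finset.prod_mul_distrib]
    refine Finset.prod_le_prod (fun j _ => by positivity) fun j _ => ?_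
    have := norm_one_sub_mul_ge (hv0 j) (hv1 j) s
    rwa [Complex.ofReal_inv, ← div_eq_mul_inv] at this
  have b3 : 0 ≤ ∏ i, (1 + u n i) := Finset.prod_nonneg fun i _ => by linarith [h.nonneg n i]
  have b4 : 0 ≤ (1 + A * s ^ 2) ^ q := by positivity
  rw [norm_mul, norm_prod, norm_prod]
  calc Real.exp (-1) / 2 * (1 + A * s ^ 2) ^ q
      ≤ ((∏ i, (1 + u n i)) * ∏ j, (1 - (y n j)⁻¹)) * (1 + A * s ^ 2) ^ q := by gcongr
    _ = (∏ i, (1 + u n i)) * ((∏ j, (1 - (y n j)⁻¹)) * (1 + A * s ^ 2) ^ q) := by ring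
    _ ≤ _ := by
        refine mul_le_mul b1 b2 ?_ (Finset.prod_nonneg fun i _ => norm_nonneg _)
        exact mul_nonneg (Finset.prod_nonneg fun j _ => by linarith [hv1 j]) b4

theorem tendsto_lineIntegral (h : IsGaussianScaling m u y) (r : ℤ) :
    Tendsto (fun n => lineIntegral (u n) (y n) 1 r) atTop (𝓝 (gaussLine r)) := by
  unfold lineIntegral gaussLine
  refine Tendsto.const_mul _ ?_
  set M := (-r - 1).natAbs with hM
  obtain ⟨A, hA, hge⟩ := h.eventually_norm_ge (M + 1)
  set B := max 1 A⁻¹ with hB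
  have hB1 : 1 ≤ B := le_max_left _ _
  have hBA : 1 ≤ B * A := by
    have : A⁻¹ * A = 1 := inv_mul_cancel₀ hA.ne'
    nlinarith [le_max_right 1 A⁻¹]
  have hcmp : ∀ s : ℝ, 1 + s ^ 2 ≤ B * (1 + A * s ^ 2) := by
    intro s
    nlinarith [sq_nonneg s]
  refine MeasureTheory.tendsto_integral_filter_of_dominated_convergence
    (fun s => 2 * Real.exp 1 * B ^ (M + 1) * (1 + s ^ 2)⁻¹) ?_ ?_
    (integrable_inv_one_add_sq.const_mul _) ?_
  · refine Eventually.of_forall fun n => Measurable.aestronglyMeasurable ?_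
    simp only [Complex.ofReal_one]
    refine (continuous_zpow_line _).measurable.div (Continuous.measurable ?_)
    fun_prop
  · filter_upwards [hge] with n hn
    refine MeasureTheory.ae_of_all _ fun s => ?_
    simp only [Complex.ofReal_one]
    have h1 := hn s
    have h2 : 0 < Real.exp (-1) / 2 * (1 + A * s ^ 2) ^ (M + 1) := by positivity
    rw [norm_div]
    refine (div_le_div₀ (by positivity) (norm_zpow_le s (-r - 1)) h2 h1).trans ?_
    rw [← hM, div_le_iff₀ h2, Real.exp_neg]
    have h3 : (1 + s ^ 2) ^ (M + 1) ≤ (B * (1 + A * s ^ 2)) ^ (M + 1) :=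
      pow_le_pow_left₀ (by positivity) (hcmp s) _
    have h4 : (0 : ℝ) < 1 + s ^ 2 := by positivity
    have h5 : 2 * Real.exp 1 * B ^ (M + 1) * (1 + s ^ 2)⁻¹ *
        ((Real.exp 1)⁻¹ / 2 * (1 + A * s ^ 2) ^ (M + 1)) =
        (B * (1 + A * s ^ 2)) ^ (M + 1) * (1 + s ^ 2)⁻¹ := by
      rw [mul_pow]
      field_simp
    rw [h5, ← div_eq_mul_inv, le_div_iff₀ h4, ← pow_succ]
    exact h3
  · refine MeasureTheory.ae_of_all _ fun s => ?_
    have h1 := (h.tendsto_prod (1 + s * Complex.I)).inv₀ (Complex.exp_ne_zero _)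
    have h2 := h1.const_mul ((1 + s * Complex.I : ℂ) ^ (-r - 1))
    rw [Complex.exp_neg, inv_inv] at h2
    simp only [Complex.ofReal_one, div_eq_mul_inv] at h2 ⊢
    exact h2

end IsGaussianScaling

/-! ### The right edge of the support -/

theorem edgeFunction_eq_of_isDoubleCritical {f g : ℝ → ℝ} {c z : ℝ}
    (hf : ContinuousOn f (Set.Icc 0 1)) (hg : ContinuousOn g (Set.Icc 0 1))
    (h : IsDoubleCritical f g c z) :
    edgeFunction f g c z = c - z ^ 2 * ((∫ s in (0 : ℝ)..1, f s ^ 2 / (1 - f s * z) ^ 2) +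
      c * ∫ s in (0 : ℝ)..1, 1 / (z + g s) ^ 2) := by
  obtain ⟨hne, hcrit⟩ := h
  have hu : Set.uIcc (0 : ℝ) 1 = Set.Icc 0 1 := Set.uIcc_of_le zero_le_one
  have cd1 : ContinuousOn (fun s => 1 - f s * z) (Set.Icc 0 1) :=
    continuousOn_const.sub (hf.mul continuousOn_const)
  have cd2 : ContinuousOn (fun s => z + g s) (Set.Icc 0 1) := continuousOn_const.add hg
  have i1 : IntervalIntegrable (fun s => f s / (1 - f s * z) ^ 2) MeasureTheory.volume 0 1 := by
    refine ContinuousOn.intervalIntegrable ?_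
    rw [hu]
    exact hf.div (cd1.pow 2) fun s hs => pow_ne_zero _ (hne s hs).1
  have i2 : IntervalIntegrable (fun s => f s ^ 2 / (1 - f s * z) ^ 2) MeasureTheory.volume 0 1 := by
    refine ContinuousOn.intervalIntegrable ?_
    rw [hu]
    exact (hf.pow 2).div (cd1.pow 2) fun s hs => pow_ne_zero _ (hne s hs).1
  have i3 : IntervalIntegrable (fun s => g s / (z + g s) ^ 2) MeasureTheory.volume 0 1 := by
    refine ContinuousOn.intervalIntegrable ?_
    rw [hu]
    exact hg.div (cd2.pow 2) fun s hs => pow_ne_zero _ (hne s hs).2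
  have i4 : IntervalIntegrable (fun s => 1 / (z + g s) ^ 2) MeasureTheory.volume 0 1 := by
    refine ContinuousOn.intervalIntegrable ?_
    rw [hu]
    exact continuousOn_const.div (cd2.pow 2) fun s hs => pow_ne_zero _ (hne s hs).2
  have e1 : ∫ s in (0 : ℝ)..1, f s * z / (1 - f s * z) =
      z * (∫ s in (0 : ℝ)..1, f s / (1 - f s * z) ^ 2) -
        z ^ 2 * ∫ s in (0 : ℝ)..1, f s ^ 2 / (1 - f s * z) ^ 2 := by
    rw [← intervalIntegral.integral_const_mul, ← intervalIntegral.integral_const_mul,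
      ← intervalIntegral.integral_sub (i1.const_mul _) (i2.const_mul _)]
    refine intervalIntegral.integral_congr fun s hs => ?_
    rw [hu] at hs
    have := (hne s hs).1
    field_simp
  have e2 : ∫ s in (0 : ℝ)..1, g s / (z + g s) =
      1 - z ^ 2 * (∫ s in (0 : ℝ)..1, 1 / (z + g s) ^ 2) -
        z * ∫ s in (0 : ℝ)..1, g s / (z + g s) ^ 2 := by
    have h1 : (1 : ℝ) = ∫ _ in (0 : ℝ)..1, (1 : ℝ) := by simp
    rw [← intervalIntegral.integral_const_mul, ← intervalIntegral.integral_const_mul]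
    refine Eq.trans ?_ (congrArg (· - (∫ s in (0 : ℝ)..1, z ^ 2 * (1 / (z + g s) ^ 2)) -
      ∫ s in (0 : ℝ)..1, z * (g s / (z + g s) ^ 2)) h1.symm)
    rw [← intervalIntegral.integral_sub intervalIntegrable_const (i4.const_mul _),
      ← intervalIntegral.integral_sub (intervalIntegrable_const.sub (i4.const_mul _))
        (i3.const_mul _)]
    refine intervalIntegral.integral_congr fun s hs => ?_
    rw [hu] at hs
    have := (hne s hs).2
    field_simp
    ring
  unfold edgeFunction
  rw [e1, e2]
  linear_combination z * hcrit

theorem isDoubleCritical_zero_iff {f g : ℝ → ℝ} {c : ℝ}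
    (hg0 : ∀ s ∈ Set.Icc (0 : ℝ) 1, 0 < g s) : IsDoubleCritical f g c 0 ↔
      (∫ s in (0 : ℝ)..1, f s) = c * ∫ s in (0 : ℝ)..1, 1 / g s := by
  have e : ∫ s in (0 : ℝ)..1, g s / (0 + g s) ^ 2 = ∫ s in (0 : ℝ)..1, 1 / g s := by
    refine intervalIntegral.integral_congr fun s hs => ?_
    rw [Set.uIcc_of_le zero_le_one] at hs
    rw [zero_add, sq, div_mul_cancel_left₀ (hg0 s hs).ne', one_div]
  unfold IsDoubleCritical
  rw [e]
  simp only [mul_zero, sub_zero, one_pow, div_one, zero_add, sub_eq_zero]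
  exact and_iff_right fun s hs => ⟨one_ne_zero, (hg0 s hs).ne'⟩

theorem isRightEdge_iff {f g : ℝ → ℝ} {c : ℝ} (hc : 0 < c)
    (hf : ContinuousOn f (Set.Icc 0 1)) (hg : ContinuousOn g (Set.Icc 0 1))
    (hg0 : ∀ s ∈ Set.Icc (0 : ℝ) 1, 0 < g s) : IsRightEdge f g c c ↔
      (∫ s in (0 : ℝ)..1, f s) = c * ∫ s in (0 : ℝ)..1, 1 / g s := by
  rw [← isDoubleCritical_zero_iff hg0]
  have hA : ∀ z, 0 ≤ ∫ s in (0 : ℝ)..1, f s ^ 2 / (1 - f s * z) ^ 2 := fun z =>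
    intervalIntegral.integral_nonneg zero_le_one fun s _ => by positivity
  have hB : ∀ z, 0 ≤ ∫ s in (0 : ℝ)..1, 1 / (z + g s) ^ 2 := fun z =>
    intervalIntegral.integral_nonneg zero_le_one fun s _ => by positivity
  constructor
  · rintro ⟨⟨z, hz, hcz⟩, -⟩
    rw [edgeFunction_eq_of_isDoubleCritical hf hg hz] at hcz
    have hBpos : 0 < ∫ s in (0 : ℝ)..1, 1 / (z + g s) ^ 2 := by
      refine intervalIntegral.intervalIntegral_pos_of_pos_on ?_ ?_ zero_lt_one
      · refine ContinuousOn.intervalIntegrable ?_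
        rw [Set.uIcc_of_le zero_le_one]
        exact continuousOn_const.div ((continuousOn_const.add hg).pow 2)
          fun s hs => pow_ne_zero _ (hz.1 s hs).2
      · intro s hs
        have := (hz.1 s (Set.Ioo_subset_Icc_self hs)).2
        positivity
    have hpos : 0 < (∫ s in (0 : ℝ)..1, f s ^ 2 / (1 - f s * z) ^ 2) +
        c * ∫ s in (0 : ℝ)..1, 1 / (z + g s) ^ 2 := by
      have := hA z
      positivity
    have hz2 : z ^ 2 * ((∫ s in (0 : ℝ)..1, f s ^ 2 / (1 - f s * z) ^ 2) +
        c * ∫ s in (0 : ℝ)..1, 1 / (z + g s) ^ 2) = 0 := by linarith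
    have hz0 : z = 0 := by
      simpa using (mul_eq_zero.1 hz2).resolve_right hpos.ne'
    rwa [hz0] at hz
  · intro h0
    refine ⟨⟨0, h0, ?_⟩, ?_⟩
    · rw [edgeFunction_eq_of_isDoubleCritical hf hg h0]
      ring
    · rintro t ⟨z, hz, rfl⟩
      rw [edgeFunction_eq_of_isDoubleCritical hf hg hz]
      have h1 := hA z
      have h2 := hB z
      have : 0 ≤ z ^ 2 * ((∫ s in (0 : ℝ)..1, f s ^ 2 / (1 - f s * z) ^ 2) +
        c * ∫ s in (0 : ℝ)..1, 1 / (z + g s) ^ 2) := by positivity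
      linarith

/-! ### Riemann sums -/

theorem abs_sum_sampled_sub_le {φ : ℝ → ℝ} {K : NNReal}
    (hφ : LipschitzOnWith K φ (Set.Icc 0 1)) (n : ℕ) :
    |∑ i, sampled φ n i - n * ∫ s in (0 : ℝ)..1, φ s| ≤ K := by
  rcases Nat.eq_zero_or_pos n with rfl | hn
  · simp
  have hn' : (0 : ℝ) < n := by exact_mod_cast hn
  let a : ℕ → ℝ := fun i => i / n
  have ha : ∀ i, a i ≤ a (i + 1) := fun i => by
    simp only [a]
    gcongr
    simp
  have hmem : ∀ i ≤ n, a i ∈ Set.Icc (0 : ℝ) 1 := by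
    intro i hi
    refine ⟨by positivity, ?_⟩
    simp only [a]
    rw [div_le_one hn']
    exact_mod_cast hi
  have hsub : ∀ i < n, Set.Icc (a i) (a (i + 1)) ⊆ Set.Icc 0 1 := fun i hi =>
    Set.Icc_subset_Icc (hmem i hi.le).1 (hmem (i + 1) hi).2
  have hint : ∀ i < n, IntervalIntegrable φ MeasureTheory.volume (a i) (a (i + 1)) := by
    intro i hi
    refine ContinuousOn.intervalIntegrable ?_
    rw [Set.uIcc_of_le (ha i)]
    exact hφ.continuousOn.mono (hsub i hi)
  have hsum := intervalIntegral.sum_integral_adjacent_intervals hint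
  have a0 : a 0 = 0 := by simp [a]
  have an : a n = 1 := by simp only [a]; exact div_self hn'.ne'
  rw [a0, an] at hsum
  have hs : ∑ i, sampled φ n i = ∑ i ∈ Finset.range n, φ (a (i + 1)) := by
    rw [← Fin.sum_univ_eq_sum_range (fun i => φ (a (i + 1)))]
    refine Finset.sum_congr rfl fun i _ => ?_
    simp [sampled, a]
  rw [hs, ← hsum, Finset.mul_sum, ← Finset.sum_sub_distrib]
  have hstep : ∀ i ∈ Finset.range n,
      |φ (a (i + 1)) - n * ∫ s in (a i)..(a (i + 1)), φ s| ≤ K / n := by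
    intro i hi
    rw [Finset.mem_range] at hi
    have hlen : a (i + 1) - a i = 1 / n := by
      simp only [a]
      push_cast
      ring
    have e : φ (a (i + 1)) - n * ∫ s in (a i)..(a (i + 1)), φ s =
        n * ∫ s in (a i)..(a (i + 1)), (φ (a (i + 1)) - φ s) := by
      rw [intervalIntegral.integral_sub intervalIntegrable_const (hint i hi),
        intervalIntegral.integral_const, hlen, smul_eq_mul]
      field_simp
    have hb : ‖∫ s in (a i)..(a (i + 1)), (φ (a (i + 1)) - φ s)‖ ≤
        (K / n) * |a (i + 1) - a i| := by
      refine intervalIntegral.norm_integral_le_of_norm_le_const fun s hs => ?_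
      rw [Set.uIoc_of_le (ha i)] at hs
      have h1 := hφ.dist_le_mul _ (hmem (i + 1) hi) s (hsub i hi (Set.Ioc_subset_Icc_self hs))
      rw [Real.dist_eq, Real.dist_eq] at h1
      rw [Real.norm_eq_abs]
      refine h1.trans ?_
      rw [div_eq_mul_one_div (K : ℝ), ← hlen]
      gcongr
      rw [abs_of_nonneg (by linarith [hs.2])]
      linarith [hs.1]
    rw [e, abs_mul, abs_of_pos hn']
    rw [Real.norm_eq_abs, hlen, abs_of_pos (show (0 : ℝ) < 1 / n by positivity)] at hb
    calc (n : ℝ) * |∫ s in (a i)..(a (i + 1)), (φ (a (i + 1)) - φ s)|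
        ≤ n * (K / n * (1 / n)) := by gcongr
      _ = K / n := by field_simp
  calc _ ≤ ∑ i ∈ Finset.range n, |φ (a (i + 1)) - n * ∫ s in (a i)..(a (i + 1)), φ s| :=
        Finset.abs_sum_le_sum_abs _ _
    _ ≤ ∑ i ∈ Finset.range n, (K : ℝ) / n := Finset.sum_le_sum hstep
    _ = K := by
      rw [Finset.sum_const, Finset.card_range, nsmul_eq_mul]
      field_simp

theorem tendsto_sum_sampled_div {φ : ℝ → ℝ} {K : NNReal}
    (hφ : LipschitzOnWith K φ (Set.Icc 0 1)) :
    Tendsto (fun n : ℕ => (∑ i, sampled φ n i) / n) atTop (𝓝 (∫ s in (0 : ℝ)..1, φ s)) := by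
  rw [tendsto_iff_norm_sub_tendsto_zero]
  refine squeeze_zero' (Eventually.of_forall fun _ => norm_nonneg _) ?_
    (tendsto_const_div_atTop_nhds_zero_nat (K : ℝ))
  filter_upwards [eventually_gt_atTop 0] with n hn
  have hn' : (0 : ℝ) < n := by exact_mod_cast hn
  have h := abs_sum_sampled_sub_le hφ n
  have e : (∑ i, sampled φ n i) / n - ∫ s in (0 : ℝ)..1, φ s =
      (∑ i, sampled φ n i - n * ∫ s in (0 : ℝ)..1, φ s) / n := by
    field_simp
  rw [e, norm_div, Real.norm_eq_abs, Real.norm_of_nonneg hn'.le]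
  gcongr

theorem sampled_mem {φ : ℝ → ℝ} {p : ℝ → Prop} (h : ∀ s ∈ Set.Icc (0 : ℝ) 1, p (φ s)) {n : ℕ}
    (i : Fin n) : p (sampled φ n i) := by
  have hn : (0 : ℝ) < n := by exact_mod_cast i.pos
  refine h _ ⟨by positivity, ?_⟩
  rw [div_le_one hn]
  exact_mod_cast i.2

theorem exists_pow_le_prod {m : ℕ → ℕ} {y : ∀ n, Fin (m n) → ℝ} {a b : ℝ} (ha : 0 < a)
    (hb : 0 < b) (hm : ∀ᶠ n in atTop, b * n ≤ m n)
    (hy : ∀ᶠ n : ℕ in atTop, ∀ j, a / Real.sqrt n ≤ (y n j)⁻¹) (p : ℕ) :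
    ∃ A : ℝ, 0 < A ∧ ∀ᶠ n in atTop, ∀ s : ℝ,
      (1 + A * s ^ 2) ^ p ≤ ∏ j, (1 + s ^ 2 * (y n j)⁻¹ ^ 2) := by
  rcases Nat.eq_zero_or_pos p with rfl | hp
  · refine ⟨1, one_pos, Eventually.of_forall fun n s => ?_⟩
    calc (1 + 1 * s ^ 2) ^ 0 = ∏ _j : Fin (m n), (1 : ℝ) := by simp
      _ ≤ _ := Finset.prod_le_prod (fun _ _ => zero_le_one) fun j _ =>
        le_add_of_nonneg_right (by positivity)
  have hp' : (0 : ℝ) < p := by exact_mod_cast hp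
  refine ⟨a ^ 2 * b / (2 * p), by positivity, ?_⟩
  filter_upwards [hm, hy, eventually_gt_atTop 0,
    tendsto_natCast_atTop_atTop.eventually_ge_atTop (2 * p / b)] with n hmn hyn hn hnb s
  have hn' : (0 : ℝ) < n := by exact_mod_cast hn
  set N := m n / p with hN
  have hNp : N * p ≤ m n := Nat.div_mul_le_self _ _
  have hN1 : (m n : ℝ) < (N + 1) * p := by
    have := Nat.lt_div_mul_add hp (a := m n)
    have h2 : m n < (N + 1) * p := by rw [add_mul, one_mul]; exact this
    exact_mod_cast h2
  have hNlow : b * n / (2 * p) ≤ N := by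
    rw [div_le_iff₀ hb] at hnb
    rw [div_le_iff₀ (by positivity)]
    nlinarith
  have hq : 0 ≤ s ^ 2 * (a ^ 2 / n) := by positivity
  have h1 : (1 + s ^ 2 * (a ^ 2 / n)) ^ m n ≤ ∏ j, (1 + s ^ 2 * (y n j)⁻¹ ^ 2) := by
    have : (1 + s ^ 2 * (a ^ 2 / n)) ^ m n = ∏ _j : Fin (m n), (1 + s ^ 2 * (a ^ 2 / n)) := by
      simp
    rw [this]
    refine Finset.prod_le_prod (fun _ _ => by positivity) fun j _ => ?_
    have h2 : (a / Real.sqrt n) ^ 2 ≤ (y n j)⁻¹ ^ 2 :=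
      pow_le_pow_left₀ (by positivity) (hyn j) 2
    rw [div_pow, Real.sq_sqrt hn'.le] at h2
    gcongr
  have h2 : (1 + s ^ 2 * (a ^ 2 / n)) ^ (N * p) ≤ (1 + s ^ 2 * (a ^ 2 / n)) ^ m n :=
    pow_le_pow_right₀ (by linarith) hNp
  have h3 : 1 + N * (s ^ 2 * (a ^ 2 / n)) ≤ (1 + s ^ 2 * (a ^ 2 / n)) ^ N :=
    one_add_mul_le_pow (by linarith) N
  have h4 : a ^ 2 * b / (2 * p) * s ^ 2 ≤ N * (s ^ 2 * (a ^ 2 / n)) := by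
    calc a ^ 2 * b / (2 * p) * s ^ 2 = b * n / (2 * p) * (s ^ 2 * (a ^ 2 / n)) := by
          field_simp
      _ ≤ _ := by gcongr
  calc (1 + a ^ 2 * b / (2 * p) * s ^ 2) ^ p
      ≤ ((1 + s ^ 2 * (a ^ 2 / n)) ^ N) ^ p := by
        refine pow_le_pow_left₀ (by positivity) ?_ p
        linarith
    _ = (1 + s ^ 2 * (a ^ 2 / n)) ^ (N * p) := (pow_mul _ _ _).symm
    _ ≤ _ := h2.trans h1

/-! ### The rescaled parameters -/

theorem tendsto_div_of_sub_div_sqrt {k : ℕ → ℕ} {c : ℝ}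
    (hk : Tendsto (fun n : ℕ => ((k n : ℝ) - n * c) / Real.sqrt n) atTop (𝓝 0)) :
    Tendsto (fun n : ℕ => (k n : ℝ) / n) atTop (𝓝 c) := by
  have hs : Tendsto (fun n : ℕ => (Real.sqrt n)⁻¹) atTop (𝓝 0) :=
    tendsto_inv_atTop_zero.comp (Real.tendsto_sqrt_atTop.comp tendsto_natCast_atTop_atTop)
  have h := (hk.mul hs).add_const c
  rw [mul_zero, zero_add] at h
  refine h.congr' ?_
  filter_upwards [eventually_gt_atTop 0] with n hn
  have hn' : (0 : ℝ) < n := by exact_mod_cast hn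
  rw [← div_eq_mul_inv, div_div, Real.mul_self_sqrt hn'.le]
  field_simp
  ring

theorem tendsto_atTop_of_tendsto_div {k : ℕ → ℕ} {c : ℝ} (hc : 0 < c)
    (hk : Tendsto (fun n : ℕ => (k n : ℝ) / n) atTop (𝓝 c)) : Tendsto k atTop atTop := by
  rw [← tendsto_natCast_atTop_iff (R := ℝ)]
  have h := hk.pos_mul_atTop hc tendsto_natCast_atTop_atTop
  refine h.congr' ?_
  filter_upwards [eventually_gt_atTop 0] with n hn
  have hn' : (0 : ℝ) < n := by exact_mod_cast hn
  field_simp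

/-- The balanced case of parameters sampled from `f` and `g`, rescaled by `√(κ n)` where
`2 κ = ∫ f ^ 2 + c ∫ g⁻¹ ^ 2`, is a Gaussian scaling. -/
theorem isGaussianScaling_sampled {f g : ℝ → ℝ} {c κ : ℝ} (hc : 0 < c) (hκ : 0 < κ)
    (hf : ContDiffOn ℝ 1 f (Set.Icc 0 1)) (hf0 : ∀ s ∈ Set.Icc (0 : ℝ) 1, 0 ≤ f s)
    (hg : ContDiffOn ℝ 1 g (Set.Icc 0 1)) (hg0 : ∀ s ∈ Set.Icc (0 : ℝ) 1, 0 < g s)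
    (hbal : (∫ s in (0 : ℝ)..1, f s) = c * ∫ s in (0 : ℝ)..1, (g s)⁻¹)
    (hκ2 : (∫ s in (0 : ℝ)..1, f s ^ 2) + c * (∫ s in (0 : ℝ)..1, (g s)⁻¹ ^ 2) = 2 * κ)
    {k : ℕ → ℕ} (hk : Tendsto (fun n : ℕ => ((k n : ℝ) - n * c) / Real.sqrt n) atTop (𝓝 0)) :
    IsGaussianScaling k (fun n i => sampled f n i / Real.sqrt (κ * n))
      (fun n j => Real.sqrt (κ * n) * sampled g (k n) j) := by
  have lip : ∀ φ : ℝ → ℝ, ContDiffOn ℝ 1 φ (Set.Icc 0 1) →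
      ∃ K, LipschitzOnWith K φ (Set.Icc 0 1) := fun φ hφ =>
    hφ.exists_lipschitzOnWith one_ne_zero (convex_Icc 0 1) isCompact_Icc
  have hgi : ContDiffOn ℝ 1 (fun s => (g s)⁻¹) (Set.Icc 0 1) := hg.inv fun s hs => (hg0 s hs).ne'
  obtain ⟨K₁, hK₁⟩ := lip f hf
  obtain ⟨K₂, hK₂⟩ := lip _ hgi
  obtain ⟨K₃, hK₃⟩ := lip _ (hf.pow 2)
  obtain ⟨K₄, hK₄⟩ := lip _ (hgi.pow 2)
  obtain ⟨F, hF⟩ := isCompact_Icc.exists_bound_of_continuousOn hf.continuousOn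
  obtain ⟨G, hG⟩ := isCompact_Icc.exists_bound_of_continuousOn hg.continuousOn
  obtain ⟨H, hH⟩ := isCompact_Icc.exists_bound_of_continuousOn hgi.continuousOn
  have hGpos : 0 < G := by
    have h0 : (0 : ℝ) ∈ Set.Icc (0 : ℝ) 1 := by simp
    exact (norm_pos_iff.2 (hg0 0 h0).ne').trans_le (hG 0 h0)
  have hkc := tendsto_div_of_sub_div_sqrt hk
  have hkt := tendsto_atTop_of_tendsto_div hc hkc
  have hsq : Tendsto (fun n : ℕ => (Real.sqrt n)⁻¹) atTop (𝓝 0) :=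
    tendsto_inv_atTop_zero.comp (Real.tendsto_sqrt_atTop.comp tendsto_natCast_atTop_atTop)
  have hσ : ∀ n : ℕ, Real.sqrt (κ * n) = Real.sqrt κ * Real.sqrt n := fun n =>
    Real.sqrt_mul hκ.le _
  have hσpos : ∀ n : ℕ, 0 < n → 0 < Real.sqrt (κ * n) := fun n hn => by
    have hn' : (0 : ℝ) < n := by exact_mod_cast hn
    positivity
  have hinv : ∀ n, ∀ j : Fin (k n), (Real.sqrt (κ * n) * sampled g (k n) j)⁻¹ =
      sampled (fun s => (g s)⁻¹) (k n) j / Real.sqrt (κ * n) := fun n j => by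
    rw [mul_inv, mul_comm, div_eq_mul_inv]
    rfl
  refine ⟨fun n i => ?_, ?_, ?_, ?_, ?_, fun p => ?_⟩
  · exact div_nonneg (sampled_mem (p := fun t => 0 ≤ t) hf0 i) (Real.sqrt_nonneg _)
  · filter_upwards [eventually_gt_atTop 0] with n hn j
    exact mul_pos (hσpos n hn) (sampled_mem (p := fun t => 0 < t) hg0 j)
  · refine ⟨fun n => max F H / Real.sqrt (κ * n), ?_, ?_⟩
    · have h := hsq.const_mul (max F H / Real.sqrt κ)
      rw [mul_zero] at h
      refine h.congr fun n => ?_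
      rw [hσ, ← div_eq_mul_inv, div_div]
    · filter_upwards with n
      refine ⟨fun i => ?_, fun j => ?_⟩
      · have := sampled_mem (p := fun t => ‖t‖ ≤ F) hF i
        gcongr
        exact (le_abs_self _).trans (this.trans (le_max_left _ _))
      · rw [hinv]
        have := sampled_mem (φ := fun s => (g s)⁻¹) (p := fun t => ‖t‖ ≤ H) hH j
        gcongr
        exact (le_abs_self _).trans (this.trans (le_max_right _ _))
  · set I := ∫ s in (0 : ℝ)..1, (g s)⁻¹ with hI
    let e : ℕ → ℝ := fun n => (∑ i, sampled f n i - n * ∫ s in (0 : ℝ)..1, f s) -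
      (∑ j, sampled (fun s => (g s)⁻¹) (k n) j - k n * I)
    have he : ∀ n, ‖e n‖ ≤ K₁ + K₂ := fun n =>
      (norm_sub_le _ _).trans (add_le_add (abs_sum_sampled_sub_le hK₁ n)
        (abs_sum_sampled_sub_le hK₂ (k n)))
    have he0 : Tendsto (fun n => e n * (Real.sqrt n)⁻¹) atTop (𝓝 0) :=
      bdd_le_mul_tendsto_zero' _ (Eventually.of_forall he) hsq
    have h := (he0.sub (hk.const_mul I)).const_mul (Real.sqrt κ)⁻¹
    rw [mul_zero, sub_zero, mul_zero] at h
    refine h.congr fun n => ?_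
    simp only [hinv]
    rw [← Finset.sum_div, ← Finset.sum_div, hσ]
    simp only [e]
    rw [hbal]
    simp only [div_eq_mul_inv, mul_inv]
    ring
  · have h1 := tendsto_sum_sampled_div hK₃
    have h2 := hkc.mul ((tendsto_sum_sampled_div hK₄).comp hkt)
    have h := (h1.add h2).const_mul κ⁻¹
    rw [hκ2, mul_comm 2 κ, inv_mul_cancel_left₀ hκ.ne'] at h
    refine h.congr' ?_
    filter_upwards [eventually_gt_atTop 0, hkt.eventually_gt_atTop 0] with n hn hkn
    have hn' : (0 : ℝ) < n := by exact_mod_cast hn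
    have hk' : (0 : ℝ) < k n := by exact_mod_cast hkn
    simp only [hinv, div_pow]
    rw [← Finset.sum_div, ← Finset.sum_div, Real.sq_sqrt (by positivity)]
    simp only [Function.comp_apply, sampled]
    field_simp
  · refine exists_pow_le_prod (a := (Real.sqrt κ * G)⁻¹) (b := c / 2) (by positivity)
      (by positivity) ?_ ?_ p
    · filter_upwards [hkc.eventually_const_le (half_lt_self hc), eventually_gt_atTop 0] with n h hn
      have hn' : (0 : ℝ) < n := by exact_mod_cast hn
      rwa [le_div_iff₀ hn'] at h
    · filter_upwards [eventually_gt_atTop 0] with n hn j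
      have hn' : (0 : ℝ) < n := by exact_mod_cast hn
      have h0 : 0 < sampled g (k n) j := sampled_mem (p := fun t => 0 < t) hg0 j
      have h1 : sampled g (k n) j ≤ G :=
        (le_abs_self _).trans (sampled_mem (p := fun t => ‖t‖ ≤ G) hG j)
      rw [hσ, div_eq_mul_inv, ← mul_inv]
      refine inv_anti₀ (by positivity) ?_
      calc Real.sqrt κ * Real.sqrt n * sampled g (k n) j ≤ Real.sqrt κ * Real.sqrt n * G := by gcongr
        _ = _ := by ring

/-! ### The limit of the distribution of the first part -/

theorem IsGaussianScaling.tendsto_det {m : ℕ → ℕ} {u : ∀ n, Fin n → ℝ} {y : ∀ n, Fin (m n) → ℝ}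
    (h : IsGaussianScaling m u y) (Δ : ℕ) :
    Tendsto (fun n => (Matrix.of fun a b : Fin Δ => lineIntegral (u n) (y n) 1 ((a : ℤ) - b)).det)
      atTop (𝓝 (criticalDet Δ : ℂ)) := by
  have hdet : (criticalDet Δ : ℂ) =
      (Matrix.of fun a b : Fin Δ => gaussLine ((a : ℤ) - b)).det := by
    rw [criticalDet_eq, ← Complex.ofRealHom_eq_coe, RingHom.map_det]
    congr 1
    ext a b
    simp [gaussLine_eq]
  rw [hdet]
  have hM : Tendsto (fun n => (Matrix.of fun a b : Fin Δ =>
      lineIntegral (u n) (y n) 1 ((a : ℤ) - b) : Matrix (Fin Δ) (Fin Δ) ℂ)) atTop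
      (𝓝 (Matrix.of fun a b : Fin Δ => gaussLine ((a : ℤ) - b))) :=
    tendsto_pi_nhds.2 fun a => tendsto_pi_nhds.2 fun b => h.tendsto_lineIntegral _
  exact ((continuous_id.matrix_det (n := Fin Δ) (R := ℂ)).tendsto _).comp hM

theorem tendsto_dualSchurProb_of_balanced {f g : ℝ → ℝ} {c : ℝ} (hc : 0 < c)
    (hf : ContDiffOn ℝ 1 f (Set.Icc 0 1)) (hf0 : ∀ s ∈ Set.Icc (0 : ℝ) 1, 0 ≤ f s)
    (hg : ContDiffOn ℝ 1 g (Set.Icc 0 1)) (hg0 : ∀ s ∈ Set.Icc (0 : ℝ) 1, 0 < g s)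
    (hbal : (∫ s in (0 : ℝ)..1, f s) = c * ∫ s in (0 : ℝ)..1, 1 / g s)
    {k : ℕ → ℕ} (hk : Tendsto (fun n : ℕ => ((k n : ℝ) - n * c) / Real.sqrt n) atTop (𝓝 0))
    (Δ : ℕ) :
    Tendsto (fun n : ℕ => dualSchurProb (sampled f n) (sampled g (k n))
      (fun lam => firstPart lam + Δ ≤ k n)) atTop (𝓝 (criticalDet Δ)) := by
  simp only [one_div] at hbal
  have hgi : ContinuousOn (fun s => (g s)⁻¹) (Set.Icc 0 1) :=
    hg.continuousOn.inv₀ fun s hs => (hg0 s hs).ne'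
  have hA : 0 ≤ ∫ s in (0 : ℝ)..1, f s ^ 2 :=
    intervalIntegral.integral_nonneg zero_le_one fun s _ => by positivity
  have hB : 0 < ∫ s in (0 : ℝ)..1, (g s)⁻¹ ^ 2 := by
    refine intervalIntegral.intervalIntegral_pos_of_pos_on ?_ ?_ zero_lt_one
    · refine ContinuousOn.intervalIntegrable ?_
      rw [Set.uIcc_of_le zero_le_one]
      exact hgi.pow 2
    · intro s hs
      have := hg0 s (Set.Ioo_subset_Icc_self hs)
      positivity
  obtain ⟨κ, hκ2⟩ : ∃ κ, (∫ s in (0 : ℝ)..1, f s ^ 2) + c * (∫ s in (0 : ℝ)..1, (g s)⁻¹ ^ 2) =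
      2 * κ := ⟨_, (mul_div_cancel₀ _ two_ne_zero).symm⟩
  have hκ : 0 < κ := by
    have := mul_pos hc hB
    linarith
  have h := (isGaussianScaling_sampled hc hκ hf hf0 hg hg0 hbal hκ2 hk).tendsto_det Δ
  obtain ⟨H, hH⟩ := isCompact_Icc.exists_bound_of_continuousOn hgi
  have hre := (Complex.continuous_re.tendsto _).comp h
  rw [Complex.ofReal_re] at hre
  refine hre.congr' ?_
  have hkt := tendsto_atTop_of_tendsto_div hc (tendsto_div_of_sub_div_sqrt hk)
  have hσt : Tendsto (fun n : ℕ => Real.sqrt (κ * n)) atTop atTop :=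
    Real.tendsto_sqrt_atTop.comp (tendsto_natCast_atTop_atTop.const_mul_atTop hκ)
  filter_upwards [hkt.eventually_ge_atTop Δ, hσt.eventually_gt_atTop 0, hσt.eventually_gt_atTop H]
    with n hΔ hσ0 hσH
  have hε : ∀ j, (Real.sqrt (κ * n))⁻¹ < sampled g (k n) j := fun j => by
    have h0 : 0 < sampled g (k n) j := sampled_mem (p := fun t => 0 < t) hg0 j
    have h1 : (sampled g (k n) j)⁻¹ ≤ H :=
      (le_abs_self _).trans (sampled_mem (φ := fun s => (g s)⁻¹) (p := fun t => ‖t‖ ≤ H) hH j)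
    exact (inv_lt_comm₀ hσ0 h0).2 (h1.trans_lt hσH)
  have hdet := dualSchurProb_eq_det_lineIntegral
    (fun i => sampled_mem (n := n) (p := fun t => 0 ≤ t) hf0 i) hΔ (inv_pos.2 hσ0) hε
  simp only [lineIntegral_scale _ _ hσ0] at hdet
  have hσc : ((Real.sqrt (κ * n) : ℝ) : ℂ) ≠ 0 := by exact_mod_cast hσ0.ne'
  have hscale := det_zpow_mul hσc (Matrix.of fun a b : Fin Δ =>
    lineIntegral (fun i => sampled f n i / Real.sqrt (κ * n))
      (fun j => Real.sqrt (κ * n) * sampled g (k n) j) 1 ((a : ℤ) - b))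
  simp only [Matrix.of_apply] at hscale
  rw [hscale] at hdet
  rw [Function.comp_apply, ← hdet, Complex.ofReal_re]

end

theorem theorem3 (f g : ℝ → ℝ) (c : ℝ) (hc : 0 < c)
    (hf : ContDiffOn ℝ ∞ f (Set.Icc 0 1)) (hf0 : ∀ s ∈ Set.Icc (0 : ℝ) 1, 0 ≤ f s)
    (hg : ContDiffOn ℝ ∞ g (Set.Icc 0 1)) (hg0 : ∀ s ∈ Set.Icc (0 : ℝ) 1, 0 < g s) :
    (IsRightEdge f g c c ↔
      (∫ s in (0 : ℝ)..1, f s) = c * (∫ s in (0 : ℝ)..1, 1 / g s)) ∧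
    (IsRightEdge f g c c →
      ∀ k : ℕ → ℕ, Tendsto (fun n : ℕ => ((k n : ℝ) - n * c) / Real.sqrt n) atTop (𝓝 0) →
      ∀ Δ : ℕ,
        Tendsto (fun n : ℕ => dualSchurProb (sampled f n) (sampled g (k n))
            (fun lam => (firstPart lam : ℝ) - k n ≤ -(Δ : ℝ)))
          atTop (𝓝 (criticalDet Δ)) ∧
        ((∀ᶠ n in atTop, k n = ⌊(n : ℝ) * c⌋₊) →
          Tendsto (fun n : ℕ => dualSchurProb (sampled f n) (sampled g (k n))
              (fun lam => (firstPart lam : ℝ) - n * c ≤ -(Δ : ℝ)))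
            atTop (𝓝 (criticalDet Δ)))) := by
  have hedge := isRightEdge_iff hc hf.continuousOn hg.continuousOn hg0
  refine ⟨hedge, fun hright k hk Δ => ?_⟩
  have hlim := tendsto_dualSchurProb_of_balanced hc (hf.of_le (by simp)) hf0
    (hg.of_le (by simp)) hg0 (hedge.1 hright) hk Δ
  refine ⟨hlim.congr fun n => ?_, fun hfloor => hlim.congr' ?_⟩
  · congr 1
    ext lam
    rw [sub_le_iff_le_add, neg_add_eq_sub, le_sub_iff_add_le]
    norm_cast
  · filter_upwards [hfloor] with n hn
    congr 1
    ext lam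
    have hle := Nat.le_floor_iff (n := firstPart lam + Δ) (show 0 ≤ (n : ℝ) * c by positivity)
    rw [← hn, Nat.cast_add] at hle
    rw [sub_le_iff_le_add, neg_add_eq_sub, le_sub_iff_add_le, hle]
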